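/- **Proposition (period integral of the mirror family $\check X_{10,t}$).** Let $x_0,\dots,x_6$ be the homogeneous coordinates of the weighted projective space $\mathbb P(1^6,2)$ over $\mathbb C$ and, for $t\in\mathbb C$, let $\check X_{10,t}\subset\mathbb P(1^6,2)$ be the zero locus of the pfaffians $P_1,\dots,P_5$ of the five $4\times4$ matrices obtained by removing the $i$-th row and column from the skew-symmetric matrix $$N_{10,t}=\begin{pmatrix} 0&tx_4^2&x_0x_1&x_6&t(x_2+x_3)\\ -tx_4^2&0&tx_6&x_2x_3&x_5\\ -x_0x_1&-tx_6&0&tx_5^2&x_4\\ -x_6&-x_2x_3&-tx_5^2&0&t(x_0+x_1)\\ -t(x_2+x_3)&-x_5&-x_4&-t(x_0+x_1)&0 \end{pmatrix}.$$ Let $P_{1,3,4}=x_5$ be the pfaffian of the matrix left after removing rows and columns $1,3,4$, let $$\Omega_0=\frac1{(2\pi i)^6}\,\iota_E(dx_0\wedge\dots\wedge dx_6),\qquad E=\sum_{i=0}^{5}x_i\frac{\partial}{\partial x_i}+2x_6\frac{\partial}{\partial x_6},$$ and let $\alpha=C\cdot\mathrm{Res}\,\dfrac{P_{1,3,4}\,\Omega_0}{P_1P_3P_4}$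 be the residue 3-form on $\check X_{10,t}$, where $C=-1$ (with the sign conventions $dP_1\wedge dP_3\wedge dP_4\wedge\mathrm{Res}=(2\pi i)^3P_{1,3,4}\Omega_0$ and $\mathrm{Pf}(M)=\frac1{8}\sum_{\sigma\in\mathfrak S_4}\mathrm{sign}(\sigma)M_{\sigma(1)\sigma(3)}M_{\sigma(2)\sigma(4)}$; this makes $\Phi_0(0)=1$ below). Let $\varepsilon>0$. Then there is $\delta>0$ such that the torus $|x_2|=|x_3|=|x_5|=\varepsilon$, $x_0=1$, in the component $\{x_1=x_4=x_6=0\}$ of $\check X_{10,0}$, parametrized by the arguments of $(x_2,x_3,x_5)$, extends to a continuous family, over $|t|<\delta$, of continuously differentiable 3-tori $\gamma_t\subset\check X_{10,t}\cap\{x_0=1\}$ on which still $|x_2|=|x_3|=|x_5|=\varepsilon$, parametrized in the same way. For every such family and $|t|<\delta$ we have $\det\frac{\partial(P_1,P_3,P_4)}{\partial(x_1,x_4,x_6)}\ne0$ along $\gamma_t$, and the period $\int_{\gamma_t}\alpha$ is a function of $\phi=t^8$, given by the convergent series $$\int_{\gamma_t}\alpha=\Phi_0(\phi)=\sum_{n=0}^\infty\binom{2n}{n}\sum_{k=0}^{2n}(-1)^{k+n}\binom{2n}{k}^4\phi^n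 .$$ Moreover, with $\Theta=\phi\frac{d}{d\phi}$, the Picard–Fuchs operator of the family for this fundamental period is $$\begin{aligned}\mathscr D_{10}={}&5^2\Theta^4-2^2\cdot5\,\phi(688\Theta^4+1352\Theta^3+981\Theta^2+305\Theta+35)\\&+2^4\phi^2(5856\Theta^4+7008\Theta^3+96\Theta^2-1260\Theta-265)\\&-2^{10}\phi^3(176\Theta^4+120\Theta^3+69\Theta^2+30\Theta+5)+2^{12}\phi^4(2\Theta+1)^4,\end{aligned}$$ that is, $\mathscr D_{10}\Phi_0=0$ near $\phi=0$, no nonzero operator $\sum_j c_j(\phi)\Theta^j$ with $c_j\in\mathbb C[\phi]$ of order less than $4$ annihilates $\Phi_0$, and the coefficients of $\mathscr D_{10}$ in $\mathbb C[\phi]$ have no nonconstant common factor. -/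

import Mathlib

noncomputable section

namespace PfaffianMirror

/-- The pfaffian of a `2r × 2r` skew-symmetric matrix,
`Pf(M) = (1 / (r! 2^r)) ∑_σ sign(σ) ∏_{i=1}^r M_{σ(i) σ(r+i)}`. -/
def pfaffian {R : Type*} [CommRing R] [Algebra ℚ R] (r : ℕ)
    (M : Matrix (Fin (2 * r)) (Fin (2 * r)) R) : R :=
  ((1 : ℚ) / ((r.factorial : ℚ) * 2 ^ r)) •
    ∑ σ : Equiv.Perm (Fin (2 * r)), ((Equiv.Perm.sign σ : ℤ) : R) *
      ∏ i : Fin r, M (σ ⟨i, by omega⟩) (σ ⟨r + i, by omega⟩)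

/-- The homogeneous coordinates `x₀, …, x₆` of the weighted projective space `ℙ(1,1,1,1,1,1,2)`. -/
abbrev x (i : Fin 7) : MvPolynomial (Fin 7) ℂ := MvPolynomial.X i

/-- The weights of the coordinates of `ℙ(1,1,1,1,1,1,2)`. -/
def weight : Fin 7 → ℂ := ![1, 1, 1, 1, 1, 1, 2]

/-- The skew-symmetric matrix `N_{10,t}` which defines the family. -/
def matrixN (t : ℂ) : Matrix (Fin 5) (Fin 5) (MvPolynomial (Fin 7) ℂ) :=
  let τ : MvPolynomial (Fin 7) ℂ := MvPolynomial.C t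
  !![0, τ * x 4 ^ 2, x 0 * x 1, x 6, τ * (x 2 + x 3);
     -(τ * x 4 ^ 2), 0, τ * x 6, x 2 * x 3, x 5;
     -(x 0 * x 1), -(τ * x 6), 0, τ * x 5 ^ 2, x 4;
     -x 6, -(x 2 * x 3), -(τ * x 5 ^ 2), 0, τ * (x 0 + x 1);
     -(τ * (x 2 + x 3)), -x 5, -x 4, -(τ * (x 0 + x 1)), 0]

/-- The pfaffian of the `4 × 4` matrix that is left when row and column `i` of `N_{10,t}` are
removed. Indices start at `0`, so that `P t i` is the pfaffian usually written `P_{i+1}`. -/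
def P (t : ℂ) (i : Fin 5) : MvPolynomial (Fin 7) ℂ :=
  pfaffian 2 ((matrixN t).submatrix i.succAbove i.succAbove)

/-- The pfaffian `P_{1,3,4}`: rows and columns `1, 3, 4` (counted from `1`) are removed, and rows
and columns `2` and `5` are left. -/
def P134 (t : ℂ) : MvPolynomial (Fin 7) ℂ :=
  pfaffian 1 ((matrixN t).submatrix ![1, 4] ![1, 4])

/-- The cone over the pfaffian threefold `X̌_{10,t} ⊆ ℙ(1,1,1,1,1,1,2)`, without its vertex:
the nonzero common zeros of the five pfaffians. -/
def cone (t : ℂ) : Set (Fin 7 → ℂ) :=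
  {p | p ≠ 0 ∧ ∀ i, MvPolynomial.eval p (P t i) = 0}

/-- The form `Ω₀ = (2πi)^{-6} ι_E (dx₀ ∧ ⋯ ∧ dx₆)` at the point `p`, evaluated on six tangent
vectors, where `E = ∑ wᵢ xᵢ ∂/∂xᵢ` is the weighted Euler field. -/
def Omega0 (p : Fin 7 → ℂ) (v : Fin 6 → Fin 7 → ℂ) : ℂ :=
  (1 / (2 * Real.pi * Complex.I) ^ 6) *
    Matrix.det (Matrix.of (Fin.cons (fun k => weight k * p k) v : Fin 7 → Fin 7 → ℂ))

/-- The three equations `P₁, P₃, P₄`, which cut out the threefold where `P_{1,3,4} ≠ 0`. -/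
def eqs (t : ℂ) : Fin 3 → MvPolynomial (Fin 7) ℂ := ![P t 0, P t 2, P t 3]

/-- The number `(dP₁ ∧ dP₃ ∧ dP₄)(w₁, w₂, w₃)` at the point `p`. -/
def dEqs (t : ℂ) (p : Fin 7 → ℂ) (w : Fin 3 → Fin 7 → ℂ) : ℂ :=
  Matrix.det (Matrix.of fun i j : Fin 3 =>
    ∑ k, MvPolynomial.eval p (MvPolynomial.pderiv k (eqs t i)) * w j k)

/-- The Poincaré residue `Res (P_{1,3,4} Ω₀ / (P₁ P₃ P₄))` at the point `p`, evaluated on three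
tangent vectors `u` of the threefold. It is the form `ρ` with
`dP₁ ∧ dP₃ ∧ dP₄ ∧ ρ = (2πi)³ P_{1,3,4} Ω₀`, that is, with
`(dP₁ ∧ dP₃ ∧ dP₄)(w) ρ(u) = (2πi)³ P_{1,3,4} Ω₀(w, u)` for every triple `w` of vectors; the
right-hand side below does not depend on the triple `w` with `(dP₁ ∧ dP₃ ∧ dP₄)(w) ≠ 0`. -/
def residue (t : ℂ) (p : Fin 7 → ℂ) (w u : Fin 3 → Fin 7 → ℂ) : ℂ :=
  (2 * Real.pi * Complex.I) ^ 3 * MvPolynomial.eval p (P134 t) *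
    Omega0 p ![w 0, w 1, w 2, u 0, u 1, u 2] / dEqs t p w

/-- The coordinate vectors `∂/∂x₁, ∂/∂x₄, ∂/∂x₆`, which span a complement of the space
`{x₁ = x₄ = x₆ = 0}`. -/
def normalFrame : Fin 3 → Fin 7 → ℂ := ![Pi.single 1 1, Pi.single 4 1, Pi.single 6 1]

/-- The holomorphic 3-form `α = C · Res (P_{1,3,4} Ω₀ / (P₁ P₃ P₄))` on the threefold. The constant
`C = -1` normalizes the fundamental period to have constant term `1`. -/
def alpha (t : ℂ) (p : Fin 7 → ℂ) (u : Fin 3 → Fin 7 → ℂ) : ℂ :=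
  -residue t p normalFrame u

/-- `γ` is the continuous family, over the disc `|t| < δ`, of 3-dimensional tori
`γ_t ⊆ X̌_{10,t} ∩ {x₀ = 1}` on which `|x₂| = |x₃| = |x₅| = ε`, parametrized by the arguments of
`x₂, x₃, x₅`, and which extends the torus `|x₂/x₀| = |x₃/x₀| = |x₅/x₀| = ε` of the component
`{x₁ = x₄ = x₆ = 0}` of the central fibre `X̌_{10,0}`. -/
structure IsTorusCycle (ε δ : ℝ) (γ : ℂ → (Fin 3 → ℝ) → Fin 7 → ℂ) : Prop where
  continuousOn : ContinuousOn (fun q : ℂ × (Fin 3 → ℝ) => γ q.1 q.2)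
    (Metric.ball 0 δ ×ˢ Set.univ)
  contDiff : ∀ t ∈ Metric.ball (0 : ℂ) δ, ContDiff ℝ 1 (γ t)
  periodic : ∀ t ∈ Metric.ball (0 : ℂ) δ, ∀ θ j,
    γ t (Function.update θ j (θ j + 2 * Real.pi)) = γ t θ
  mem_cone : ∀ t ∈ Metric.ball (0 : ℂ) δ, ∀ θ, γ t θ ∈ cone t
  x0 : ∀ t ∈ Metric.ball (0 : ℂ) δ, ∀ θ, γ t θ 0 = 1
  x2 : ∀ t ∈ Metric.ball (0 : ℂ) δ, ∀ θ, γ t θ 2 = ε * Complex.exp (θ 0 * Complex.I)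
  x3 : ∀ t ∈ Metric.ball (0 : ℂ) δ, ∀ θ, γ t θ 3 = ε * Complex.exp (θ 1 * Complex.I)
  x5 : ∀ t ∈ Metric.ball (0 : ℂ) δ, ∀ θ, γ t θ 5 = ε * Complex.exp (θ 2 * Complex.I)
  central : ∀ θ, γ 0 θ 1 = 0 ∧ γ 0 θ 4 = 0 ∧ γ 0 θ 6 = 0

/-- The integral of the 3-form `α` of the fibre over `t` along the parametrized torus `c`. -/
def period (t : ℂ) (c : (Fin 3 → ℝ) → Fin 7 → ℂ) : ℂ :=
  ∫ θ in Set.Icc (0 : Fin 3 → ℝ) (fun _ => 2 * Real.pi),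
    alpha t (c θ) (fun j k => deriv (fun s : ℝ => c (Function.update θ j s) k) (θ j))

/-- The integers `binom(2n,n) ∑_{k=0}^{2n} (-1)^{k+n} binom(2n,k)^4`. -/
def periodCoeff (n : ℕ) : ℤ :=
  ((2 * n).choose n : ℤ) *
    ∑ k ∈ Finset.range (2 * n + 1), (-1) ^ (k + n) * ((2 * n).choose k : ℤ) ^ 4

/-- The Euler operator `Θ = φ d/dφ`. -/
def theta (f : ℂ → ℂ) : ℂ → ℂ := fun φ => φ * deriv f φ

/-- A linear differential operator `∑ⱼ cⱼ(φ) Θ^j` with polynomial coefficients (written to the left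
of the powers of `Θ`), recorded as the polynomial in `Θ` with the coefficients `cⱼ ∈ ℂ[φ]`. -/
abbrev DiffOp := Polynomial (Polynomial ℂ)

/-- The function `L f`. -/
def DiffOp.apply (L : DiffOp) (f : ℂ → ℂ) : ℂ → ℂ :=
  fun φ => L.sum fun j c => c.eval φ * (theta^[j] f) φ

/-- `L f = 0` near `φ = 0`. -/
def DiffOp.Annihilates (L : DiffOp) (f : ℂ → ℂ) : Prop :=
  ∀ᶠ φ in nhds (0 : ℂ), L.apply f φ = 0

/-- `L` is the Picard-Fuchs operator of the period function `f`, unique up to a nonzero constant: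
it is the operator of least order that annihilates `f`, with denominators and common factors
cleared. -/
structure IsPicardFuchs (L : DiffOp) (f : ℂ → ℂ) : Prop where
  ne_zero : L ≠ 0
  annihilates : L.Annihilates f
  minimal : ∀ L' : DiffOp, L' ≠ 0 → L'.Annihilates f → L.natDegree ≤ L'.natDegree
  primitive : L.IsPrimitive

/-- The operator `𝒟₁₀`. -/
def D10 : DiffOp :=
  let Θ : DiffOp := Polynomial.X
  let φ : DiffOp := Polynomial.C Polynomial.X
  5 ^ 2 * Θ ^ 4
    - 2 ^ 2 * 5 * φ * (688 * Θ ^ 4 + 1352 * Θ ^ 3 + 981 * Θ ^ 2 + 305 * Θ + 35)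
    + 2 ^ 4 * φ ^ 2 * (5856 * Θ ^ 4 + 7008 * Θ ^ 3 + 96 * Θ ^ 2 - 1260 * Θ - 265)
    - 2 ^ 10 * φ ^ 3 * (176 * Θ ^ 4 + 120 * Θ ^ 3 + 69 * Θ ^ 2 + 30 * Θ + 5)
    + 2 ^ 12 * φ ^ 4 * (2 * Θ + 1) ^ 4

end PfaffianMirror

end

/-! Geometry. On the chart x₀ = 1 with x₂, x₃, x₅ ≠ 0, syzygies make P₂ and P₅ consequences of P₁,
P₃, P₄. For fixed (x₂, x₃, x₅), these three equations in (b, a, c) = (x₄, x₁, x₆) form a fixed point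
system `v = sysMap p v`, whose parameters p tend to 0 with t on the torus. `sysMap p` contracts the
unit ball, so it has there a unique fixed point `sol p`, and `sol` is C¹. This gives the tori. Any
other family starts at 0 and is trapped in the ball by continuity in t, so it is the same one
(`IsTorusCycle.eq_solCycle`). On it α equals (2πi)⁻³ dx₂dx₃dx₅ / (x₂x₃x₅ J) with J = `sysJac`, and
the period is the mean of 1/J over the torus.

Expansion. The value 1/J at the solution is (2πi)⁻³ times the integral of ∏ (vᵢ - `sysMap p v i`)⁻¹
over the unit torus in (b, a, c) (`torusIntegral_sysInv`). Geometric series, and constant terms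
first in (b, a, c) and then in (x₂, x₃, x₅), leave only the exponents `balancedIdx (m, r)`, which
carry t^(8(m+r)). With n = m + r the coefficient of t^(8n) is the sum over m of C(2n,n)² C(2n+m,n)
C(2n,n-m) C(n,m). Vandermonde's and Dixon's identities turn it into the stated alternating sum
(`periodCoeff_eq_sum`).

Differential equation. Creative telescoping gives a recurrence of order two for the alternating sum
(`altSum_recurrence`). A combination of three of its shifts is the recurrence of order four encoded
by `D10` (`periodCoeff_recurrence`).

Minimality. If an operator of order less than 4 annihilated the period, one of least order, M, would
be a right factor of `D10` up to a polynomial factor, by division with remainder in the Weyl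
algebra. Its local exponents are among those of `D10`: all 0 at 0, all 1/2 at ∞, natural numbers
elsewhere. For M of order r + 1 and with nₚ the sum of its exponents at p, Fuchs' relation reads
(r+1)/2 = ∑_{p≠0} (C(r+1,2) - nₚ). Integrality forces order 2. Then every term is at most 0, as at
most one exponent at p vanishes, a contradiction (`WeylOp.no_right_factor`). -/

namespace PfaffianMirror

/-! ### The period coefficients as sums of positive terms: Dixon and Vandermonde -/

open Finset

/-- The reciprocal factorial `1 / k!`, which is zero at the negative integers. -/
def invFact (k : ℤ) : ℚ := if 0 ≤ k then 1 / (k.toNat.factorial : ℚ) else 0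

theorem invFact_natCast (n : ℕ) : invFact n = 1 / (n.factorial : ℚ) := by
  simp [invFact]

theorem invFact_of_neg {k : ℤ} (hk : k < 0) : invFact k = 0 := by
  simp [invFact, hk]

/-- Holds for all integers, with both sides zero for k ≤ 0, so that the telescoping arguments below
need no boundary cases. -/
theorem mul_invFact (k : ℤ) : (k : ℚ) * invFact k = invFact (k - 1) := by
  rcases lt_trichotomy k 0 with hk | rfl | hk
  · rw [invFact_of_neg hk, invFact_of_neg (by omega), mul_zero]
  · simp [invFact]
  · obtain ⟨n, rfl⟩ : ∃ n : ℕ, k = (n : ℤ) + 1 := ⟨(k - 1).toNat, by omega⟩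
    rw [add_sub_cancel_right, invFact_natCast, ← Nat.cast_succ, invFact_natCast,
      Nat.factorial_succ]
    push_cast
    have : (n.factorial : ℚ) ≠ 0 := by positivity
    field_simp

theorem invFact_eq (k : ℤ) : invFact k = ((k : ℚ) + 1) * invFact (k + 1) := by
  have := mul_invFact (k + 1)
  rw [add_sub_cancel_right] at this
  rw [← this]
  push_cast
  ring

theorem invFact_eq_add_two (k : ℤ) :
    invFact k = ((k : ℚ) + 1) * ((k : ℚ) + 2) * invFact (k + 2) := by
  rw [invFact_eq k, invFact_eq (k + 1), show k + 1 + 1 = k + 2 by ring]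
  push_cast
  ring

theorem choose_eq_invFact (a b : ℕ) :
    (a.choose b : ℚ) = (a.factorial : ℚ) * invFact b * invFact ((a : ℤ) - b) := by
  by_cases h : b ≤ a
  · rw [show (a : ℤ) - b = ((a - b : ℕ) : ℤ) by omega, invFact_natCast, invFact_natCast,
      Nat.cast_choose ℚ h]
    field_simp
  · rw [invFact_of_neg (k := (a : ℤ) - b) (by omega), Nat.choose_eq_zero_of_lt (by omega)]
    simp

/-- Dixon's identity, divided by factorials. -/
theorem dixon_sum (n m : ℕ) :
    ∑ j ∈ range (2 * n + 1), (-1 : ℚ) ^ j * invFact j ^ 2 * invFact (2 * n - j) ^ 2 *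
        invFact (m + n - j) * invFact (m - n + j) =
      (-1) ^ n * ((2 * n + m).factorial : ℚ) * invFact n ^ 2 * invFact m * invFact (2 * n) *
        invFact (n + m) ^ 2 := by
  induction m with
  | zero =>
    -- For m = 0 the factors 1/(n-j)! and 1/(j-n)! leave only j = n.
    rw [sum_eq_single n]
    · have h2 : invFact (2 * (n : ℤ)) = 1 / ((2 * n).factorial : ℚ) := by
        exact_mod_cast invFact_natCast (2 * n)
      have h0 : invFact 0 = 1 := by simp [invFact]
      rw [show (2 * n : ℤ) - n = n by ring]
      simp only [Nat.cast_zero, zero_add, sub_self, neg_add_cancel, zero_sub, h0, h2, add_zero]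
      have : ((2 * n).factorial : ℚ) ≠ 0 := by positivity
      field_simp
    · intro j _ hj
      rcases lt_or_gt_of_ne hj with h | h
      · rw [invFact_of_neg (k := ((0 : ℕ) : ℤ) - n + j) (by push_cast; omega)]; ring
      · rw [invFact_of_neg (k := ((0 : ℕ) : ℤ) + n - j) (by push_cast; omega)]; ring
    · intro h; simp at h; omega
  | succ m ih =>
    -- Zeilberger's certificate for the recurrence in m stated in `key`. G vanishes at j = 0 by the
    -- factor j², and at j = 2n + 1 by the reciprocal factorial of -1.
    set G : ℕ → ℚ := fun j => (-1 : ℚ) ^ j * (-1 / 2) * (j : ℚ) ^ 2 * ((m : ℚ) + 1 - n + j) *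
      (invFact j ^ 2 * invFact (2 * n - j) ^ 2 *
        invFact ((m + 1 : ℕ) + n - j) * invFact ((m + 1 : ℕ) - n + j)) with hG
    have key : ∀ j : ℕ,
        ((m : ℚ) + 1) * ((n : ℚ) + m + 1) ^ 2 *
          ((-1 : ℚ) ^ j * invFact j ^ 2 * invFact (2 * n - j) ^ 2 *
            invFact ((m + 1 : ℕ) + n - j) * invFact ((m + 1 : ℕ) - n + j)) -
        ((2 * n : ℚ) + m + 1) * ((-1 : ℚ) ^ j * invFact j ^ 2 * invFact (2 * n - j) ^ 2 *
            invFact (m + n - j) * invFact (m - n + j)) = G (j + 1) - G j := by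
      intro j
      have e1 : invFact (m + n - j) = ((m : ℚ) + n - j + 1) * invFact ((m + 1 : ℕ) + n - j) := by
        rw [invFact_eq]; push_cast; ring_nf
      have e2 : invFact (m - n + j) = ((m : ℚ) - n + j + 1) * invFact ((m + 1 : ℕ) - n + j) := by
        rw [invFact_eq]; push_cast; ring_nf
      have e3 : invFact (2 * n - ((j + 1 : ℕ) : ℤ)) = ((2 * n : ℚ) - j) * invFact (2 * n - j) := by
        have := mul_invFact (2 * n - j)
        push_cast at this ⊢
        rw [this]; ring_nf
      have e4 : ((j : ℚ) + 1) * invFact ((j + 1 : ℕ) : ℤ) = invFact j := by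
        have := mul_invFact (j + 1)
        push_cast at this ⊢
        rw [this]; ring_nf
      have e5 : invFact ((m + 1 : ℕ) + n - ((j + 1 : ℕ) : ℤ)) =
          ((m : ℚ) + 1 + n - j) * invFact ((m + 1 : ℕ) + n - j) := by
        have := mul_invFact ((m + 1 : ℕ) + n - j)
        push_cast at this ⊢
        rw [this]; ring_nf
      have e6 : ((m : ℚ) + 1 - n + (j + 1 : ℕ)) *
          invFact ((m + 1 : ℕ) - n + ((j + 1 : ℕ) : ℤ)) = invFact ((m + 1 : ℕ) - n + j) := by
        have := mul_invFact ((m + 1 : ℕ) - n + ((j + 1 : ℕ) : ℤ))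
        push_cast at this ⊢
        rw [this]; ring_nf
      have hG1 : G (j + 1) = (-1 : ℚ) ^ j * (1 / 2) *
          (((j : ℚ) + 1) * invFact ((j + 1 : ℕ) : ℤ)) ^ 2 *
          invFact (2 * n - ((j + 1 : ℕ) : ℤ)) ^ 2 *
          invFact ((m + 1 : ℕ) + n - ((j + 1 : ℕ) : ℤ)) *
          (((m : ℚ) + 1 - n + (j + 1 : ℕ)) *
            invFact ((m + 1 : ℕ) - n + ((j + 1 : ℕ) : ℤ))) := by
        rw [hG]; simp only [pow_succ]; push_cast; ring
      rw [hG1, e3, e4, e5, e6, e1, e2, hG]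
      ring
    have hsum : ∑ j ∈ range (2 * n + 1), (G (j + 1) - G j) = 0 := by
      rw [sum_range_sub]
      have : invFact (2 * n - ((2 * n + 1 : ℕ) : ℤ)) = 0 := invFact_of_neg (by push_cast; omega)
      simp only [hG, this]
      simp
    rw [← sum_congr rfl fun j _ => key j, sum_sub_distrib, ← mul_sum, ← mul_sum, ih,
      sub_eq_zero] at hsum
    have e1 : invFact (m : ℤ) = ((m : ℚ) + 1) * invFact ((m + 1 : ℕ) : ℤ) := by
      rw [invFact_eq]; push_cast; ring
    have e2 : invFact (n + m : ℤ) = ((n : ℚ) + m + 1) * invFact (n + ((m + 1 : ℕ) : ℤ)) := by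
      rw [invFact_eq]; push_cast; ring_nf
    rw [e1, e2] at hsum
    have h0 : ((m : ℚ) + 1) * ((n : ℚ) + m + 1) ^ 2 ≠ 0 := by positivity
    refine mul_left_cancel₀ h0 (hsum.trans ?_)
    rw [show 2 * n + (m + 1) = (2 * n + m) + 1 by ring, Nat.factorial_succ]
    push_cast
    ring

/-- With i = n - m the summand is C(2n-j,i) C(j,i) up to the factor (2n-j)! j!, so Vandermonde's
convolution gives C(2n,j). -/
theorem vandermonde_sum {n j : ℕ} (hj : j ≤ 2 * n) :
    ∑ m ∈ range (n + 1), invFact (n - m) ^ 2 * invFact (m + n - j) * invFact (m - n + j) =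
      ((2 * n).factorial : ℚ) * invFact j ^ 2 * invFact (2 * n - j) ^ 2 := by
  have h1 : ∑ i ∈ range (n + 1), (2 * n - j).choose i * j.choose i = (2 * n).choose j := by
    have := Nat.add_choose_eq (2 * n - j) j j
    rw [Nat.sub_add_cancel hj, Nat.sum_antidiagonal_eq_sum_range_succ
      (fun a b => (2 * n - j).choose a * j.choose b)] at this
    rw [this]
    have h2 : ∀ i ∈ range j.succ, (2 * n - j).choose i * j.choose (j - i) =
        (2 * n - j).choose i * j.choose i := fun i hi => by
      rw [Nat.choose_symm (by simp at hi; omega)]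
    rw [sum_congr rfl h2]
    -- The summation ranges i ≤ j and i ≤ n agree: the product of binomials is zero for i > min(n,
    -- j), as 2n - j ≤ n when n ≤ j.
    have h3 : ∀ N, n ≤ N → j ≤ N →
        ∑ i ∈ range (N + 1), (2 * n - j).choose i * j.choose i =
          ∑ i ∈ range (min n j + 1), (2 * n - j).choose i * j.choose i := by
      intro N _ _
      symm
      apply sum_subset
      · intro i; simp; omega
      · intro i _ hi
        simp only [mem_range, not_lt] at hi
        rcases le_total n j with h | h
        · rw [Nat.choose_eq_zero_of_lt (n := 2 * n - j) (by omega), zero_mul]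
        · rw [Nat.choose_eq_zero_of_lt (n := j) (by omega), mul_zero]
    rcases le_total n j with h | h
    · rw [Nat.succ_eq_add_one, h3 j h le_rfl, min_eq_left h]
    · rw [h3 n le_rfl h, min_eq_right h]
  have h1' : ∑ i ∈ range (n + 1), ((2 * n - j).choose i : ℚ) * (j.choose i : ℚ) =
      (2 * n).choose j := by exact_mod_cast h1
  rw [← sum_range_reflect] at h1'
  have h4 : ∀ m ∈ range (n + 1), ((2 * n - j).choose (n + 1 - 1 - m) : ℚ) *
      (j.choose (n + 1 - 1 - m) : ℚ) = ((2 * n - j).factorial : ℚ) * (j.factorial : ℚ) *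
      (invFact (n - m) ^ 2 * invFact (m + n - j) * invFact (m - n + j)) := by
    intro m hm
    have hm' : m ≤ n := by simp at hm; omega
    rw [choose_eq_invFact, choose_eq_invFact,
      show ((n + 1 - 1 - m : ℕ) : ℤ) = n - m by omega,
      show ((2 * n - j : ℕ) : ℤ) - (n - m) = m + n - j by omega,
      show (j : ℤ) - (n - m) = m - n + j by ring]
    ring
  rw [sum_congr rfl h4, ← mul_sum, choose_eq_invFact] at h1'
  have e1 := invFact_natCast j
  have e2 : invFact (2 * n - j) = 1 / ((2 * n - j).factorial : ℚ) := by
    rw [← invFact_natCast]; congr 1; omega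
  push_cast at h1'
  rw [e1, e2] at h1' ⊢
  have f1 : ((j.factorial : ℕ) : ℚ) ≠ 0 := by positivity
  have f2 : (((2 * n - j).factorial : ℕ) : ℚ) ≠ 0 := by positivity
  field_simp at h1' ⊢
  linear_combination h1'

/-- The summand of the expansion of the alternating sum of fourth powers with positive terms. -/
def posTerm (n m : ℕ) : ℚ :=
  ((2 * n + m).factorial : ℚ) * invFact m * invFact (n + m) ^ 2 * invFact (n - m) ^ 2

/-- The alternating sum of fourth powers of binomial coefficients. -/
def altSum (n : ℕ) : ℚ :=
  ∑ k ∈ range (2 * n + 1), (-1) ^ (k + n) * ((2 * n).choose k : ℚ) ^ 4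

/-- In C(2n,j)⁴ a factor (2n)!/(j!(2n-j)!)² is replaced by the sum over m of `vandermonde_sum`.
After exchanging the sums, the inner sum over j is Dixon's. -/
theorem altSum_eq (n : ℕ) :
    altSum n = ((2 * n).factorial : ℚ) ^ 2 * invFact n ^ 2 *
      ∑ m ∈ range (n + 1), posTerm n m := by
  have hf : ((2 * n).factorial : ℚ) * invFact (2 * n) = 1 := by
    have : invFact (2 * (n : ℤ)) = 1 / ((2 * n).factorial : ℚ) := by
      exact_mod_cast invFact_natCast (2 * n)
    rw [this]
    have : ((2 * n).factorial : ℚ) ≠ 0 := by positivity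
    field_simp
  have h1 : ∀ m ∈ range (n + 1), ((2 * n).factorial : ℚ) ^ 2 * invFact n ^ 2 * posTerm n m =
      ((2 * n).factorial : ℚ) ^ 3 * (-1) ^ n * (invFact (n - m) ^ 2 *
        ∑ j ∈ range (2 * n + 1), (-1 : ℚ) ^ j * invFact j ^ 2 * invFact (2 * n - j) ^ 2 *
          invFact (m + n - j) * invFact (m - n + j)) := by
    intro m _
    have h : ((-1 : ℚ) ^ n) * (-1) ^ n = 1 := by rw [← mul_pow]; simp
    rw [dixon_sum, posTerm]
    linear_combination (-(((2 * n).factorial : ℚ) ^ 3 * invFact (n - m) ^ 2 *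
      ((2 * n + m).factorial : ℚ) * invFact n ^ 2 * invFact m * invFact (2 * n) *
        invFact (n + m) ^ 2)) * h - (((2 * n).factorial : ℚ) ^ 2 * invFact (n - m) ^ 2 *
      ((2 * n + m).factorial : ℚ) * invFact n ^ 2 * invFact m * invFact (n + m) ^ 2) * hf
  rw [mul_sum, sum_congr rfl h1, ← mul_sum]
  simp_rw [mul_sum]
  rw [sum_comm, altSum]
  refine sum_congr rfl fun j hj => ?_
  have hj' : j ≤ 2 * n := by simp at hj; omega
  have h2 := vandermonde_sum hj'
  rw [choose_eq_invFact]
  push_cast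
  calc _ = ((2 * n).factorial : ℚ) ^ 3 * (-1) ^ n * ((-1) ^ j * invFact j ^ 2 *
        invFact (2 * n - j) ^ 2) * (((2 * n).factorial : ℚ) * invFact j ^ 2 *
          invFact (2 * n - j) ^ 2) := by rw [pow_add]; ring
    _ = _ := by
      rw [← h2, mul_sum]
      exact sum_congr rfl fun m _ => by ring

theorem periodCoeff_eq_altSum (n : ℕ) :
    (periodCoeff n : ℚ) = ((2 * n).choose n : ℚ) * altSum n := by
  simp [periodCoeff, altSum]

/-- The form in which the coefficient comes out of the torus integral, with n - m in the role of the
index r there. -/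
theorem periodCoeff_eq_sum (n : ℕ) :
    periodCoeff n = ∑ m ∈ range (n + 1), ((2 * n).choose n : ℤ) ^ 2 *
      ((2 * n + m).choose n * (2 * n).choose (n - m) * n.choose m) := by
  have : (periodCoeff n : ℚ) = ((∑ m ∈ range (n + 1), ((2 * n).choose n : ℤ) ^ 2 *
      ((2 * n + m).choose n * (2 * n).choose (n - m) * n.choose m) : ℤ) : ℚ) := by
    rw [periodCoeff_eq_altSum, altSum_eq]
    push_cast
    rw [mul_sum, mul_sum]
    refine sum_congr rfl fun m hm => ?_
    have hm' : m ≤ n := by simp at hm; omega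
    have hn : (n.factorial : ℚ) * invFact n = 1 := by
      rw [invFact_natCast]
      have : (n.factorial : ℚ) ≠ 0 := by positivity
      field_simp
    simp only [choose_eq_invFact, posTerm]
    rw [show ((n - m : ℕ) : ℤ) = n - m by omega, show ((2 * n : ℕ) : ℤ) - (n - m) = n + m by
      push_cast; ring, show ((2 * n : ℕ) : ℤ) - n = n by push_cast; ring,
      show ((2 * n + m : ℕ) : ℤ) - n = n + m by push_cast; ring]
    linear_combination (-(((2 * n).factorial : ℚ) * invFact n * invFact n) ^ 2 *
      (((2 * n + m).factorial : ℚ) * invFact (n + m)) * ((2 * n).factorial : ℚ) *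
      invFact (n - m) * invFact (n + m) * invFact m * invFact (n - m)) * hn
  exact_mod_cast this

end PfaffianMirror

/-! ### Recurrences by creative telescoping -/

namespace PfaffianMirror

open Finset

/-- The coefficient of `altSum n` in its recurrence. -/
def recCoeff0 (n : ℚ) : ℚ := 4 * (n + 1) * (2 * n + 1) ^ 3 * (48 * n ^ 2 + 162 * n + 137)

/-- The coefficient of `altSum (n + 1)` in its recurrence. -/
def recCoeff1 (n : ℚ) : ℚ :=
  -13056 * n ^ 6 - 96288 * n ^ 5 - 289600 * n ^ 4 - 453428 * n ^ 3 - 388698 * n ^ 2 - 172598 *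
  n - 31030

/-- The coefficient of `altSum (n + 2)` in its recurrence. -/
def recCoeff2 (n : ℚ) : ℚ := (n + 2) ^ 3 * (2 * n + 3) * (48 * n ^ 2 + 66 * n + 23)

/-- The polynomial part of the telescoping certificate for the recurrence of `altSum`. -/
def certPoly (n m : ℚ) : ℚ :=
  (-220416 * n ^ 11 - 2482656 * n ^ 10 - 12393136 * n ^ 9 - 36182552 * n ^ 8 - 68642820 * n ^
  7 - 88860540 * n ^ 6 - 80120524 * n ^ 5 - 50338158 * n ^ 4 - 21609796 * n ^ 3 - 6041106 * n
  ^ 2 - 990552 * n - 72232) +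
  (-465408 * n ^ 10 - 5032128 * n ^ 9 - 23662656 * n ^ 8 - 63761008 * n ^ 7 - 109104696 * n ^
  6 - 123998904 * n ^ 5 - 94908726 * n ^ 4 - 48377132 * n ^ 3 - 15740766 * n ^ 2 - 2956988 * n
  - 243928) * m +
  (-128256 * n ^ 9 - 1716960 * n ^ 8 - 8830384 * n ^ 7 - 24084632 * n ^ 6 - 39280404 * n ^ 5 -
  40250084 * n ^ 4 - 26142744 * n ^ 3 - 10446544 * n ^ 2 - 2342248 * n - 225422) * m ^ 2 +
  (211968 * n ^ 8 + 1437312 * n ^ 7 + 3970752 * n ^ 6 + 5736096 * n ^ 5 + 4593328 * n ^ 4 +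
  1934400 * n ^ 3 + 303264 * n ^ 2 - 42844 * n - 14910) * m ^ 3 +
  (103680 * n ^ 7 + 717024 * n ^ 6 + 2041968 * n ^ 5 + 3099640 * n ^ 4 + 2709396 * n ^ 3 +
  1366148 * n ^ 2 + 368908 * n + 41282) * m ^ 4 +
  (1536 * n ^ 6 + 10560 * n ^ 5 + 29440 * n ^ 4 + 42320 * n ^ 3 + 32712 * n ^ 2 + 12680 * n +
  1918) * m ^ 5 +
  (-768 * n ^ 5 - 4128 * n ^ 4 - 8336 * n ^ 3 - 7816 * n ^ 2 - 3388 * n - 548) * m ^ 6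

/-- The telescoping relation for `posTerm`, divided by the common hypergeometric factor. -/
theorem certPoly_identity (n m : ℚ) :
    recCoeff0 n * ((n + m + 1) * (n + m + 2) * (n - m + 1) * (n - m + 2)) ^ 2 +
      recCoeff1 n * (4 * (2 * n + 1) ^ 2) *
        ((2 * n + m + 1) * (2 * n + m + 2) * ((n + m + 2) * (n - m + 2)) ^ 2) +
      recCoeff2 n * (16 * (2 * n + 1) ^ 2 * (2 * n + 3) ^ 2) *
        ((2 * n + m + 1) * (2 * n + m + 2) * (2 * n + m + 3) * (2 * n + m + 4)) =
      certPoly n (m + 1) * (2 * n + m + 1) * (n + 2 - m) ^ 2 -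
        certPoly n m * m * (n + 2 + m) ^ 2 := by
  unfold recCoeff0 recCoeff1 recCoeff2 certPoly
  ring

theorem posTerm_eq_zero {n m : ℕ} (h : n < m) : posTerm n m = 0 := by
  rw [posTerm, invFact_of_neg (k := (n : ℤ) - m) (by omega)]
  ring

/-- The factors 4(2n+1)² and 16(2n+1)²(2n+3)² are the quotients of the prefactors ((2n)!/n!)² in
`altSum_eq`. The common range costs nothing, since `posTerm n m` vanishes for m > n. -/
theorem posTerm_recurrence (n : ℕ) :
    recCoeff0 n * ∑ m ∈ range (n + 3), posTerm n m +
      recCoeff1 n * (4 * (2 * n + 1) ^ 2) * ∑ m ∈ range (n + 3), posTerm (n + 1) m +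
      recCoeff2 n * (16 * (2 * n + 1) ^ 2 * (2 * n + 3) ^ 2) *
        ∑ m ∈ range (n + 3), posTerm (n + 2) m = 0 := by
  -- The three terms `posTerm n m`, `posTerm (n+1) m` and `posTerm (n+2) m` are polynomial multiples
  -- of B m.
  set B : ℕ → ℚ := fun m => ((2 * n + m).factorial : ℚ) * invFact m *
    invFact (n + m + 2) ^ 2 * invFact (n - m + 2) ^ 2 with hB
  set G : ℕ → ℚ := fun m => certPoly n m * m * (n + 2 + m) ^ 2 * B m with hG
  have key : ∀ m : ℕ, recCoeff0 n * posTerm n m +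
      recCoeff1 n * (4 * (2 * n + 1) ^ 2) * posTerm (n + 1) m +
      recCoeff2 n * (16 * (2 * n + 1) ^ 2 * (2 * n + 3) ^ 2) * posTerm (n + 2) m =
      G (m + 1) - G m := by
    intro m
    have e0 : posTerm n m =
        ((n + m + 1) * (n + m + 2) * (n - m + 1) * (n - m + 2) : ℚ) ^ 2 * B m := by
      rw [posTerm, invFact_eq_add_two (n + m), invFact_eq_add_two (n - m), hB]
      push_cast
      ring
    have e1 : posTerm (n + 1) m =
        ((2 * n + m + 1) * (2 * n + m + 2) * ((n + m + 2) * (n - m + 2)) ^ 2 : ℚ) * B m := by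
      rw [posTerm, invFact_eq ((n + 1 : ℕ) + m), invFact_eq ((n + 1 : ℕ) - m), hB,
        show 2 * (n + 1) + m = 2 * n + m + 1 + 1 by ring, Nat.factorial_succ, Nat.factorial_succ,
        show (((n + 1 : ℕ) : ℤ) + m + 1) = n + m + 2 by push_cast; ring,
        show (((n + 1 : ℕ) : ℤ) - m + 1) = n - m + 2 by push_cast; ring]
      push_cast
      ring
    have e2 : posTerm (n + 2) m =
        ((2 * n + m + 1) * (2 * n + m + 2) * (2 * n + m + 3) * (2 * n + m + 4) : ℚ) * B m := by
      rw [posTerm, hB, show 2 * (n + 2) + m = 2 * n + m + 1 + 1 + 1 + 1 by ring,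
        Nat.factorial_succ, Nat.factorial_succ, Nat.factorial_succ, Nat.factorial_succ,
        show (((n + 2 : ℕ) : ℤ) + m) = n + m + 2 by push_cast; ring,
        show (((n + 2 : ℕ) : ℤ) - m) = n - m + 2 by push_cast; ring]
      push_cast
      ring
    have e3 : G (m + 1) = certPoly n (m + 1) * (2 * n + m + 1) * (n + 2 - m) ^ 2 * B m := by
      have h1 := mul_invFact ((m + 1 : ℕ) : ℤ)
      have h2 := mul_invFact (n + (m + 1 : ℕ) + 2)
      have h3 := mul_invFact (n - m + 2)
      rw [show ((m + 1 : ℕ) : ℤ) - 1 = m by push_cast; ring] at h1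
      rw [show (n : ℤ) + (m + 1 : ℕ) + 2 - 1 = n + m + 2 by push_cast; ring] at h2
      rw [show (n : ℤ) - m + 2 - 1 = n - (m + 1 : ℕ) + 2 by push_cast; ring] at h3
      simp only [hG, hB]
      rw [← h1, ← h2, ← h3, show 2 * n + (m + 1) = 2 * n + m + 1 by ring, Nat.factorial_succ]
      push_cast
      ring
    rw [e0, e1, e2, e3]
    linear_combination B m * certPoly_identity n m
  rw [mul_sum, mul_sum, mul_sum, ← sum_add_distrib, ← sum_add_distrib,
    sum_congr rfl fun m _ => key m, sum_range_sub]
  -- The upper end of the telescoping sum vanishes by this factor, the lower end by the factor m of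
  -- G.
  have : invFact (n - (n + 3 : ℕ) + 2) = 0 := invFact_of_neg (by push_cast; omega)
  simp only [hG, hB, this]
  simp

theorem altSum_recurrence (n : ℕ) :
    recCoeff0 n * altSum n + recCoeff1 n * altSum (n + 1) + recCoeff2 n * altSum (n + 2) = 0 := by
  have ext : ∀ j ≤ 2, ∑ m ∈ range (n + j + 1), posTerm (n + j) m =
      ∑ m ∈ range (n + 3), posTerm (n + j) m := by
    intro j hj
    refine sum_subset (by intro i; simp; omega) fun i _ hi => posTerm_eq_zero ?_
    simp at hi; omega
  have h0 := ext 0 (by norm_num)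
  have h1 := ext 1 (by norm_num)
  have h2 := ext 2 (by norm_num)
  rw [add_zero] at h0
  have step : ∀ k : ℕ, ((2 * (k + 1)).factorial : ℚ) ^ 2 * invFact ((k + 1 : ℕ) : ℤ) ^ 2 =
      4 * (2 * k + 1) ^ 2 * (((2 * k).factorial : ℚ) ^ 2 * invFact k ^ 2) := by
    intro k
    have h := mul_invFact ((k + 1 : ℕ) : ℤ)
    rw [show ((k + 1 : ℕ) : ℤ) - 1 = k by push_cast; ring] at h
    rw [← h, show 2 * (k + 1) = 2 * k + 1 + 1 by ring, Nat.factorial_succ, Nat.factorial_succ]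
    push_cast
    ring
  rw [altSum_eq n, altSum_eq (n + 1), altSum_eq (n + 2), h0, h1, h2, step (n + 1), step n]
  push_cast
  linear_combination ((2 * n).factorial : ℚ) ^ 2 * invFact n ^ 2 * posTerm_recurrence n

theorem centralBinom_step (n : ℕ) :
    ((n : ℚ) + 1) * ((2 * (n + 1)).choose (n + 1) : ℚ) =
      2 * (2 * n + 1) * ((2 * n).choose n : ℚ) := by
  exact_mod_cast Nat.succ_mul_centralBinom_succ n

/-- The recurrence for the period coefficients that is encoded in `D10`. -/
theorem periodCoeff_recurrence (n : ℕ) :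
    25 * ((n : ℚ) + 4) ^ 4 * periodCoeff (n + 4)
      - 20 * (688 * ((n : ℚ) + 3) ^ 4 + 1352 * ((n : ℚ) + 3) ^ 3 + 981 * ((n : ℚ) + 3) ^ 2 +
          305 * ((n : ℚ) + 3) + 35) * periodCoeff (n + 3)
      + 16 * (5856 * ((n : ℚ) + 2) ^ 4 + 7008 * ((n : ℚ) + 2) ^ 3 + 96 * ((n : ℚ) + 2) ^ 2 -
          1260 * ((n : ℚ) + 2) - 265) * periodCoeff (n + 2)
      - 1024 * (176 * ((n : ℚ) + 1) ^ 4 + 120 * ((n : ℚ) + 1) ^ 3 + 69 * ((n : ℚ) + 1) ^ 2 +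
          30 * ((n : ℚ) + 1) + 5) * periodCoeff (n + 1)
      + 4096 * (2 * (n : ℚ) + 1) ^ 4 * periodCoeff n = 0 := by
  have r0 := altSum_recurrence n
  have r1 := altSum_recurrence (n + 1)
  have r2 := altSum_recurrence (n + 2)
  simp only [periodCoeff_eq_altSum]
  have b0 := centralBinom_step n
  have b1 := centralBinom_step (n + 1)
  have b2 := centralBinom_step (n + 2)
  have b3 := centralBinom_step (n + 3)
  rw [show n + 1 + 1 = n + 2 by ring, show n + 1 + 2 = n + 3 by ring] at *
  rw [show n + 2 + 1 = n + 3 by ring, show n + 2 + 2 = n + 4 by ring] at *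
  rw [show n + 3 + 1 = n + 4 by ring] at *
  generalize altSum n = s0 at *
  generalize altSum (n + 1) = s1 at *
  generalize altSum (n + 2) = s2 at *
  generalize altSum (n + 3) = s3 at *
  generalize altSum (n + 4) = s4 at *
  generalize ((2 * n).choose n : ℚ) = c0 at *
  generalize ((2 * (n + 1)).choose (n + 1) : ℚ) = c1 at *
  generalize ((2 * (n + 2)).choose (n + 2) : ℚ) = c2 at *
  generalize ((2 * (n + 3)).choose (n + 3) : ℚ) = c3 at *
  generalize ((2 * (n + 4)).choose (n + 4) : ℚ) = c4 at *
  push_cast at *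
  have hx : (0 : ℚ) ≤ n := by positivity
  generalize (n : ℚ) = x at *
  have e1 : c1 = 2 * (2 * x + 1) / (x + 1) * c0 := by
    field_simp; linear_combination b0
  have e2 : c2 = 2 * (2 * x + 3) / (x + 2) * c1 := by
    field_simp; linear_combination b1
  have e3 : c3 = 2 * (2 * x + 5) / (x + 3) * c2 := by
    field_simp; linear_combination b2
  have e4 : c4 = 2 * (2 * x + 7) / (x + 4) * c3 := by
    field_simp; linear_combination b3
  have hq0 : 48 * x ^ 2 + 162 * x + 137 ≠ 0 := by positivity
  have hq1 : 48 * (x + 1) ^ 2 + 162 * (x + 1) + 137 ≠ 0 := by positivity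
  -- The target is a combination of `r0`, `r1`, `r2` whose multipliers have denominators q(x) and
  -- q(x+1), where q(x) = 48x² + 162x + 137 is a factor of `recCoeff0`. The product
  -- (x+1)(x+2)(x+3)(x+4) clears those of the quotients of central binomials.
  refine mul_left_cancel₀ (mul_ne_zero (mul_ne_zero hq0 hq1)
    (show (x + 1) * (x + 2) * (x + 3) * (x + 4) ≠ 0 by positivity)) ?_
  rw [mul_zero]
  have f0 : (x + 1) * (x + 2) * (x + 3) * (x + 4) * c1 =
      2 * (2 * x + 1) * (x + 2) * (x + 3) * (x + 4) * c0 := by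
    rw [e1]; field_simp
  have f1 : (x + 1) * (x + 2) * (x + 3) * (x + 4) * c2 =
      4 * (2 * x + 1) * (2 * x + 3) * (x + 3) * (x + 4) * c0 := by
    rw [e2, e1]; field_simp; ring
  have f2 : (x + 1) * (x + 2) * (x + 3) * (x + 4) * c3 =
      8 * (2 * x + 1) * (2 * x + 3) * (2 * x + 5) * (x + 4) * c0 := by
    rw [e3, e2, e1]; field_simp; ring
  have f3 : (x + 1) * (x + 2) * (x + 3) * (x + 4) * c4 =
      16 * (2 * x + 1) * (2 * x + 3) * (2 * x + 5) * (2 * x + 7) * c0 := by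
    rw [e4, e3, e2, e1]; field_simp; ring
  unfold recCoeff0 recCoeff1 recCoeff2 at r0 r1 r2
  linear_combination c0 * (48 * (x + 1) ^ 2 + 162 * (x + 1) + 137) *
      (2048 * x ^ 4 + 19456 * x ^ 3 + 62464 * x ^ 2 + 75776 * x + 24576) * r0
    + c0 * (-245760 * x ^ 6 - 3287040 * x ^ 5 - 17244160 * x ^ 4 - 44889600 * x ^ 3 - 60231680 * x ^ 2 - 38730240 * x - 8939520) * r1
    + c0 * (48 * x ^ 2 + 162 * x + 137) * (3200 * x ^ 4 + 27200 * x ^ 3 + 76000 * x ^ 2 + 79600 * x + 24000) * r2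
    + (48 * x ^ 2 + 162 * x + 137) * (48 * (x + 1) ^ 2 + 162 * (x + 1) + 137) * (25 * (x + 4) ^ 4) * s4 * f3
    + (48 * x ^ 2 + 162 * x + 137) * (48 * (x + 1) ^ 2 + 162 * (x + 1) + 137) * ((-20) * (688 * (x + 3) ^ 4 + 1352 * (x + 3) ^ 3 + 981 * (x + 3) ^ 2 + 305 * (x + 3) ^ 1 + 35 * (x + 3) ^ 0)) * s3 * f2
    + (48 * x ^ 2 + 162 * x + 137) * (48 * (x + 1) ^ 2 + 162 * (x + 1) + 137) * (16 * (5856 * (x + 2) ^ 4 + 7008 * (x + 2) ^ 3 + 96 * (x + 2) ^ 2 + (-1260) * (x + 2) ^ 1 + (-265) * (x + 2) ^ 0)) * s2 * f1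
    + (48 * x ^ 2 + 162 * x + 137) * (48 * (x + 1) ^ 2 + 162 * (x + 1) + 137) * ((-1024) * (176 * (x + 1) ^ 4 + 120 * (x + 1) ^ 3 + 69 * (x + 1) ^ 2 + 30 * (x + 1) ^ 1 + 5 * (x + 1) ^ 0)) * s1 * f0

end PfaffianMirror

/-! ### The Weyl algebra: division, action, indicial polynomials -/

noncomputable section

namespace PfaffianMirror

open Polynomial

/-- Differential operators `∑ⱼ cⱼ ∂^j` with polynomial coefficients, recorded as polynomials
in `∂`. -/
abbrev WeylOp := Polynomial (Polynomial ℂ)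

namespace WeylOp

/-- The derivative of the coefficients of an operator. -/
def coeffDeriv : WeylOp →ₗ[ℂ] WeylOp :=
  Polynomial.lsum fun j => ((Polynomial.monomial j).restrictScalars ℂ).comp Polynomial.derivative

/-- The product `∂ M`. -/
def partialMul : WeylOp →ₗ[ℂ] WeylOp := LinearMap.mulLeft ℂ X + coeffDeriv

theorem coeffDeriv_monomial (j : ℕ) (c : ℂ[X]) :
    coeffDeriv (monomial j c) = monomial j (derivative c) := by
  simp [coeffDeriv, Polynomial.lsum_apply, sum_monomial_index]

theorem coeff_coeffDeriv (M : WeylOp) (j : ℕ) :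
    (coeffDeriv M).coeff j = derivative (M.coeff j) := by
  induction M using Polynomial.induction_on' with
  | add p q hp hq => simp [hp, hq]
  | monomial n c => rw [coeffDeriv_monomial, coeff_monomial, coeff_monomial]; split_ifs <;> simp

theorem partialMul_apply (M : WeylOp) : partialMul M = X * M + coeffDeriv M := rfl

theorem coeff_partialMul_succ (M : WeylOp) (j : ℕ) :
    (partialMul M).coeff (j + 1) = M.coeff j + derivative (M.coeff (j + 1)) := by
  rw [partialMul_apply, coeff_add, coeff_X_mul, coeff_coeffDeriv]

theorem coeff_partialMul_zero (M : WeylOp) :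
    (partialMul M).coeff 0 = derivative (M.coeff 0) := by
  rw [partialMul_apply, coeff_add, coeff_coeffDeriv]; simp

theorem coeff_partialMul_iterate_of_lt (M : WeylOp) (k : ℕ) {j : ℕ} (h : M.natDegree + k < j) :
    (partialMul^[k] M).coeff j = 0 := by
  induction k generalizing j with
  | zero => exact coeff_eq_zero_of_natDegree_lt (by simpa using h)
  | succ k ih =>
    obtain ⟨i, rfl⟩ : ∃ i, j = i + 1 := ⟨j - 1, by omega⟩
    rw [Function.iterate_succ_apply', coeff_partialMul_succ, ih (by omega), ih (by omega)]
    simp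

/-- Moving ∂ past a coefficient creates only terms of lower order, so leading coefficients survive.
-/
theorem coeff_partialMul_iterate_top (M : WeylOp) (k : ℕ) :
    (partialMul^[k] M).coeff (M.natDegree + k) = M.leadingCoeff := by
  induction k with
  | zero => simp
  | succ k ih =>
    rw [Function.iterate_succ_apply', ← add_assoc, coeff_partialMul_succ, ih,
      coeff_partialMul_iterate_of_lt M k (by omega)]
    simp

/-- The product `Q M` of two operators. -/
def opMul (M : WeylOp) : WeylOp →ₗ[ℂ[X]] WeylOp :=
  Polynomial.lsum fun j => LinearMap.toSpanSingleton ℂ[X] WeylOp (partialMul^[j] M)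

theorem opMul_monomial (M : WeylOp) (j : ℕ) (c : ℂ[X]) :
    opMul M (monomial j c) = c • partialMul^[j] M := by
  simp [opMul, Polynomial.lsum_apply, sum_monomial_index]

/-- Division with remainder in the Weyl algebra, up to a polynomial factor on the left. -/
theorem exists_pseudo_division {M : WeylOp} (hM : M ≠ 0) (hr : 0 < M.natDegree) (n : ℕ)
    (D : WeylOp) (hD : D.natDegree < n + M.natDegree) :
    ∃ g : ℂ[X], g ≠ 0 ∧ ∃ Q R : WeylOp, g • D = opMul M Q + R ∧ R.natDegree < M.natDegree ∧
      Q.natDegree ≤ n - 1 := by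
  induction n generalizing D with
  | zero => exact ⟨1, one_ne_zero, 0, D, by simp, by omega, by simp⟩
  | succ n ih =>
    -- One step of pseudo-division: cross-multiplying by leading coefficients cancels the top term
    -- without dividing.
    set D' : WeylOp := M.leadingCoeff • D - D.coeff (M.natDegree + n) • partialMul^[n] M with hD'
    have hz : ∀ j, n + M.natDegree ≤ j → D'.coeff j = 0 := by
      intro j hj
      rw [hD', coeff_sub, coeff_smul, coeff_smul]
      rcases hj.eq_or_lt with rfl | h
      · rw [add_comm n, coeff_partialMul_iterate_top]
        simp [mul_comm]
      · rw [coeff_partialMul_iterate_of_lt M n (by omega),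
          coeff_eq_zero_of_natDegree_lt (p := D) (by omega)]
        simp
    have hlt : D'.natDegree < n + M.natDegree := by
      have := natDegree_le_iff_coeff_eq_zero (p := D') (n := n + M.natDegree - 1)
      have := this.mpr fun j hj => hz j (by omega)
      omega
    obtain ⟨g, hg, Q, R, h, hR, hQ⟩ := ih D' hlt
    refine ⟨g * M.leadingCoeff, mul_ne_zero hg (leadingCoeff_ne_zero.mpr hM),
      Q + monomial n (g * D.coeff (M.natDegree + n)), R, ?_, hR, ?_⟩
    · rw [map_add, opMul_monomial, mul_smul, mul_smul, add_right_comm, ← h, hD', smul_sub]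
      abel
    · refine (natDegree_add_le _ _).trans (max_le (hQ.trans (by omega)) ?_)
      exact (natDegree_monomial_le _).trans (by omega)

/-- The action of an operator on an element of a differential module with derivation `δ`. -/
def act {A : Type*} [AddCommGroup A] [Module ℂ[X] A] (δ : A → A) (a : A) : WeylOp →ₗ[ℂ[X]] A :=
  Polynomial.lsum fun j => LinearMap.toSpanSingleton ℂ[X] A (δ^[j] a)

section act

variable {A : Type*} [AddCommGroup A] [Module ℂ[X] A] (δ : A →+ A)

theorem act_monomial (δ : A → A) (a : A) (j : ℕ) (c : ℂ[X]) :
    act δ a (monomial j c) = c • δ^[j] a := by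
  simp [act, Polynomial.lsum_apply, sum_monomial_index]

theorem act_partialMul (hδ : ∀ (c : ℂ[X]) (a : A), δ (c • a) = derivative c • a + c • δ a)
    (a : A) (M : WeylOp) : act δ a (partialMul M) = δ (act δ a M) := by
  induction M using Polynomial.induction_on' with
  | add p q hp hq => simp [hp, hq]
  | monomial n c =>
    rw [partialMul_apply, coeffDeriv_monomial, X_mul_monomial, map_add, act_monomial,
      act_monomial, act_monomial, hδ, Function.iterate_succ_apply', add_comm]

theorem act_partialMul_iterate
    (hδ : ∀ (c : ℂ[X]) (a : A), δ (c • a) = derivative c • a + c • δ a)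
    (a : A) (M : WeylOp) (k : ℕ) : act δ a (partialMul^[k] M) = δ^[k] (act δ a M) := by
  induction k with
  | zero => rfl
  | succ k ih =>
    rw [Function.iterate_succ_apply', Function.iterate_succ_apply', act_partialMul δ hδ, ih]

/-- The composition law: whatever M annihilates, Q M annihilates too. Division with remainder then
passes annihilation on to the remainder. -/
theorem act_opMul (hδ : ∀ (c : ℂ[X]) (a : A), δ (c • a) = derivative c • a + c • δ a)
    (a : A) (Q M : WeylOp) : act δ a (opMul M Q) = act δ (act δ a M) Q := by
  induction Q using Polynomial.induction_on' with
  | add p q hp hq => simp [hp, hq]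
  | monomial n c =>
    rw [opMul_monomial, act_monomial, map_smul, act_partialMul_iterate δ hδ]

end act

/-- The expansion of `∑ⱼ cⱼ Θ^j`, `Θ = X ∂`, in powers of `∂`. -/
def ofTheta : DiffOp →ₗ[ℂ[X]] WeylOp :=
  Polynomial.lsum fun j => LinearMap.toSpanSingleton ℂ[X] WeylOp
    ((fun M : WeylOp => (X : ℂ[X]) • partialMul M)^[j] 1)

theorem ofTheta_monomial (j : ℕ) (c : ℂ[X]) :
    ofTheta (monomial j c) = c • (fun M : WeylOp => (X : ℂ[X]) • partialMul M)^[j] 1 := by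
  simp [ofTheta, Polynomial.lsum_apply, sum_monomial_index]

theorem act_ofTheta {A : Type*} [AddCommGroup A] [Module ℂ[X] A] (δ : A →+ A)
    (hδ : ∀ (c : ℂ[X]) (a : A), δ (c • a) = derivative c • a + c • δ a) (a : A) (L : DiffOp) :
    act δ a (ofTheta L) = act (fun b => (X : ℂ[X]) • δ b) a L := by
  induction L using Polynomial.induction_on' with
  | add p q hp hq => simp [hp, hq]
  | monomial n c =>
    rw [ofTheta_monomial, act_monomial, map_smul]
    congr 1
    induction n with
    | zero => rw [Function.iterate_zero_apply, ← monomial_zero_one, act_monomial]; simp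
    | succ n ih =>
      rw [Function.iterate_succ_apply', Function.iterate_succ_apply', map_smul,
        act_partialMul δ hδ, ih]

theorem coeff_thetaPow_of_lt {n j : ℕ} (h : n < j) :
    ((fun M : WeylOp => (X : ℂ[X]) • partialMul M)^[n] 1).coeff j = 0 := by
  induction n generalizing j with
  | zero => simp [coeff_one, h.ne']
  | succ n ih =>
    obtain ⟨i, rfl⟩ : ∃ i, j = i + 1 := ⟨j - 1, by omega⟩
    rw [Function.iterate_succ_apply', coeff_smul, coeff_partialMul_succ, ih (by omega),
      ih (by omega)]
    simp

theorem coeff_thetaPow_self (n : ℕ) :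
    ((fun M : WeylOp => (X : ℂ[X]) • partialMul M)^[n] 1).coeff n = X ^ n := by
  induction n with
  | zero => simp
  | succ n ih =>
    rw [Function.iterate_succ_apply', coeff_smul, coeff_partialMul_succ, ih,
      coeff_thetaPow_of_lt (by omega), derivative_zero, add_zero, smul_eq_mul, pow_succ']

theorem coeff_ofTheta (L : DiffOp) (j : ℕ) : (ofTheta L).coeff j =
    L.sum fun n c => c * ((fun M : WeylOp => (X : ℂ[X]) • partialMul M)^[n] 1).coeff j := by
  simp [ofTheta, Polynomial.lsum_apply, Polynomial.sum_def]

theorem natDegree_ofTheta_le (L : DiffOp) : (ofTheta L).natDegree ≤ L.natDegree := by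
  rw [natDegree_le_iff_coeff_eq_zero]
  intro j hj
  rw [coeff_ofTheta, Polynomial.sum_def]
  refine Finset.sum_eq_zero fun n hn => ?_
  rw [coeff_thetaPow_of_lt ((le_natDegree_of_mem_supp n hn).trans_lt hj), mul_zero]

/-- Θⁿ has leading term Xⁿ∂ⁿ, so the leading coefficient of L is merely multiplied by a power of X.
-/
theorem ofTheta_ne_zero {L : DiffOp} (hL : L ≠ 0) : ofTheta L ≠ 0 := by
  intro h
  have h1 : (ofTheta L).coeff L.natDegree = 0 := by rw [h, coeff_zero]
  rw [coeff_ofTheta, Polynomial.sum_def, Finset.sum_eq_single L.natDegree] at h1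
  · rw [coeff_thetaPow_self] at h1
    exact mul_ne_zero (leadingCoeff_ne_zero.mpr hL) (pow_ne_zero _ X_ne_zero) h1
  · intro n hn hne
    rw [coeff_thetaPow_of_lt (lt_of_le_of_ne (le_natDegree_of_mem_supp n hn) hne), mul_zero]
  · intro hn
    exact absurd (natDegree_mem_support_of_nonzero hL) hn

/-- The polynomial `f` with `M(x^s) = ∑ₖ f(s) x^(s-k)`. -/
def indPoly (k : ℤ) : WeylOp →ₗ[ℂ] ℂ[X] :=
  Polynomial.lsum fun j => if (j : ℤ) < k then 0 else
    (Polynomial.lcoeff ℂ ((j : ℤ) - k).toNat).smulRight (descPochhammer ℂ j)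

theorem indPoly_monomial (k : ℤ) (j i : ℕ) (c : ℂ) :
    indPoly k (monomial j (monomial i c)) =
      if k = (j : ℤ) - i then C c * descPochhammer ℂ j else 0 := by
  simp only [indPoly, Polynomial.lsum_apply, sum_monomial_index, map_zero]
  split_ifs with h1 h2 h2
  · omega
  · rfl
  · rw [LinearMap.smulRight_apply, lcoeff_apply, coeff_monomial, if_pos (by omega),
      smul_eq_C_mul]
  · rw [LinearMap.smulRight_apply, lcoeff_apply, coeff_monomial, if_neg (by omega), zero_smul]

/-- Induction on operators, from `c x^i ∂^j`. -/
theorem induction_monomial {motive : WeylOp → Prop} (M : WeylOp)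
    (add : ∀ p q, motive p → motive q → motive (p + q))
    (mono : ∀ j i c, motive (monomial j (monomial i c))) : motive M := by
  induction M using Polynomial.induction_on' with
  | add p q hp hq => exact add p q hp hq
  | monomial n c =>
    induction c using Polynomial.induction_on' with
    | add p q hp hq => rw [map_add]; exact add _ _ hp hq
    | monomial i c => exact mono n i c

/-- ∂ sends x^(s-k+1) to (s-k+1) x^(s-k), which explains the shift of k and the linear factor. -/
theorem indPoly_partialMul (k : ℤ) (M : WeylOp) :
    indPoly k (partialMul M) = indPoly (k - 1) M * (X - C ((k : ℂ) - 1)) := by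
  induction M using induction_monomial with
  | add p q hp hq => simp only [map_add, hp, hq, add_mul]
  | mono j i c =>
    rw [partialMul_apply, coeffDeriv_monomial, X_mul_monomial, derivative_monomial, map_add,
      indPoly_monomial, indPoly_monomial, indPoly_monomial]
    rcases Nat.eq_zero_or_pos i with rfl | hi
    · simp only [Nat.cast_zero, mul_zero, map_zero, zero_mul, ite_self, add_zero]
      by_cases h : k = (j : ℤ) + 1
      · subst h
        rw [if_pos (by simp), if_pos (by simp), descPochhammer_succ_right]
        push_cast
        simp
        ring
      · rw [if_neg (by push_cast; omega), if_neg (by omega), zero_mul]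
    · by_cases h : k = (j : ℤ) + 1 - i
      · subst h
        rw [if_pos (by push_cast; ring), if_pos (by omega), if_pos (by ring),
          descPochhammer_succ_right]
        push_cast
        simp only [map_mul, map_sub, map_add, map_natCast, map_one]
        ring
      · rw [if_neg (by push_cast; omega), if_neg (by omega), if_neg (by omega), zero_mul, add_zero]

theorem indPoly_partialMul_iterate (n : ℕ) (k : ℤ) (M : WeylOp) :
    indPoly k (partialMul^[n] M) =
      indPoly (k - n) M * (descPochhammer ℂ n).comp (X - C ((k : ℂ) - n)) := by
  induction n generalizing k with
  | zero => simp
  | succ n ih =>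
    rw [Function.iterate_succ_apply', indPoly_partialMul, ih, descPochhammer_succ_right]
    have h1 : k - 1 - (n : ℤ) = k - (n + 1 : ℕ) := by push_cast; ring
    have h2 : (((k - 1 : ℤ) : ℂ) - n) = (k : ℂ) - (n + 1 : ℕ) := by push_cast; ring
    rw [h1, h2, mul_assoc, mul_comp, sub_comp, X_comp, natCast_comp]
    congr 2
    simp only [map_sub, map_add, map_natCast, map_one, Nat.cast_add, Nat.cast_one]
    ring

theorem indPoly_X_pow_mul (i : ℕ) (a : ℂ) (k : ℤ) (M : WeylOp) :
    indPoly k ((monomial i a : ℂ[X]) • M) = C a * indPoly (k + i) M := by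
  induction M using induction_monomial with
  | add p q hp hq => simp only [map_add, smul_add, hp, hq, mul_add]
  | mono j l c =>
    rw [smul_monomial, smul_eq_mul, monomial_mul_monomial, indPoly_monomial, indPoly_monomial]
    push_cast
    by_cases h : k = (j : ℤ) - (i + l)
    · rw [if_pos h, if_pos (by omega), map_mul, mul_assoc]
    · rw [if_neg h, if_neg (by omega), mul_zero]

/-- The parts of a product of operators. -/
theorem indPoly_opMul (Q M : WeylOp) (s : Finset ℤ) (hs : ∀ a ∉ s, indPoly a M = 0) (k : ℤ) :
    indPoly k (opMul M Q) =
      ∑ a ∈ s, indPoly a M * (indPoly (k - a) Q).comp (X - C (a : ℂ)) := by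
  induction Q using induction_monomial with
  | add p q hp hq => simp only [map_add, hp, hq, add_comp, mul_add, Finset.sum_add_distrib]
  | mono j i c =>
    rw [opMul_monomial, indPoly_X_pow_mul, indPoly_partialMul_iterate]
    simp only [indPoly_monomial]
    have hk : ∀ a : ℤ, (k - a = (j : ℤ) - i) ↔ a = k + i - j := fun a => by omega
    simp only [hk]
    by_cases hmem : k + i - j ∈ s
    · rw [Finset.sum_eq_single (k + i - j)]
      · rw [if_pos rfl, mul_comp, C_comp]
        push_cast
        ring
      · intro b _ hb
        rw [if_neg hb, zero_comp, mul_zero]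
      · exact fun h => absurd hmem h
    · rw [hs _ hmem, zero_mul, mul_zero]
      symm
      refine Finset.sum_eq_zero fun a ha => ?_
      rw [if_neg (by rintro rfl; exact hmem ha), zero_comp, mul_zero]

end WeylOp

end PfaffianMirror

end

/-! ### Extremal parts of operators and local exponents -/

noncomputable section

namespace PfaffianMirror

open Polynomial

namespace WeylOp

/-- The translation `x ↦ x + p` of an operator. -/
def shift (p : ℂ) : WeylOp →+* WeylOp :=
  Polynomial.mapRingHom (taylorAlgHom p : ℂ[X] →ₐ[ℂ] ℂ[X]).toRingHom

theorem coeff_shift (p : ℂ) (M : WeylOp) (j : ℕ) :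
    (shift p M).coeff j = taylor p (M.coeff j) := by
  simp [shift]

theorem shift_smul (p : ℂ) (c : ℂ[X]) (M : WeylOp) :
    shift p (c • M) = taylor p c • shift p M := by
  ext1 j
  rw [coeff_shift, coeff_smul, coeff_smul, coeff_shift, smul_eq_mul, smul_eq_mul, taylor_mul]

theorem natDegree_shift (p : ℂ) (M : WeylOp) : (shift p M).natDegree = M.natDegree :=
  natDegree_map_eq_of_injective (taylor_injective p) M

theorem shift_partialMul (p : ℂ) (M : WeylOp) :
    shift p (partialMul M) = partialMul (shift p M) := by
  have h : ∀ f : ℂ[X], derivative (taylor p f) = taylor p (derivative f) := fun f => by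
    rw [taylor_apply, taylor_apply, derivative_comp]; simp
  ext1 j
  rw [coeff_shift]
  cases j with
  | zero => rw [coeff_partialMul_zero, coeff_partialMul_zero, coeff_shift, h]
  | succ j => rw [coeff_partialMul_succ, coeff_partialMul_succ, coeff_shift, coeff_shift, h,
      map_add]

/-- Translation commutes with ∂, so it respects products; a factorization can thus be studied at
every point as at 0. -/
theorem shift_opMul (p : ℂ) (Q M : WeylOp) :
    shift p (opMul M Q) = opMul (shift p M) (shift p Q) := by
  induction Q using Polynomial.induction_on' with
  | add a b ha hb => simp only [map_add, ha, hb]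
  | monomial j c =>
    have h : shift p (monomial j c) = monomial j (taylor p c) := by
      ext1 i
      rw [coeff_shift, coeff_monomial, coeff_monomial]
      split_ifs <;> simp
    have h2 : ∀ j, shift p (partialMul^[j] M) = partialMul^[j] (shift p M) := fun j => by
      induction j with
      | zero => rfl
      | succ j ih =>
        rw [Function.iterate_succ_apply', Function.iterate_succ_apply', shift_partialMul, ih]
    rw [h, opMul_monomial, opMul_monomial, shift_smul, h2]

/-- The coefficient of `x^n`, which is zero if `n < 0`. -/
def coeffInt (c : ℂ[X]) (n : ℤ) : ℂ := if n < 0 then 0 else c.coeff n.toNat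

theorem coeffInt_natCast (c : ℂ[X]) (n : ℕ) : coeffInt c n = c.coeff n := by
  simp [coeffInt]

theorem coeffInt_of_neg (c : ℂ[X]) {n : ℤ} (h : n < 0) : coeffInt c n = 0 := by
  simp [coeffInt, h]

theorem indPoly_apply (k : ℤ) (M : WeylOp) : indPoly k M =
    M.sum fun j c => C (coeffInt c (j - k)) * descPochhammer ℂ j := by
  rw [indPoly, lsum_apply]
  refine Finset.sum_congr rfl fun j _ => ?_
  by_cases h : (j : ℤ) < k
  · simp [h, coeffInt]
  · simp [h, coeffInt, smul_eq_C_mul]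

theorem indPoly_eq_sum {M : WeylOp} {r : ℕ} (h : M.natDegree ≤ r) (k : ℤ) : indPoly k M =
    ∑ j ∈ Finset.range (r + 1), C (coeffInt (M.coeff j) (j - k)) * descPochhammer ℂ j := by
  rw [indPoly_apply]
  exact Polynomial.sum_over_range' _ (by simp [coeffInt]) _ (by omega)

/-- The roots 0, …, r add up to C(r+1,2). This is the source of the binomial coefficient in Fuchs'
relation. -/
theorem coeff_descPochhammer_pred (r : ℕ) :
    (descPochhammer ℂ (r + 1)).coeff r = -((r + 1).choose 2 : ℂ) := by
  have h : (descPochhammer ℂ (r + 1)).nextCoeff = -((r + 1).choose 2 : ℂ) := by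
    induction r with
    | zero =>
      have := nextCoeff_X_sub_C (0 : ℂ)
      simp only [map_zero, sub_zero, neg_zero] at this
      simp [this]
    | succ r ih =>
      rw [descPochhammer_succ_right, ← C_eq_natCast, (monic_descPochhammer ℂ _).nextCoeff_mul
        (monic_X_sub_C _), ih, nextCoeff_X_sub_C, Nat.choose_succ_succ' (r + 1) 1]
      push_cast
      simp
  rw [← h, nextCoeff_of_natDegree_pos (by rw [descPochhammer_natDegree]; omega),
    descPochhammer_natDegree, Nat.add_sub_cancel]

/-- Only ∂ʳ contributes degree r in s; in the next lemma only the two highest orders contribute. The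
two top coefficients of a part therefore read off those of the operator. -/
theorem coeff_indPoly_top {M : WeylOp} {r : ℕ} (h : M.natDegree ≤ r) (k : ℤ) :
    (indPoly k M).coeff r = coeffInt (M.coeff r) (r - k) := by
  rw [indPoly_eq_sum h, finsetSum_coeff, Finset.sum_eq_single r]
  · have : (descPochhammer ℂ r).coeff r = 1 := by
      have := monic_descPochhammer ℂ r
      rwa [Monic, leadingCoeff, descPochhammer_natDegree] at this
    rw [coeff_C_mul, this, mul_one]
  · intro j hj hne
    rw [coeff_C_mul, coeff_eq_zero_of_natDegree_lt (p := descPochhammer ℂ j), mul_zero]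
    rw [descPochhammer_natDegree]
    simp at hj; omega
  · intro h; simp at h

theorem coeff_indPoly_pred {M : WeylOp} {r : ℕ} (h : M.natDegree ≤ r + 1) (k : ℤ) :
    (indPoly k M).coeff r = coeffInt (M.coeff r) (r - k) -
      ((r + 1).choose 2 : ℂ) * coeffInt (M.coeff (r + 1)) (r + 1 - k) := by
  have h1 : (descPochhammer ℂ r).coeff r = 1 := by
    have := monic_descPochhammer ℂ r
    rwa [Monic, leadingCoeff, descPochhammer_natDegree] at this
  rw [indPoly_eq_sum h, finsetSum_coeff, Finset.sum_range_succ, Finset.sum_range_succ,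
    coeff_C_mul, coeff_C_mul, h1, coeff_descPochhammer_pred, Finset.sum_eq_zero]
  · push_cast
    ring
  · intro j hj
    rw [coeff_C_mul, coeff_eq_zero_of_natDegree_lt (p := descPochhammer ℂ j), mul_zero]
    rw [descPochhammer_natDegree]
    simpa using hj

theorem natDegree_indPoly_le {M : WeylOp} {r : ℕ} (h : M.natDegree ≤ r) (k : ℤ) :
    (indPoly k M).natDegree ≤ r := by
  rw [indPoly_eq_sum h]
  refine natDegree_sum_le_of_forall_le _ _ fun j hj => (natDegree_C_mul_le _ _).trans ?_
  rw [descPochhammer_natDegree]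
  simp at hj; omega

theorem exists_indPoly_support (M : WeylOp) :
    ∃ s : Finset ℤ, ∀ a ∉ s, indPoly a M = 0 := by
  classical
  induction M using induction_monomial with
  | add p q hp hq =>
    obtain ⟨s, hs⟩ := hp
    obtain ⟨t, ht⟩ := hq
    refine ⟨s ∪ t, fun a ha => ?_⟩
    rw [Finset.mem_union, not_or] at ha
    rw [map_add, hs a ha.1, ht a ha.2, add_zero]
  | mono j i c =>
    refine ⟨{(j : ℤ) - i}, fun a ha => ?_⟩
    rw [indPoly_monomial, if_neg (by simpa using ha)]

/-- The extremal part of an operator: `f = indPoly κ M` is nonzero, and the parts `indPoly k M` with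
`e κ < e k` vanish. The part with `e = 1` is the indicial polynomial at `0`, the one with `e = -1`
is the indicial polynomial at infinity. -/
structure IsExtremal (e : ℤ) (M : WeylOp) (κ : ℤ) (f : ℂ[X]) : Prop where
  eq : indPoly κ M = f
  ne_zero : f ≠ 0
  vanish : ∀ k, e * κ < e * k → indPoly k M = 0

/-- Only finitely many parts are nonzero, and some part is, because the top coefficients of the
parts list the coefficients of the leading coefficient of M. -/
theorem exists_isExtremal (e : ℤ) {M : WeylOp} (hM : M ≠ 0) : ∃ κ f, IsExtremal e M κ f := by
  classical
  obtain ⟨s, hs⟩ := exists_indPoly_support M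
  have hne : ∃ a, indPoly a M ≠ 0 := by
    obtain ⟨i, hi⟩ : ∃ i, (M.leadingCoeff).coeff i ≠ 0 := by
      by_contra! h
      exact hM (leadingCoeff_eq_zero.mp (Polynomial.ext (by simpa using h)))
    refine ⟨M.natDegree - i, fun h => hi ?_⟩
    have := coeff_indPoly_top (M := M) le_rfl (M.natDegree - i)
    rw [h, sub_sub_cancel, coeffInt_natCast, coeff_zero] at this
    exact this.symm
  obtain ⟨a, ha⟩ := hne
  have hmem : ∀ {b}, indPoly b M ≠ 0 → b ∈ s.filter fun b => indPoly b M ≠ 0 := fun {b} hb =>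
    Finset.mem_filter.mpr ⟨by by_contra h; exact hb (hs b h), hb⟩
  obtain ⟨κ, hκ, hmax⟩ := Finset.exists_max_image _ (fun b => e * b) ⟨a, hmem ha⟩
  refine ⟨κ, _, rfl, (Finset.mem_filter.mp hκ).2, fun k hk => ?_⟩
  by_contra h
  exact absurd (hmax k (hmem h)) (by omega)

theorem IsExtremal.unique {e : ℤ} (he : e ≠ 0) {M : WeylOp} {κ κ' : ℤ} {f f' : ℂ[X]}
    (h : IsExtremal e M κ f) (h' : IsExtremal e M κ' f') : κ = κ' ∧ f = f' := by
  have : κ = κ' := by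
    rcases lt_trichotomy (e * κ) (e * κ') with hl | hl | hl
    · exact absurd (h'.eq.symm.trans (h.vanish _ hl)) h'.ne_zero
    · exact mul_left_cancel₀ he hl
    · exact absurd (h.eq.symm.trans (h'.vanish _ hl)) h.ne_zero
  subst this
  exact ⟨rfl, h.eq.symm.trans h'.eq⟩

/-- Extremal parts multiply like leading terms: only one pair of parts reaches degree κ + l, and
ℂ[X] is a domain. -/
theorem IsExtremal.opMul {e : ℤ} (he : e ≠ 0) {Q M : WeylOp} {κ l : ℤ} {f g : ℂ[X]}
    (hM : IsExtremal e M κ f) (hQ : IsExtremal e Q l g) :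
    IsExtremal e (opMul M Q) (κ + l) (f * g.comp (X - C (κ : ℂ))) := by
  classical
  obtain ⟨s, hs⟩ := exists_indPoly_support M
  refine ⟨?_, mul_ne_zero hM.ne_zero ?_, fun k hk => ?_⟩
  · rw [indPoly_opMul Q M s hs, Finset.sum_eq_single κ, hM.eq, add_sub_cancel_left, hQ.eq]
    · intro a _ ha
      rcases lt_trichotomy (e * κ) (e * a) with h | h | h
      · rw [hM.vanish a h, zero_mul]
      · exact absurd (mul_left_cancel₀ he h).symm ha
      · rw [hQ.vanish (κ + l - a) (by rw [mul_sub, mul_add]; omega), zero_comp, mul_zero]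
    · intro h
      rw [hs κ h, zero_mul]
  · intro h
    rw [comp_eq_zero_iff] at h
    rcases h with h | ⟨_, h⟩
    · exact hQ.ne_zero h
    · have := congrArg natDegree h
      rw [natDegree_X_sub_C, natDegree_C] at this
      omega
  · rw [indPoly_opMul Q M s hs]
    refine Finset.sum_eq_zero fun a _ => ?_
    by_cases h : e * κ < e * a
    · rw [hM.vanish a h, zero_mul]
    · rw [hQ.vanish (k - a) (by rw [mul_add] at hk; rw [mul_sub]; omega), zero_comp, mul_zero]

/-- The extremal part of a right factor divides the extremal part of the product. -/
theorem IsExtremal.of_dvd {e : ℤ} (he : e ≠ 0) {D Q M : WeylOp} {g : ℂ[X]} (hg : g ≠ 0)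
    (hM : M ≠ 0) (hQ : Q ≠ 0) (h : g • D = WeylOp.opMul M Q) {κ : ℤ} {f : ℂ[X]}
    (hD : IsExtremal e D κ f) (hdeg : M.natDegree + Q.natDegree ≤ f.natDegree) :
    ∃ κ' f', IsExtremal e M κ' f' ∧ f'.natDegree = M.natDegree ∧ f'.roots ≤ f.roots := by
  obtain ⟨κ₁, f₁, h₁⟩ := exists_isExtremal e hM
  obtain ⟨κ₂, f₂, h₂⟩ := exists_isExtremal e hQ
  have hg' : (monomial 0 g : WeylOp) ≠ 0 := by simpa using hg
  obtain ⟨κ₃, f₃, h₃⟩ := exists_isExtremal e hg'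
  -- The factor g has order zero, so its parts are constants and do not affect roots.
  have hf₃ : f₃.natDegree = 0 := by
    rw [← h₃.eq]
    have := natDegree_indPoly_le (M := monomial 0 g) (r := 0) (natDegree_monomial_le g) κ₃
    omega
  have hprod := hD.opMul he h₃
  rw [opMul_monomial, Function.iterate_zero_apply, h] at hprod
  obtain ⟨-, heq⟩ := (h₁.opMul he h₂).unique he hprod
  obtain ⟨c, rfl⟩ := natDegree_eq_zero.mp hf₃
  rw [C_comp] at heq
  have hc : c ≠ 0 := fun h0 => h₃.ne_zero (by rw [h0, map_zero])
  have hne₂ : f₂.comp (X - C (κ₁ : ℂ)) ≠ 0 := by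
    intro h0
    rw [h0, mul_zero] at heq
    exact hprod.ne_zero (by rw [C_comp, ← heq])
  have hd := congrArg natDegree heq
  rw [natDegree_mul h₁.ne_zero hne₂, natDegree_mul hD.ne_zero h₃.ne_zero, natDegree_C,
    natDegree_comp, natDegree_X_sub_C, mul_one] at hd
  -- The degrees of the extremal parts are at most the orders and add up to deg f, so `hdeg` forces
  -- equality: a factor of a Fuchsian operator is Fuchsian.
  have hd₁ : f₁.natDegree ≤ M.natDegree := h₁.eq ▸ natDegree_indPoly_le le_rfl κ₁
  have hd₂ : f₂.natDegree ≤ Q.natDegree := h₂.eq ▸ natDegree_indPoly_le le_rfl κ₂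
  refine ⟨κ₁, f₁, h₁, by omega, ?_⟩
  have : f₁.roots ≤ (f * C c).roots :=
    roots.le_of_dvd (mul_ne_zero hD.ne_zero h₃.ne_zero) ⟨_, heq.symm⟩
  rwa [mul_comm, roots_C_mul f hc] at this

/-- The second coefficient of an extremal part of full degree. -/
theorem IsExtremal.coeff_pred {e : ℤ} {M : WeylOp} {κ : ℤ} {f : ℂ[X]}
    (h : IsExtremal e M κ f) {r : ℕ} (hr : M.natDegree = r + 1) (hf : f.natDegree = r + 1) :
    coeffInt (M.coeff (r + 1)) (r + 1 - κ) ≠ 0 ∧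
      coeffInt (M.coeff r) (r - κ) = (((r + 1).choose 2 : ℂ) - f.roots.sum) *
        coeffInt (M.coeff (r + 1)) (r + 1 - κ) := by
  have h1 := coeff_indPoly_top hr.le κ
  have h2 := coeff_indPoly_pred hr.le κ
  push_cast at h1
  rw [h.eq] at h1 h2
  have h3 := (IsAlgClosed.splits f).nextCoeff_eq_neg_sum_roots_mul_leadingCoeff
  rw [nextCoeff_of_natDegree_pos (by omega), hf, Nat.add_sub_cancel, leadingCoeff, hf] at h3
  rw [← h1]
  refine ⟨?_, ?_⟩
  · rw [← hf]; exact leadingCoeff_ne_zero.mpr h.ne_zero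
  · rw [← h1] at h2
    linear_combination h3 - h2

/-- The local behaviour at `0` of the two leading coefficients of an operator. -/
theorem IsExtremal.local_coeff {M : WeylOp} {κ : ℤ} {f : ℂ[X]}
    (h : IsExtremal 1 M κ f) {r : ℕ} (hr : M.natDegree = r + 1) (hf : f.natDegree = r + 1) :
    ∃ v, (∀ i < v, (M.coeff (r + 1)).coeff i = 0) ∧ (M.coeff (r + 1)).coeff v ≠ 0 ∧
      (∀ i, i + 1 < v → (M.coeff r).coeff i = 0) ∧
      coeffInt (M.coeff r) (v - 1) =
        (((r + 1).choose 2 : ℂ) - f.roots.sum) * (M.coeff (r + 1)).coeff v := by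
  obtain ⟨h1, h2⟩ := h.coeff_pred hr hf
  have hv : 0 ≤ r + 1 - κ := by
    by_contra hneg
    exact h1 (coeffInt_of_neg _ (by omega))
  -- v = r + 1 - κ is the order of vanishing at 0 of the leading coefficient.
  obtain ⟨v, hv⟩ := Int.eq_ofNat_of_zero_le hv
  have hκ : κ = r + 1 - v := by omega
  subst hκ
  rw [sub_sub_cancel, coeffInt_natCast] at h1 h2
  have top : ∀ i < v, (M.coeff (r + 1)).coeff i = 0 := by
    intro i hi
    have := coeff_indPoly_top hr.le (r + 1 - i)
    rw [h.vanish _ (by omega)] at this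
    push_cast at this
    rw [sub_sub_cancel, coeffInt_natCast, coeff_zero] at this
    exact this.symm
  refine ⟨v, top, h1, fun i hi => ?_, ?_⟩
  · have := coeff_indPoly_pred hr.le (r - i)
    rw [h.vanish _ (by omega), sub_sub_cancel, coeffInt_natCast, coeff_zero,
      show (r : ℤ) + 1 - (r - i) = (i + 1 : ℕ) by push_cast; ring, coeffInt_natCast,
      top _ hi] at this
    simpa using this.symm
  · rw [← h2]
    congr 1
    ring

/-- The behaviour at infinity of the two leading coefficients of an operator. -/
theorem IsExtremal.infinity_coeff {M : WeylOp} {κ : ℤ} {f : ℂ[X]}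
    (h : IsExtremal (-1) M κ f) {r : ℕ} (hr : M.natDegree = r + 1) (hf : f.natDegree = r + 1) :
    (∀ i : ℕ, (M.coeff (r + 1)).natDegree ≤ i → (M.coeff r).coeff i = 0) ∧
      coeffInt (M.coeff r) ((M.coeff (r + 1)).natDegree - 1) =
        (((r + 1).choose 2 : ℂ) - f.roots.sum) * (M.coeff (r + 1)).leadingCoeff := by
  obtain ⟨h1, h2⟩ := h.coeff_pred hr hf
  have hv : 0 ≤ r + 1 - κ := by
    by_contra hneg
    exact h1 (coeffInt_of_neg _ (by omega))
  obtain ⟨v, hv⟩ := Int.eq_ofNat_of_zero_le hv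
  have hκ : κ = r + 1 - v := by omega
  subst hκ
  rw [sub_sub_cancel, coeffInt_natCast] at h1 h2
  have top : ∀ i, v < i → (M.coeff (r + 1)).coeff i = 0 := by
    intro i hi
    have := coeff_indPoly_top hr.le (r + 1 - i)
    rw [h.vanish _ (by omega)] at this
    push_cast at this
    rw [sub_sub_cancel, coeffInt_natCast, coeff_zero] at this
    exact this.symm
  have hdeg : (M.coeff (r + 1)).natDegree = v :=
    le_antisymm (natDegree_le_iff_coeff_eq_zero.mpr top) (le_natDegree_of_ne_zero h1)
  refine ⟨fun i hi => ?_, ?_⟩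
  · have := coeff_indPoly_pred hr.le (r - i)
    rw [h.vanish _ (by omega), sub_sub_cancel, coeffInt_natCast, coeff_zero,
      show (r : ℤ) + 1 - (r - i) = (i + 1 : ℕ) by push_cast; ring, coeffInt_natCast,
      top _ (by omega)] at this
    simpa using this.symm
  · rw [leadingCoeff, hdeg, ← h2]
    congr 1
    ring

end WeylOp

end PfaffianMirror

end

/-! ### Fuchs' relation and the absence of right factors -/

noncomputable section

namespace PfaffianMirror

open Polynomial

namespace WeylOp

theorem X_sub_C_pow_dvd_iff_taylor (p : ℂ) (w : ℕ) (f : ℂ[X]) :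
    (X - C p) ^ w ∣ f ↔ ∀ i < w, (taylor p f).coeff i = 0 := by
  rw [← X_pow_dvd_iff, ← map_dvd_iff (taylorEquiv p)]
  have : (taylorEquiv p) ((X - C p) ^ w) = X ^ w := by
    rw [map_pow, map_sub]
    change (taylor p X - taylor p (C p)) ^ w = _
    rw [taylor_X, taylor_C, add_sub_cancel_right]
  rw [this]
  rfl

/-- The residues of a fraction `N / m` with simple poles add up to the residue at infinity. -/
theorem coeffInt_eq_sum_residues {m N : ℂ[X]} (hm : m ≠ 0)
    (hdeg : ∀ i, m.natDegree ≤ i → N.coeff i = 0) (ρ : ℂ → ℂ)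
    (hloc : ∀ p, ∃ v, (∀ i < v, (taylor p m).coeff i = 0) ∧ (taylor p m).coeff v ≠ 0 ∧
      (∀ i, i + 1 < v → (taylor p N).coeff i = 0) ∧
      coeffInt (taylor p N) (v - 1) = ρ p * (taylor p m).coeff v) :
    coeffInt N (m.natDegree - 1) = (∑ p ∈ m.roots.toFinset, ρ p) * m.leadingCoeff := by
  classical
  have hh : ∀ p ∈ m.roots.toFinset, ∃ h, m = (X - C p) * h := fun p hp =>
    dvd_iff_isRoot.mpr (by simpa [hm] using hp)
  choose! h hh using hh
  have hdegh : ∀ p ∈ m.roots.toFinset, (h p).natDegree + 1 = m.natDegree := by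
    intro p hp
    have h0 : h p ≠ 0 := fun h0 => hm (by rw [hh p hp, h0, mul_zero])
    have := congrArg natDegree (hh p hp)
    rw [natDegree_mul (X_sub_C_ne_zero p) h0, natDegree_X_sub_C] at this
    omega
  -- `h p` is m/(X - p), so U/m is N/m minus its expected principal parts.
  set U : ℂ[X] := N - ∑ p ∈ m.roots.toFinset, C (ρ p) * h p with hU
  have hUlow : ∀ i, m.natDegree ≤ i → U.coeff i = 0 := by
    intro i hi
    rw [hU, coeff_sub, hdeg i hi, finsetSum_coeff, Finset.sum_eq_zero, sub_zero]
    intro p hp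
    rw [coeff_C_mul, coeff_eq_zero_of_natDegree_lt (p := h p), mul_zero]
    have := hdegh p hp
    omega
  have hloc' : ∀ p ∈ m.roots.toFinset, (X - C p) ^ (m.rootMultiplicity p) ∣ U := by
    intro p hp
    obtain ⟨v, hv0, hv, hN, hres⟩ := hloc p
    have hw : m.rootMultiplicity p ≤ v := by
      by_contra! hlt
      exact hv ((X_sub_C_pow_dvd_iff_taylor p _ m).mp (pow_rootMultiplicity_dvd m p) v hlt)
    rw [X_sub_C_pow_dvd_iff_taylor]
    intro i hi
    have hiv : i < v := hi.trans_le hw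
    have e1 : ∀ i, (taylor p (h p)).coeff i = (taylor p m).coeff (i + 1) := by
      intro i
      conv_rhs => rw [hh p hp]
      rw [taylor_mul, map_sub, taylor_X, taylor_C, add_sub_cancel_right, coeff_X_mul]
    have e2 : ∀ q ∈ m.roots.toFinset, q ≠ p → ∀ i < v, (taylor p (h q)).coeff i = 0 := by
      intro q hq hqp i
      have hmul : ∀ j, (taylor p m).coeff j =
          (X * taylor p (h q)).coeff j + (p - q) * (taylor p (h q)).coeff j := by
        intro j
        conv_lhs => rw [hh q hq]
        rw [taylor_mul, map_sub, taylor_X, taylor_C, add_sub_assoc, ← C_sub, add_mul,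
          coeff_add, coeff_C_mul]
      have hne : p - q ≠ 0 := sub_ne_zero.mpr (Ne.symm hqp)
      induction i with
      | zero =>
        intro hi
        have := hmul 0
        rw [hv0 0 hi, mul_coeff_zero, coeff_X_zero, zero_mul, zero_add] at this
        exact (mul_eq_zero.mp this.symm).resolve_left hne
      | succ i ih =>
        intro hi
        have := hmul (i + 1)
        rw [hv0 _ hi, coeff_X_mul, ih (by omega), zero_add] at this
        exact (mul_eq_zero.mp this.symm).resolve_left hne
    have hC : ∀ q, taylor p (C (ρ q) * h q) = C (ρ q) * taylor p (h q) := fun q => by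
      rw [taylor_mul, taylor_C]
    rw [hU, map_sub, map_sum, coeff_sub, finsetSum_coeff, Finset.sum_eq_single p]
    · rw [hC, coeff_C_mul, e1]
      rcases (Nat.succ_le_of_lt hiv).eq_or_lt with h1 | h1
      · rw [← h1] at hres
        rw [show ((i.succ : ℕ) : ℤ) - 1 = i by push_cast; ring, coeffInt_natCast] at hres
        rw [hres, sub_self]
      · rw [hN i h1, hv0 _ h1, mul_zero, sub_zero]
    · intro q hq hqp
      rw [hC, coeff_C_mul, e2 q hq hqp i hiv, mul_zero]
    · exact fun hn => absurd hp hn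
  -- U is divisible by m, counted with multiplicity, but has smaller degree.
  have hU0 : U = 0 := by
    by_contra hne
    have hle : m.roots ≤ U.roots := by
      rw [Multiset.le_iff_count]
      intro p
      by_cases hp : p ∈ m.roots
      · rw [count_roots, count_roots]
        exact (le_rootMultiplicity_iff hne).mpr (hloc' p (Multiset.mem_toFinset.mpr hp))
      · rw [Multiset.count_eq_zero_of_notMem hp]
        exact Nat.zero_le _
    have h1 := Multiset.card_le_card hle
    rw [← (IsAlgClosed.splits m).natDegree_eq_card_roots] at h1
    have h2 := card_roots' U
    exact hne (leadingCoeff_eq_zero.mp (hUlow _ (h1.trans h2)))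
  have hN := sub_eq_zero.mp hU0
  rcases Nat.eq_zero_or_pos m.natDegree with hd | hd
  · have : m.roots = 0 := by
      rw [← Multiset.card_eq_zero, ← (IsAlgClosed.splits m).natDegree_eq_card_roots, hd]
    rw [this, hd, coeffInt_of_neg _ (by simp)]
    simp
  · obtain ⟨d, hd'⟩ : ∃ d, m.natDegree = d + 1 := ⟨m.natDegree - 1, by omega⟩
    rw [hd', show ((d + 1 : ℕ) : ℤ) - 1 = d by push_cast; ring, coeffInt_natCast, hN,
      finsetSum_coeff, Finset.sum_mul]
    refine Finset.sum_congr rfl fun p hp => ?_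
    have e : m.leadingCoeff = (h p).coeff d := by
      rw [leadingCoeff, hd']
      conv_lhs => rw [hh p hp]
      have := hdegh p hp
      rw [sub_mul, coeff_sub, coeff_X_mul, coeff_C_mul,
        coeff_eq_zero_of_natDegree_lt (p := h p) (n := d + 1) (by omega), mul_zero, sub_zero]
    rw [coeff_C_mul, e]

theorem exists_nat_sum {s : Multiset ℂ} (h : ∀ x ∈ s, ∃ n : ℕ, x = n) : ∃ n : ℕ, s.sum = n := by
  induction s using Multiset.induction with
  | empty => exact ⟨0, by simp⟩
  | cons a s ih =>
    obtain ⟨n, hn⟩ := ih fun x hx => h x (Multiset.mem_cons_of_mem hx)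
    obtain ⟨k, hk⟩ := h a (Multiset.mem_cons_self a s)
    exact ⟨k + n, by rw [Multiset.sum_cons, hn, hk]; push_cast; ring⟩

/-- An operator of order `4` which has the local exponents of a Calabi–Yau operator with exponents
`(0, 0, 0, 0)` at `0`, `(1/2, 1/2, 1/2, 1/2)` at `∞` and natural numbers, at most one of them zero,
elsewhere has no right factor of order `1`, `2` or `3`. -/
theorem no_right_factor {D Q M : WeylOp}
    (h0 : ∃ κ f, IsExtremal 1 D κ f ∧ f.natDegree = 4 ∧ ∀ s ∈ f.roots, s = 0)
    (hinf : ∃ κ f, IsExtremal (-1) D κ f ∧ f.natDegree = 4 ∧ ∀ s ∈ f.roots, s = -1 / 2)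
    (hp : ∀ p : ℂ, p ≠ 0 → ∃ κ f, IsExtremal 1 (shift p D) κ f ∧ f.natDegree = 4 ∧
      (∀ s ∈ f.roots, ∃ n : ℕ, s = n) ∧ f.roots.count 0 ≤ 1)
    {g : ℂ[X]} (hg : g ≠ 0) (hM : M ≠ 0) (hQ : Q ≠ 0) (h : g • D = opMul M Q)
    (hdeg : M.natDegree + Q.natDegree ≤ 4) (hpos : 0 < M.natDegree) (hlt : M.natDegree < 4) :
    False := by
  classical
  obtain ⟨r, hr⟩ : ∃ r, M.natDegree = r + 1 := ⟨M.natDegree - 1, by omega⟩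
  have hshift : ∀ p, taylor p g ≠ 0 ∧ shift p M ≠ 0 ∧ shift p Q ≠ 0 ∧
      taylor p g • shift p D = opMul (shift p M) (shift p Q) := by
    intro p
    have hinj : Function.Injective (shift p) := by
      intro a b hab
      ext1 j
      apply taylor_injective p
      rw [← coeff_shift, ← coeff_shift, hab]
    refine ⟨fun h0 => hg (taylor_injective p (by rw [h0, map_zero])), ?_, ?_, ?_⟩
    · exact fun h0 => hM (hinj (by rw [h0, map_zero]))
    · exact fun h0 => hQ (hinj (by rw [h0, map_zero]))
    · rw [← shift_opMul, ← h, shift_smul]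
  -- exponents of the right factor at a point other than `0`
  have hexp : ∀ p : ℂ, p ≠ 0 → ∃ n : ℕ, (r = 1 → 1 ≤ n) ∧ ∃ κ f, IsExtremal 1 (shift p M) κ f ∧
      f.natDegree = r + 1 ∧ f.roots.sum = n := by
    intro p hp0
    obtain ⟨κ, f, hD, hf, hnat, hcount⟩ := hp p hp0
    obtain ⟨hg', hM', hQ', h'⟩ := hshift p
    obtain ⟨κ', f', hf', hd, hroots⟩ := hD.of_dvd one_ne_zero hg' hM' hQ' h'
      (by rw [natDegree_shift, natDegree_shift, hf]; exact hdeg)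
    rw [natDegree_shift, hr] at hd
    obtain ⟨n, hn⟩ := exists_nat_sum fun x hx => hnat x (Multiset.mem_of_le hroots hx)
    -- For order two, exponent sum zero would make both natural exponents zero, against the bound on
    -- the multiplicity of the root 0.
    refine ⟨n, fun h1 => ?_, κ', f', hf', hd, hn⟩
    by_contra hn0
    have hn0 : n = 0 := by omega
    have hcard : f'.roots.card = 2 := by
      rw [← (IsAlgClosed.splits f').natDegree_eq_card_roots, hd, h1]
    obtain ⟨a, b, hab⟩ := Multiset.card_eq_two.mp hcard
    obtain ⟨na, ha⟩ := hnat a (Multiset.mem_of_le hroots (by simp [hab]))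
    obtain ⟨nb, hb⟩ := hnat b (Multiset.mem_of_le hroots (by simp [hab]))
    rw [hab, hn0, ha, hb] at hn
    simp only [Multiset.insert_eq_cons, Multiset.sum_cons, Multiset.sum_singleton] at hn
    have hsum : na + nb = 0 := by exact_mod_cast hn
    have hna : na = 0 := by omega
    have hnb : nb = 0 := by omega
    have h2 := (Multiset.le_iff_count.mp hroots 0).trans hcount
    rw [hab, ha, hb, hna, hnb] at h2
    simp at h2
  choose! n hn1 κ f hf hfd hfs using hexp
  -- The residue at p of the quotient of the two leading coefficients of M; at 0 all exponents
  -- vanish.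
  set ρ : ℂ → ℂ := fun p => ((r + 1).choose 2 : ℂ) - if p = 0 then 0 else (n p : ℂ) with hρ
  have hzero : ∃ κ f, IsExtremal 1 M κ f ∧ f.natDegree = r + 1 ∧ f.roots.sum = 0 := by
    obtain ⟨κ, f, hD, hf, hz⟩ := h0
    obtain ⟨κ', f', hf', hd, hroots⟩ := hD.of_dvd one_ne_zero hg hM hQ h (by rw [hf]; exact hdeg)
    refine ⟨κ', f', hf', hd.trans hr, Multiset.sum_eq_zero fun x hx => ?_⟩
    exact hz x (Multiset.mem_of_le hroots hx)
  have hloc : ∀ p, ∃ v, (∀ i < v, (taylor p (M.coeff (r + 1))).coeff i = 0) ∧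
      (taylor p (M.coeff (r + 1))).coeff v ≠ 0 ∧
      (∀ i, i + 1 < v → (taylor p (M.coeff r)).coeff i = 0) ∧
      coeffInt (taylor p (M.coeff r)) (v - 1) =
        ρ p * (taylor p (M.coeff (r + 1))).coeff v := by
    intro p
    by_cases hp0 : p = 0
    · obtain ⟨κ, f, h1, h2, h3⟩ := hzero
      obtain ⟨v, hv⟩ := h1.local_coeff hr h2
      rw [h3] at hv
      refine ⟨v, ?_⟩
      subst hp0
      simpa only [taylor_zero, hρ, if_pos] using hv
    · obtain ⟨v, hv⟩ := (hf p hp0).local_coeff (by rw [natDegree_shift, hr]) (hfd p hp0)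
      rw [hfs p hp0] at hv
      refine ⟨v, ?_⟩
      simpa only [coeff_shift, hρ, if_neg hp0] using hv
  obtain ⟨hdegN, hinf'⟩ : (∀ i : ℕ, (M.coeff (r + 1)).natDegree ≤ i → (M.coeff r).coeff i = 0) ∧
      coeffInt (M.coeff r) ((M.coeff (r + 1)).natDegree - 1) =
        (((r + 1).choose 2 : ℂ) + (r + 1) / 2) * (M.coeff (r + 1)).leadingCoeff := by
    obtain ⟨κ, f, hD, hf, hz⟩ := hinf
    obtain ⟨κ', f', hf', hd, hroots⟩ :=
      hD.of_dvd (by norm_num) hg hM hQ h (by rw [hf]; exact hdeg)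
    obtain ⟨h1, h2⟩ := hf'.infinity_coeff hr (hd.trans hr)
    refine ⟨h1, ?_⟩
    have hrep : f'.roots = Multiset.replicate (r + 1) (-1 / 2) := by
      refine Multiset.eq_replicate.mpr ⟨?_, fun x hx => hz x (Multiset.mem_of_le hroots hx)⟩
      rw [← (IsAlgClosed.splits f').natDegree_eq_card_roots, hd, hr]
    rw [h2, hrep, Multiset.sum_replicate]
    simp
    left
    ring
  have hlead : M.coeff (r + 1) ≠ 0 := by
    rw [← hr]; exact leadingCoeff_ne_zero.mpr hM
  have hres := coeffInt_eq_sum_residues hlead hdegN ρ hloc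
  rw [hinf'] at hres
  have hsum := mul_right_cancel₀ (leadingCoeff_ne_zero.mpr hlead) hres
  -- Fuchs' relation for M, after cancelling the C(r+1,2) of 0 against that of ∞.
  have hsum' : ((r : ℂ) + 1) / 2 = ∑ p ∈ (M.coeff (r + 1)).roots.toFinset.erase 0,
      (((r + 1).choose 2 : ℂ) - n p) := by
    have hcongr : ∑ p ∈ (M.coeff (r + 1)).roots.toFinset.erase 0, ρ p =
        ∑ p ∈ (M.coeff (r + 1)).roots.toFinset.erase 0, (((r + 1).choose 2 : ℂ) - n p) :=
      Finset.sum_congr rfl fun p hp => by simp only [hρ, if_neg (Finset.ne_of_mem_erase hp)]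
    have hρ0 : ρ 0 = ((r + 1).choose 2 : ℂ) := by simp [hρ]
    by_cases hmem : (0 : ℂ) ∈ (M.coeff (r + 1)).roots.toFinset
    · rw [← Finset.add_sum_erase _ _ hmem, hcongr, hρ0] at hsum
      linear_combination hsum
    · rw [← Finset.erase_eq_of_notMem hmem, hcongr] at hsum
      -- If the leading coefficient does not vanish at 0, the local relation there gives C(r+1,2) =
      -- 0, so the missing term is zero anyway.
      obtain ⟨v, h1, h2, -, h4⟩ := hloc 0
      have hv : v = 0 := by
        by_contra hv
        have := h1 0 (Nat.pos_of_ne_zero hv)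
        rw [taylor_coeff_zero] at this
        exact hmem (by simpa [hlead] using this)
      subst hv
      rw [coeffInt_of_neg _ (by simp), hρ0] at h4
      have h5 := (mul_eq_zero.mp h4.symm).resolve_right h2
      linear_combination hsum - h5
  set T := (M.coeff (r + 1)).roots.toFinset.erase 0
  have hint : ((r : ℤ) + 1) = 2 * ∑ p ∈ T, (((r + 1).choose 2 : ℤ) - n p) := by
    have : ((r : ℂ) + 1) = 2 * ∑ p ∈ T, (((r + 1).choose 2 : ℂ) - n p) := by
      rw [← hsum']; ring
    exact_mod_cast this
  have hr3 : r ≤ 2 := by omega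
  -- Orders 1 and 3 fail by parity. For order 2 the left side of `hint` is 2 and the right side is
  -- at most 0.
  interval_cases r
  · omega
  · have hle : ∑ p ∈ T, ((((1 + 1).choose 2 : ℕ) : ℤ) - n p) ≤ 0 := by
      refine Finset.sum_nonpos fun p hp => ?_
      have := hn1 p (Finset.ne_of_mem_erase hp) rfl
      simp
      omega
    omega
  · omega

end WeylOp

end PfaffianMirror

end

/-! ### The operator `D10` in explicit form, and its exponents at 0 and ∞ -/

noncomputable section

namespace PfaffianMirror

open Polynomial

/-- A polynomial of degree at most four with given coefficients. -/
def quartic (a b c d e : ℂ) : ℂ[X] := C a + C b * X + C c * X ^ 2 + C d * X ^ 3 + C e * X ^ 4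

theorem coeff_quartic (a b c d e : ℂ) (i : ℕ) : (quartic a b c d e).coeff i =
    if i = 0 then a else if i = 1 then b else if i = 2 then c else if i = 3 then d else
      if i = 4 then e else 0 := by
  simp only [quartic, coeff_add, coeff_C_mul, coeff_X_pow, coeff_C, coeff_X]
  rcases i with _ | _ | _ | _ | _ | i <;> simp

theorem coeff_quartic_of_lt (a b c d e : ℂ) {i : ℕ} (hi : 4 < i) :
    (quartic a b c d e).coeff i = 0 := by
  rw [coeff_quartic]
  repeat rw [if_neg (by omega)]

theorem eval_quartic (a b c d e p : ℂ) : (quartic a b c d e).eval p =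
    a + b * p + c * p ^ 2 + d * p ^ 3 + e * p ^ 4 := by
  simp [quartic]

theorem D10_eq : D10 = monomial 0 (quartic 0 (-700) (-4240) (-5120) 4096) +
    monomial 1 (quartic 0 (-6100) (-20160) (-30720) 32768) +
    monomial 2 (quartic 0 (-19620) 1536 (-70656) 98304) +
    monomial 3 (quartic 0 (-27040) 112128 (-122880) 131072) +
    monomial 4 (quartic 25 (-13760) 93696 (-180224) 65536) := by
  simp only [D10, quartic, ← C_mul_X_pow_eq_monomial, map_add, map_mul, map_pow, map_neg,
    map_ofNat, map_zero, pow_zero, pow_one]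
  ring

theorem natDegree_D10_le : D10.natDegree ≤ 4 := by
  rw [natDegree_le_iff_coeff_eq_zero]
  intro j hj
  rw [D10_eq]
  simp only [coeff_add, coeff_monomial]
  rw [if_neg (by omega), if_neg (by omega), if_neg (by omega), if_neg (by omega),
    if_neg (by omega)]
  simp

theorem D10_ne_zero : D10 ≠ 0 := by
  intro h
  have h1 : (D10.coeff 4).coeff 0 = 25 := by
    rw [D10_eq]
    simp [coeff_monomial, coeff_quartic]
  rw [h] at h1
  simp at h1

theorem D10_isPrimitive : D10.IsPrimitive := by
  intro r hr
  rw [C_dvd_iff_dvd_coeff] at hr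
  have h0 := hr 0
  have h1 := hr 1
  have h2 := hr 2
  have h3 := hr 3
  have h4 := hr 4
  rw [D10_eq] at h0 h1 h2 h3 h4
  simp [coeff_monomial] at h0 h1 h2 h3 h4
  refine isUnit_of_dvd_one ?_
  -- The coefficients span 1 over ℂ: only that of Θ⁴ has a constant term, and the other four
  -- eliminate its higher powers.
  have : (1 : ℂ[X]) = C (51053 / 6000) * quartic 0 (-700) (-4240) (-5120) 4096 +
      C (-10329 / 4000) * quartic 0 (-6100) (-20160) (-30720) 32768 +
      C (419 / 576) * quartic 0 (-19620) 1536 (-70656) 98304 +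
      C (-7139 / 38400) * quartic 0 (-27040) 112128 (-122880) 131072 +
      C (1 / 25) * quartic 25 (-13760) 93696 (-180224) 65536 := by
    ext i
    simp only [coeff_add, coeff_C_mul, coeff_one]
    rcases Nat.lt_or_ge 4 i with hi | hi
    · simp only [coeff_quartic_of_lt _ _ _ _ _ hi]
      rw [if_neg (by omega)]
      ring
    · simp only [coeff_quartic]
      interval_cases i <;> norm_num
  rw [this]
  exact dvd_add (dvd_add (dvd_add (dvd_add (h0.mul_left _) (h1.mul_left _)) (h2.mul_left _))
    (h3.mul_left _)) (h4.mul_left _)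

namespace WeylOp

/-- The expansion of `D10` in powers of `∂`. -/
def weylD10 : WeylOp :=
  monomial 0 (quartic 0 (-700) (-4240) (-5120) 4096) +
    monomial 1 (X * quartic 25 (-66520) 187200 (-404480) 327680) +
    monomial 2 (X ^ 2 * quartic 175 (-197060) 993792 (-1700864) 950272) +
    monomial 3 (X ^ 3 * quartic 150 (-109600) 674304 (-1204224) 524288) +
    monomial 4 (X ^ 4 * quartic 25 (-13760) 93696 (-180224) 65536)

theorem smul_partialMul_monomial_X_pow (j i : ℕ) :
    (X : ℂ[X]) • partialMul (monomial j (X ^ i)) =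
      monomial (j + 1) (X ^ (i + 1)) + i • monomial j (X ^ i) := by
  rw [partialMul_apply, coeffDeriv_monomial, X_mul_monomial, smul_add, smul_monomial,
    smul_monomial, derivative_X_pow, ← map_nsmul]
  congr 2
  · simp [pow_succ']
  · cases i <;> simp [pow_succ]
    ring

/-- Θ(Xⁱ∂ʲ) = Xⁱ⁺¹∂ʲ⁺¹ + i Xⁱ∂ʲ, so Θⁿ expands in the Xʲ∂ʲ with Stirling numbers of the second kind.
-/
theorem ofTheta_D10 : ofTheta D10 = weylD10 := by
  set T : WeylOp → WeylOp := fun M => (X : ℂ[X]) • partialMul M with hT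
  have hadd : ∀ a b, T (a + b) = T a + T b := fun a b => by simp [hT]
  have hsmul : ∀ (n : ℕ) a, T (n • a) = n • T a := fun n a => by
    simp only [hT, map_nsmul]
    rw [smul_comm]
  have hmono : ∀ j i : ℕ, T (monomial j (X ^ i)) =
    monomial (j + 1) (X ^ (i + 1)) + i • monomial j (X ^ i) := smul_partialMul_monomial_X_pow
  have e0 : (1 : WeylOp) = monomial 0 (X ^ 0) := by simp
  have t1 : T (monomial 0 (X ^ 0)) = monomial 1 (X ^ 1) := by rw [hmono, zero_nsmul, add_zero]
  have t2 : T (monomial 1 (X ^ 1)) = monomial 2 (X ^ 2) + monomial 1 (X ^ 1) := by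
    rw [hmono, one_nsmul]
  have t3 : T (monomial 2 (X ^ 2)) = monomial 3 (X ^ 3) + 2 • monomial 2 (X ^ 2) := hmono 2 2
  have t4 : T (monomial 3 (X ^ 3)) = monomial 4 (X ^ 4) + 3 • monomial 3 (X ^ 3) := hmono 3 3
  rw [D10_eq, weylD10]
  simp only [map_add, ofTheta_monomial, e0, Function.iterate_succ_apply',
    Function.iterate_zero_apply, ← hT, hadd, hsmul, t1, t2, t3, t4]
  ext1 j
  simp only [coeff_add, coeff_monomial, coeff_smul, smul_eq_mul, nsmul_eq_mul]
  rcases j with _ | _ | _ | _ | _ | j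
  all_goals simp [coeff_monomial]
  all_goals simp only [quartic, map_neg, map_ofNat, map_zero]
  all_goals ring

theorem natDegree_weylD10_le : weylD10.natDegree ≤ 4 :=
  ofTheta_D10 ▸ (natDegree_ofTheta_le D10).trans natDegree_D10_le

theorem coeff_weylD10 :
    weylD10.coeff 0 = X ^ 0 * quartic 0 (-700) (-4240) (-5120) 4096 ∧
    weylD10.coeff 1 = X ^ 1 * quartic 25 (-66520) 187200 (-404480) 327680 ∧
    weylD10.coeff 2 = X ^ 2 * quartic 175 (-197060) 993792 (-1700864) 950272 ∧
    weylD10.coeff 3 = X ^ 3 * quartic 150 (-109600) 674304 (-1204224) 524288 ∧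
    weylD10.coeff 4 = X ^ 4 * quartic 25 (-13760) 93696 (-180224) 65536 := by
  refine ⟨?_, ?_, ?_, ?_, ?_⟩ <;> simp [weylD10, coeff_monomial]

theorem coeffInt_X_pow_mul_quartic (j : ℕ) (a b c d e : ℂ) (k : ℤ) :
    coeffInt (X ^ j * quartic a b c d e) (j - k) =
      if k = 0 then a else if k = -1 then b else if k = -2 then c else if k = -3 then d else
        if k = -4 then e else 0 := by
  rcases lt_or_ge ((j : ℤ) - k) 0 with h | h
  · rw [coeffInt_of_neg _ h]
    repeat rw [if_neg (by omega)]
  · obtain ⟨n, hn⟩ := Int.eq_ofNat_of_zero_le h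
    rw [hn, coeffInt_natCast, coeff_X_pow_mul']
    by_cases hk : 0 < k
    · rw [if_neg (by omega)]
      repeat rw [if_neg (by omega)]
    · rw [if_pos (by omega), coeff_quartic]
      have : ∀ i : ℕ, (n - j = i) ↔ (k = -(i : ℤ)) := fun i => by omega
      simp only [this]
      rfl

theorem descPochhammer_explicit : descPochhammer ℂ 0 = 1 ∧ descPochhammer ℂ 1 = X ∧
    descPochhammer ℂ 2 = X * (X - 1) ∧ descPochhammer ℂ 3 = X * (X - 1) * (X - 2) ∧
    descPochhammer ℂ 4 = X * (X - 1) * (X - 2) * (X - 3) := by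
  simp [descPochhammer_succ_right]

/-- Θ preserves the degree of monomials and φⁱ raises it by i, so only the parts from -4 to 0 occur.
-/
theorem indPoly_weylD10 (k : ℤ) (hk : k ≠ 0) (hk1 : k ≠ -1) (hk2 : k ≠ -2) (hk3 : k ≠ -3)
    (hk4 : k ≠ -4) : indPoly k weylD10 = 0 := by
  obtain ⟨h0, h1, h2, h3, h4⟩ := coeff_weylD10
  rw [indPoly_eq_sum natDegree_weylD10_le]
  simp only [Finset.sum_range_succ, Finset.sum_range_zero, h0, h1, h2, h3, h4,
    coeffInt_X_pow_mul_quartic, hk, hk1, hk2, hk3, hk4, if_false, map_zero, zero_mul, add_zero]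

theorem weylD10_isExtremal_zero :
    ∃ κ f, IsExtremal 1 weylD10 κ f ∧ f.natDegree = 4 ∧ ∀ s ∈ f.roots, s = 0 := by
  refine ⟨0, C 25 * X ^ 4, ⟨?_, by simp, fun k hk => ?_⟩, ?_, ?_⟩
  · obtain ⟨h0, h1, h2, h3, h4⟩ := coeff_weylD10
    obtain ⟨p0, p1, p2, p3, p4⟩ := descPochhammer_explicit
    rw [indPoly_eq_sum natDegree_weylD10_le]
    simp only [Finset.sum_range_succ, Finset.sum_range_zero, h0, h1, h2, h3, h4,
      coeffInt_X_pow_mul_quartic, p0, p1, p2, p3, p4, if_true, map_ofNat, map_zero]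
    ring
  · exact indPoly_weylD10 k (by omega) (by omega) (by omega) (by omega) (by omega)
  · rw [natDegree_C_mul (by norm_num), natDegree_X_pow]
  · intro s hs
    rw [roots_C_mul _ (by norm_num), roots_X_pow] at hs
    simpa using Multiset.mem_of_mem_nsmul hs

theorem weylD10_isExtremal_infinity :
    ∃ κ f, IsExtremal (-1) weylD10 κ f ∧ f.natDegree = 4 ∧ ∀ s ∈ f.roots, s = -1 / 2 := by
  have hX : (X - C (-1 / 2 : ℂ)) ^ 4 ≠ 0 := pow_ne_zero _ (X_sub_C_ne_zero _)
  refine ⟨-4, C 65536 * (X - C (-1 / 2)) ^ 4, ⟨?_, ?_, fun k hk => ?_⟩, ?_, ?_⟩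
  · obtain ⟨h0, h1, h2, h3, h4⟩ := coeff_weylD10
    obtain ⟨p0, p1, p2, p3, p4⟩ := descPochhammer_explicit
    rw [indPoly_eq_sum natDegree_weylD10_le]
    simp only [Finset.sum_range_succ, Finset.sum_range_zero, h0, h1, h2, h3, h4,
      coeffInt_X_pow_mul_quartic, p0, p1, p2, p3, p4]
    have h2 : (2 : ℂ[X]) * (X - C (-1 / 2)) = 2 * X + 1 := by
      rw [← map_ofNat C 2, mul_sub, ← map_mul]
      norm_num
    have h3 : C 65536 * (X - C (-1 / 2)) ^ 4 = 4096 * ((2 : ℂ[X]) * (X - C (-1 / 2))) ^ 4 := by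
      simp only [map_ofNat]
      ring
    rw [h3, h2]
    norm_num
    simp only [map_ofNat]
    ring
  · exact mul_ne_zero (by simp) hX
  · exact indPoly_weylD10 k (by omega) (by omega) (by omega) (by omega) (by omega)
  · rw [natDegree_C_mul (by norm_num), natDegree_pow, natDegree_X_sub_C]
  · intro s hs
    rw [roots_C_mul _ (by norm_num), roots_pow, roots_X_sub_C] at hs
    simpa using Multiset.mem_of_mem_nsmul hs

end WeylOp

end PfaffianMirror

end

/-! ### Exponents of `D10` at the other points -/

noncomputable section

namespace PfaffianMirror

open Polynomial

namespace WeylOp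

theorem exists_isExtremal_of_eq {M : WeylOp} {κ : ℤ} {a : ℂ} (ha : a ≠ 0) {e₁ e₂ e₃ : ℕ}
    (h₁ : 0 < e₁) (h₂ : 0 < e₂) (h₃ : 0 < e₃)
    (h : indPoly κ M = C a * (X * (X - C (e₁ : ℂ)) * (X - C (e₂ : ℂ)) * (X - C (e₃ : ℂ))))
    (hv : ∀ k, κ < k → indPoly k M = 0) :
    ∃ κ f, IsExtremal 1 M κ f ∧ f.natDegree = 4 ∧
      (∀ s ∈ f.roots, ∃ n : ℕ, s = n) ∧ f.roots.count 0 ≤ 1 := by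
  set s : Multiset ℂ := {0, (e₁ : ℂ), (e₂ : ℂ), (e₃ : ℂ)} with hs
  have hf : C a * (X * (X - C (e₁ : ℂ)) * (X - C (e₂ : ℂ)) * (X - C (e₃ : ℂ))) =
      C a * (s.map fun r => X - C r).prod := by
    simp [hs, mul_assoc]
  have hroots : (C a * (s.map fun r => X - C r).prod).roots = s := by
    rw [roots_C_mul _ ha, roots_multiset_prod_X_sub_C]
  have hne : C a * (s.map fun r => X - C r).prod ≠ 0 :=
    mul_ne_zero (by simpa using ha) (monic_multiset_prod_of_monic _ _ fun r _ =>
      monic_X_sub_C r).ne_zero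
  rw [hf] at h
  refine ⟨κ, _, ⟨h, hne, fun k hk => hv k (by omega)⟩, ?_, ?_, ?_⟩
  · rw [(IsAlgClosed.splits _).natDegree_eq_card_roots, hroots]
    simp [hs]
  · rw [hroots]
    intro r hr
    simp only [hs, Multiset.insert_eq_cons, Multiset.mem_cons, Multiset.mem_singleton] at hr
    rcases hr with rfl | rfl | rfl | rfl
    exacts [⟨0, by simp⟩, ⟨_, rfl⟩, ⟨_, rfl⟩, ⟨_, rfl⟩]
  · rw [hroots]
    have g₁ : (0 : ℂ) ≠ e₁ := by exact_mod_cast h₁.ne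
    have g₂ : (0 : ℂ) ≠ e₂ := by exact_mod_cast h₂.ne
    have g₃ : (0 : ℂ) ≠ e₃ := by exact_mod_cast h₃.ne
    simp only [hs, Multiset.insert_eq_cons, Multiset.count_cons_self,
      Multiset.count_cons_of_ne g₁, Multiset.count_cons_of_ne g₂, Multiset.count_singleton,
      if_neg g₃]
    norm_num

theorem coeffInt_taylor_zero (p : ℂ) (f : ℂ[X]) : coeffInt (taylor p f) 0 = f.eval p := by
  rw [← taylor_coeff_zero]; exact coeffInt_natCast _ 0

theorem coeffInt_taylor_one (p : ℂ) (f : ℂ[X]) :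
    coeffInt (taylor p f) 1 = f.derivative.eval p := by
  rw [← taylor_coeff_one]; exact coeffInt_natCast _ 1

theorem eval_derivative_X_pow_mul_quartic (j : ℕ) (a b c d e p : ℂ) :
    (derivative (X ^ j * quartic a b c d e)).eval p =
      j * p ^ (j - 1) * (a + b * p + c * p ^ 2 + d * p ^ 3 + e * p ^ 4) +
        p ^ j * (b + 2 * c * p + 3 * d * p ^ 2 + 4 * e * p ^ 3) := by
  have h : (derivative (quartic a b c d e)).eval p =
      b + 2 * c * p + 3 * d * p ^ 2 + 4 * e * p ^ 3 := by
    simp [quartic]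
    ring
  rw [derivative_mul, eval_add, eval_mul, eval_mul, eval_quartic, derivative_X_pow, h, eval_mul,
    eval_C, eval_pow, eval_pow, eval_X]

/-- The local exponents of `D10` away from `0` and `∞`. -/
theorem weylD10_isExtremal_shift (p : ℂ) (hp : p ≠ 0) :
    ∃ κ f, IsExtremal 1 (shift p weylD10) κ f ∧ f.natDegree = 4 ∧
      (∀ s ∈ f.roots, ∃ n : ℕ, s = n) ∧ f.roots.count 0 ≤ 1 := by
  obtain ⟨h0, h1, h2, h3, h4⟩ := coeff_weylD10
  obtain ⟨p0, p1, p2, p3, p4⟩ := descPochhammer_explicit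
  have hsum : ∀ k, indPoly k (shift p weylD10) =
      ∑ j ∈ Finset.range 5, C (coeffInt (taylor p (weylD10.coeff j)) (j - k)) *
        descPochhammer ℂ j := fun k => by
    rw [indPoly_eq_sum ((natDegree_shift p weylD10).le.trans natDegree_weylD10_le)]
    simp only [coeff_shift]
  simp only [Finset.sum_range_succ, Finset.sum_range_zero, zero_add, p0, p1, p2, p3, p4,
    Nat.cast_zero, Nat.cast_one, Nat.cast_ofNat] at hsum
  have hbig : ∀ k, 4 < k → indPoly k (shift p weylD10) = 0 := fun k hk => by
    rw [hsum, coeffInt_of_neg _ (by omega), coeffInt_of_neg _ (by omega),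
      coeffInt_of_neg _ (by omega), coeffInt_of_neg _ (by omega), coeffInt_of_neg _ (by omega)]
    simp
  have hk4 : indPoly 4 (shift p weylD10) =
      C ((weylD10.coeff 4).eval p) * (X * (X - 1) * (X - 2) * (X - 3)) := by
    rw [hsum, coeffInt_of_neg _ (by omega), coeffInt_of_neg _ (by omega),
      coeffInt_of_neg _ (by omega), coeffInt_of_neg _ (by omega), sub_self, coeffInt_taylor_zero]
    simp
  by_cases hlead : (weylD10.coeff 4).eval p = 0
  swap
  -- An ordinary point has the exponents 0, 1, 2, 3.
  · refine exists_isExtremal_of_eq hlead (e₁ := 1) (e₂ := 2) (e₃ := 3) (by norm_num)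
      (by norm_num) (by norm_num) ?_ hbig
    rw [hk4]
    simp only [Nat.cast_one, Nat.cast_ofNat, map_one, map_ofNat]
  have hv4 : ∀ k, 3 < k → indPoly k (shift p weylD10) = 0 := fun k hk => by
    rcases (show 4 ≤ k by omega).eq_or_lt with rfl | h
    · rw [hk4, hlead, map_zero, zero_mul]
    · exact hbig k h
  have hk3 : indPoly 3 (shift p weylD10) =
      C ((weylD10.coeff 3).eval p) * (X * (X - 1) * (X - 2)) +
        C ((derivative (weylD10.coeff 4)).eval p) * (X * (X - 1) * (X - 2) * (X - 3)) := by
    rw [hsum, coeffInt_of_neg _ (by omega), coeffInt_of_neg _ (by omega),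
      coeffInt_of_neg _ (by omega), sub_self, coeffInt_taylor_zero,
      show (4 : ℤ) - 3 = 1 by norm_num, coeffInt_taylor_one]
    simp
  have hfac : (16 * p - 5) ^ 2 * (256 * p ^ 2 - 544 * p + 1) = 0 := by
    rw [h4, eval_mul, eval_quartic, eval_pow, eval_X] at hlead
    rw [← (mul_eq_zero.mp hlead).resolve_left (pow_ne_zero _ hp)]
    ring
  rcases mul_eq_zero.mp hfac with hA | hB
  · -- the apparent singularity
    have hp' : p = 5 / 16 := by
      have := pow_eq_zero_iff (two_ne_zero) |>.mp hA
      linear_combination this / 16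
    have hv3 : ∀ k, 2 < k → indPoly k (shift p weylD10) = 0 := fun k hk => by
      rcases (show 3 ≤ k by omega).eq_or_lt with rfl | h
      · rw [hk3, h3, h4, eval_derivative_X_pow_mul_quartic, eval_mul, eval_quartic, hp']
        norm_num
      · exact hv4 k h
    have hc4 : coeffInt (taylor p (weylD10.coeff 4)) 2 = p ^ 4 * (-36864) := by
      have hq : weylD10.coeff 4 = (C 16 * X - C 5) ^ 2 * (X ^ 4 * quartic 1 (-544) 256 0 0) := by
        rw [h4]
        simp only [quartic, map_neg, map_ofNat, map_zero, map_one]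
        ring
      have ht : taylor p (C 16 * X - C 5 : ℂ[X]) = C 16 * X := by
        rw [map_sub, taylor_mul, taylor_C, taylor_C, taylor_X, hp', mul_add, ← C_mul]
        norm_num
      rw [hq, taylor_mul, taylor_pow, ht, mul_pow, mul_comm (C 16 ^ 2), mul_assoc,
        ← map_pow]
      have := coeffInt_natCast (X ^ 2 * (C ((16 : ℂ) ^ 2) *
        taylor p (X ^ 4 * quartic 1 (-544) 256 0 0))) 2
      rw [Nat.cast_ofNat] at this
      rw [this, coeff_X_pow_mul', if_pos le_rfl, coeff_C_mul, Nat.sub_self, taylor_coeff_zero,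
        eval_mul, eval_quartic, eval_pow, eval_X, hp']
      norm_num
    refine exists_isExtremal_of_eq (κ := 2) (a := -3600 * p ^ 2) (e₁ := 1) (e₂ := 3) (e₃ := 4)
      (mul_ne_zero (by norm_num) (pow_ne_zero _ hp)) (by norm_num) (by norm_num) (by norm_num)
      ?_ hv3
    rw [hsum, coeffInt_of_neg _ (by omega), coeffInt_of_neg _ (by omega), sub_self,
      show (3 : ℤ) - 2 = 1 by norm_num, show (4 : ℤ) - 2 = 2 by norm_num, coeffInt_taylor_zero,
      coeffInt_taylor_one, hc4, h2, h3, eval_derivative_X_pow_mul_quartic, eval_mul,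
      eval_quartic, eval_pow, eval_X]
    -- Up to the factor -3600p² s(s-1), the indicial polynomial is (s-2)(s-3) - 2(s-2) + 2 =
    -- (s-3)(s-4).
    have e1 : p ^ 2 * (175 + -197060 * p + 993792 * p ^ 2 + -1700864 * p ^ 3 +
        950272 * p ^ 4) = p ^ 2 * (-7200) := by
      rw [hp']; norm_num
    have e2 : ((3 : ℕ) : ℂ) * p ^ (3 - 1) * (150 + -109600 * p + 674304 * p ^ 2 +
        -1204224 * p ^ 3 + 524288 * p ^ 4) + p ^ 3 * (-109600 + 2 * 674304 * p +
          3 * -1204224 * p ^ 2 + 4 * 524288 * p ^ 3) = p ^ 2 * 7200 := by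
      rw [hp']; norm_num
    have e3 : p ^ 4 * (-36864) = p ^ 2 * (-3600) := by
      rw [hp']; norm_num
    rw [e1, e2, e3]
    simp only [map_mul, map_neg, map_ofNat, map_pow, map_zero, Nat.cast_one,
      map_one, Nat.cast_ofNat]
    ring
  · -- the conifold points
    have e4 : (derivative (weylD10.coeff 4)).eval p = p ^ 4 * (-13760 + 2 * 93696 * p +
        3 * -180224 * p ^ 2 + 4 * 65536 * p ^ 3) := by
      rw [h4, eval_derivative_X_pow_mul_quartic]
      linear_combination (((4 : ℕ) : ℂ) * p ^ (4 - 1) * (16 * p - 5) ^ 2) * hB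
    -- Since the third coefficient is twice the derivative of the fourth here, the indicial
    -- polynomial is proportional to s(s-1)(s-2)((s-3) + 2), with roots 0, 1, 1, 2.
    have e3 : (weylD10.coeff 3).eval p = 2 * (p ^ 4 * (-13760 + 2 * 93696 * p +
        3 * -180224 * p ^ 2 + 4 * 65536 * p ^ 3)) := by
      rw [h3, eval_mul, eval_quartic, eval_pow, eval_X]
      linear_combination (p ^ 3 * (150 - 480 * p)) * hB
    have hne : p ^ 4 * (-13760 + 2 * 93696 * p + 3 * -180224 * p ^ 2 + 4 * 65536 * p ^ 3) ≠ 0 := by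
      intro h
      have h' := (mul_eq_zero.mp h).resolve_left (pow_ne_zero _ hp)
      -- These points are simple roots of the leading coefficient: elimination leaves p = 1/528 as
      -- the only possible multiple root, and it is not a root of the quadratic factor.
      have hp528 : p = 1 / 528 := by
        linear_combination (2 * p * h' - (2048 * p ^ 2 + 128 * p + 1728) * hB) / 912384
      rw [hp528] at hB
      norm_num at hB
    refine exists_isExtremal_of_eq hne (e₁ := 1) (e₂ := 2) (e₃ := 1) (by norm_num)
      (by norm_num) (by norm_num) ?_ hv4
    rw [hk3, e3, e4]
    simp only [map_mul, map_ofNat, Nat.cast_one, Nat.cast_ofNat, map_one]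
    ring

end WeylOp

end PfaffianMirror

end

/-! ### From germs at 0 to power series; minimality of `D10` -/

noncomputable section

namespace PfaffianMirror

open Polynomial Filter Topology

theorem polynomial_smul_eq (c : ℂ[X]) (F : PowerSeries ℂ) : c • F = (c : PowerSeries ℂ) * F := by
  rw [Algebra.smul_def, PowerSeries.algebraMap_apply', Algebra.algebraMap_self,
    PowerSeries.map_id, id_eq]

theorem WeylOp.act_zero {A : Type*} [AddCommGroup A] [Module ℂ[X] A] (δ : A →+ A) (Q : WeylOp) :
    WeylOp.act δ (0 : A) Q = 0 := by
  induction Q using Polynomial.induction_on' with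
  | add p q hp hq => rw [map_add, hp, hq, add_zero]
  | monomial n c => rw [WeylOp.act_monomial, iterate_map_zero, smul_zero]

/-- The function `f` has the Taylor series `F` at `0`. -/
def HasSeries (f : ℂ → ℂ) (F : PowerSeries ℂ) : Prop :=
  HasFPowerSeriesAt f (FormalMultilinearSeries.ofScalars ℂ fun n => PowerSeries.coeff n F) 0

theorem hasSeries_iff {f : ℂ → ℂ} {F : PowerSeries ℂ} : HasSeries f F ↔
    ∀ᶠ z in 𝓝 (0 : ℂ), HasSum (fun n => z ^ n * PowerSeries.coeff n F) (f z) := by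
  rw [HasSeries, hasFPowerSeriesAt_iff]
  simp [FormalMultilinearSeries.coeff_ofScalars]

namespace HasSeries

variable {f g : ℂ → ℂ} {F G : PowerSeries ℂ}

theorem add (hf : HasSeries f F) (hg : HasSeries g G) : HasSeries (fun z => f z + g z) (F + G) := by
  rw [hasSeries_iff] at *
  filter_upwards [hf, hg] with z h1 h2
  simpa only [map_add, mul_add] using h1.add h2

theorem zero : HasSeries (fun _ => 0) 0 := by
  rw [hasSeries_iff]
  simp

theorem const_mul (c : ℂ) (hf : HasSeries f F) :
    HasSeries (fun z => c * f z) (PowerSeries.C c * F) := by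
  rw [hasSeries_iff] at *
  filter_upwards [hf] with z h
  simpa only [PowerSeries.coeff_C_mul, mul_left_comm] using h.mul_left c

theorem id_mul (hf : HasSeries f F) : HasSeries (fun z => z * f z) (PowerSeries.X * F) := by
  rw [hasSeries_iff] at *
  filter_upwards [hf] with z h
  rw [← hasSum_nat_add_iff' 1]
  simp only [PowerSeries.coeff_succ_X_mul, Finset.range_one, Finset.sum_singleton,
    PowerSeries.coeff_zero_X_mul, mul_zero, sub_zero, pow_succ', mul_assoc]
  exact h.mul_left z

theorem eval_mul (c : ℂ[X]) (hf : HasSeries f F) :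
    HasSeries (fun z => c.eval z * f z) (c • F) := by
  induction c using Polynomial.induction_on' with
  | add p q hp hq =>
    simp only [eval_add, add_mul, add_smul]
    exact hp.add hq
  | monomial n a =>
    have h : ∀ n : ℕ, HasSeries (fun z => z ^ n * f z) (PowerSeries.X ^ n * F) := fun n => by
      induction n with
      | zero => simpa using hf
      | succ n ih => simpa only [pow_succ', mul_assoc] using ih.id_mul
    have h2 := (h n).const_mul a
    rw [polynomial_smul_eq]
    convert h2 using 1
    · ext z; simp [mul_assoc]
    · simp [← C_mul_X_pow_eq_monomial, mul_assoc]

theorem unique (hf : HasSeries f F) (hg : HasSeries g G) (h : f =ᶠ[𝓝 0] g) : F = G := by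
  have h1 := HasFPowerSeriesAt.eq_formalMultilinearSeries_of_eventually hf hg h
  have h2 := FormalMultilinearSeries.ofScalars_series_injective ℂ ℂ h1
  ext n
  exact congrFun h2 n

theorem coeff_eq (hf : HasSeries f F) (n : ℕ) :
    PowerSeries.coeff n F = iteratedDeriv n f 0 / n.factorial := by
  have h1 := HasFPowerSeriesAt.eq_formalMultilinearSeries hf
    (HasFPowerSeriesAt.analyticAt hf).hasFPowerSeriesAt
  exact congrFun (FormalMultilinearSeries.ofScalars_series_injective ℂ ℂ h1) n

theorem deriv (hf : HasSeries f F) : HasSeries (deriv f) (PowerSeries.derivative ℂ F) := by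
  have h1 := (HasFPowerSeriesAt.analyticAt hf).deriv.hasFPowerSeriesAt
  have h2 : (fun n => PowerSeries.coeff n (PowerSeries.derivative ℂ F)) =
      fun n => iteratedDeriv n (_root_.deriv f) 0 / n.factorial := by
    funext n
    rw [PowerSeries.coeff_derivative, hf.coeff_eq, iteratedDeriv_succ', Nat.factorial_succ]
    have : (n.factorial : ℂ) ≠ 0 := by exact_mod_cast n.factorial_ne_zero
    have : (n : ℂ) + 1 ≠ 0 := by exact_mod_cast n.succ_ne_zero
    push_cast
    field_simp
  rw [HasSeries, h2]
  exact h1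

theorem theta (hf : HasSeries f F) :
    HasSeries (theta f) ((X : ℂ[X]) • PowerSeries.derivative ℂ F) := by
  have := hf.deriv.eval_mul X
  simp only [eval_X] at this
  exact this

theorem theta_iterate (hf : HasSeries f F) (j : ℕ) : HasSeries (PfaffianMirror.theta^[j] f)
    ((fun G => (X : ℂ[X]) • PowerSeries.derivative ℂ G)^[j] F) := by
  induction j with
  | zero => exact hf
  | succ j ih =>
    rw [Function.iterate_succ_apply', Function.iterate_succ_apply']
    exact ih.theta

theorem apply (hf : HasSeries f F) (L : DiffOp) : HasSeries (L.apply f)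
    (WeylOp.act (fun G => (X : ℂ[X]) • PowerSeries.derivative ℂ G) F L) := by
  induction L using Polynomial.induction_on' with
  | add p q hp hq =>
    rw [map_add]
    convert hp.add hq using 1
    ext z
    simp only [DiffOp.apply]
    exact sum_add_index p q _ (by simp) (by simp [add_mul])
  | monomial n c =>
    rw [WeylOp.act_monomial]
    convert (hf.theta_iterate n).eval_mul c using 1
    ext z
    simp only [DiffOp.apply]
    exact sum_monomial_index c _ (by simp)

/-- A germ is determined by its Taylor series, so annihilation becomes an algebraic statement in
ℂ[[φ]]. -/
theorem annihilates_iff (hf : HasSeries f F) (L : DiffOp) : L.Annihilates f ↔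
    WeylOp.act (fun G => (X : ℂ[X]) • PowerSeries.derivative ℂ G) F L = 0 := by
  constructor
  · intro h
    exact (hf.apply L).unique HasSeries.zero h
  · intro h
    have h1 := hf.apply L
    rw [h, hasSeries_iff] at h1
    filter_upwards [h1] with z hz
    exact hz.unique (by simp)

end HasSeries

/-- The generating series of the period coefficients. -/
def periodSeries : PowerSeries ℂ := PowerSeries.mk fun n => (periodCoeff n : ℂ)

theorem coeff_theta_iterate (F : PowerSeries ℂ) (j n : ℕ) :
    PowerSeries.coeff n ((fun G => (X : ℂ[X]) • PowerSeries.derivative ℂ G)^[j] F) =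
      (n : ℂ) ^ j * PowerSeries.coeff n F := by
  induction j with
  | zero => simp
  | succ j ih =>
    rw [Function.iterate_succ_apply', polynomial_smul_eq, Polynomial.coe_X]
    cases n with
    | zero => simp
    | succ n =>
      rw [PowerSeries.coeff_succ_X_mul, PowerSeries.coeff_derivative, ih, pow_succ]
      push_cast
      ring

theorem quartic_smul (a b c d e : ℂ) (F : PowerSeries ℂ) : quartic a b c d e • F =
    PowerSeries.C a * F + PowerSeries.C b * (PowerSeries.X ^ 1 * F) +
      PowerSeries.C c * (PowerSeries.X ^ 2 * F) + PowerSeries.C d * (PowerSeries.X ^ 3 * F) +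
      PowerSeries.C e * (PowerSeries.X ^ 4 * F) := by
  rw [polynomial_smul_eq]
  simp [quartic]
  ring

/-- The coefficient of degree n + 4 is `periodCoeff_recurrence n`; the four lower degrees, where
terms are missing, use the explicit values of the coefficients. -/
theorem D10_act_periodSeries :
    WeylOp.act (fun G => (X : ℂ[X]) • PowerSeries.derivative ℂ G) periodSeries D10 = 0 := by
  have c0 : periodCoeff 0 = 1 := by decide
  have c1 : periodCoeff 1 = 28 := by decide
  have c2 : periodCoeff 2 = 4716 := by decide
  have c3 : periodCoeff 3 = 1226800 := by decide
  rw [D10_eq]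
  simp only [map_add, WeylOp.act_monomial, quartic_smul]
  ext n
  simp only [map_add, PowerSeries.coeff_C_mul, PowerSeries.coeff_X_pow_mul',
    coeff_theta_iterate, periodSeries, PowerSeries.coeff_mk, map_zero]
  rcases n with _ | _ | _ | _ | n
  · simp
  · simp [c0, c1]
    norm_num
  · simp [c0, c1, c2]
    norm_num
  · simp [c0, c1, c2, c3]
    norm_num
  · have h := congrArg (fun q : ℚ => (q : ℂ)) (periodCoeff_recurrence n)
    push_cast at h
    rw [if_pos (by omega), if_pos (by omega), if_pos (by omega), if_pos (by omega),
      show n + 1 + 1 + 1 + 1 - 1 = n + 3 by omega, show n + 1 + 1 + 1 + 1 - 2 = n + 2 by omega,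
      show n + 1 + 1 + 1 + 1 - 3 = n + 1 by omega, show n + 1 + 1 + 1 + 1 - 4 = n by omega,
      show n + 1 + 1 + 1 + 1 = n + 4 by omega]
    push_cast
    simp only [zero_mul, map_zero]
    linear_combination h

/-- The fundamental period is not annihilated by an operator of order less than four. -/
theorem four_le_natDegree {L : DiffOp} (hL : L ≠ 0)
    (h : WeylOp.act (fun G => (X : ℂ[X]) • PowerSeries.derivative ℂ G) periodSeries L = 0) :
    4 ≤ L.natDegree := by
  classical
  by_contra! hlt
  set δ : PowerSeries ℂ →+ PowerSeries ℂ := (PowerSeries.derivative ℂ : _ →ₗ[ℂ] _).toAddMonoidHom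
  have hδ : ∀ (c : ℂ[X]) (a : PowerSeries ℂ), δ (c • a) = derivative c • a + c • δ a := by
    intro c a
    change PowerSeries.derivative ℂ (c • a) = _ • a + c • PowerSeries.derivative ℂ a
    simp only [polynomial_smul_eq]
    rw [Derivation.leibniz, PowerSeries.derivative_coe, smul_eq_mul, smul_eq_mul]
    ring
  have hex : ∃ r, ∃ M : WeylOp, M ≠ 0 ∧ WeylOp.act δ periodSeries M = 0 ∧ M.natDegree = r :=
    ⟨_, WeylOp.ofTheta L, WeylOp.ofTheta_ne_zero hL,
      (WeylOp.act_ofTheta δ hδ periodSeries L).trans h, rfl⟩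
  obtain ⟨M, hM, hMF, hMr⟩ := Nat.find_spec hex
  have hmin : ∀ M' : WeylOp, M' ≠ 0 → WeylOp.act δ periodSeries M' = 0 →
      M.natDegree ≤ M'.natDegree := fun M' h1 h2 =>
    hMr.trans_le (Nat.find_min' hex ⟨M', h1, h2, rfl⟩)
  have hM4 : M.natDegree < 4 :=
    ((hmin _ (WeylOp.ofTheta_ne_zero hL)
      ((WeylOp.act_ofTheta δ hδ periodSeries L).trans h)).trans
        (WeylOp.natDegree_ofTheta_le L)).trans_lt hlt
  -- An operator of order zero is multiplication by a nonzero polynomial, which is injective on the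
  -- domain ℂ[[φ]].
  have hpos : 0 < M.natDegree := by
    by_contra h0
    obtain ⟨c, hc⟩ := natDegree_eq_zero.mp (Nat.eq_zero_of_not_pos h0)
    rw [← hc, ← monomial_zero_left, WeylOp.act_monomial, Function.iterate_zero_apply,
      polynomial_smul_eq] at hMF
    rcases mul_eq_zero.mp hMF with h1 | h1
    · refine hM ?_
      rw [← hc, Polynomial.coe_eq_zero_iff.mp h1, map_zero]
    · have := congrArg (PowerSeries.coeff 0) h1
      rw [periodSeries, PowerSeries.coeff_mk, show periodCoeff 0 = 1 by decide] at this
      simp at this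
  -- 5 - ord M division steps cover an operator of order at most 4 and give ord Q ≤ 4 - ord M. The
  -- remainder annihilates the series and has order below the minimum, so it is zero.
  obtain ⟨g, hg, Q, R, hdiv, hR, hQ⟩ := WeylOp.exists_pseudo_division hM hpos
    (5 - M.natDegree) WeylOp.weylD10 (by have := WeylOp.natDegree_weylD10_le; omega)
  have hDF : WeylOp.act δ periodSeries WeylOp.weylD10 = 0 := by
    rw [← WeylOp.ofTheta_D10]
    exact (WeylOp.act_ofTheta δ hδ periodSeries D10).trans D10_act_periodSeries
  have hRF : WeylOp.act δ periodSeries R = 0 := by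
    have := congrArg (WeylOp.act δ periodSeries) hdiv
    rw [map_smul, hDF, smul_zero, map_add, WeylOp.act_opMul δ hδ, hMF] at this
    rw [WeylOp.act_zero, zero_add] at this
    exact this.symm
  have hR0 : R = 0 := by
    by_contra h0
    exact absurd (hmin R h0 hRF) (by omega)
  rw [hR0, add_zero] at hdiv
  have hD0 : WeylOp.weylD10 ≠ 0 := WeylOp.ofTheta_D10 ▸ WeylOp.ofTheta_ne_zero D10_ne_zero
  have hQ0 : Q ≠ 0 := by
    rintro rfl
    rw [map_zero] at hdiv
    exact (smul_ne_zero hg hD0) hdiv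
  exact WeylOp.no_right_factor WeylOp.weylD10_isExtremal_zero
    WeylOp.weylD10_isExtremal_infinity WeylOp.weylD10_isExtremal_shift hg hM hQ0 hdiv
    (by omega) hpos hM4

theorem isPicardFuchs_D10 {f : ℂ → ℂ} (hf : HasSeries f periodSeries) :
    IsPicardFuchs D10 f where
  ne_zero := D10_ne_zero
  annihilates := (hf.annihilates_iff D10).mpr D10_act_periodSeries
  minimal L hL h := natDegree_D10_le.trans
    (four_le_natDegree hL ((hf.annihilates_iff L).mp h))
  primitive := D10_isPrimitive

end PfaffianMirror

end

/-! ### The fixed point system and its solution -/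

noncomputable section

namespace PfaffianMirror

open Filter Topology Metric

/-- The right-hand side of the fixed point system
`b = p₁ + q₁ c (1 + a)`, `a = p₂ b³ + q₂ c`, `c = p₃ b² (1 + a) + q₃`
for `v = (b, a, c)`, with the parameters `p = (p₁, q₁, p₂, q₂, p₃, q₃)`. -/
def sysMap (p : Fin 6 → ℂ) (v : Fin 3 → ℂ) : Fin 3 → ℂ :=
  ![p 0 + p 1 * v 2 * (1 + v 1), p 2 * v 0 ^ 3 + p 3 * v 2, p 4 * v 0 ^ 2 * (1 + v 1) + p 5]

theorem norm_pi_three_le {v : Fin 3 → ℂ} {r : ℝ} (hr : 0 ≤ r) (h0 : ‖v 0‖ ≤ r) (h1 : ‖v 1‖ ≤ r)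
    (h2 : ‖v 2‖ ≤ r) : ‖v‖ ≤ r := by
  rw [pi_norm_le_iff_of_nonneg hr, Fin.forall_fin_succ, Fin.forall_fin_two]
  exact ⟨h0, h1, h2⟩

theorem norm_one_add_le {a : ℂ} (ha : ‖a‖ ≤ 1) : ‖1 + a‖ ≤ 2 :=
  (norm_add_le _ _).trans (by rw [norm_one]; linarith)

/-- The gap between 1/4 and 1 matters: it keeps vᵢ - `sysMap p v i` nonzero where |vᵢ| = 1, and it
traps continuous families of solutions near 0. -/
theorem norm_sysMap_le {p : Fin 6 → ℂ} {v : Fin 3 → ℂ} (hp : ‖p‖ ≤ 1 / 16) (hv : ‖v‖ ≤ 1) :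
    ‖sysMap p v‖ ≤ 1 / 4 := by
  have hp' (i) := (norm_le_pi_norm p i).trans hp
  have hv' (i) := (norm_le_pi_norm v i).trans hv
  have h1 := norm_one_add_le (hv' 1)
  refine norm_pi_three_le (by norm_num) ?_ ?_ ?_
  · calc ‖p 0 + p 1 * v 2 * (1 + v 1)‖ ≤ ‖p 0‖ + ‖p 1‖ * ‖v 2‖ * ‖1 + v 1‖ :=
          (norm_add_le _ _).trans_eq (by simp only [norm_mul])
      _ ≤ 1 / 16 + 1 / 16 * 1 * 2 := by gcongr <;> apply_assumption
      _ ≤ 1 / 4 := by norm_num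
  · calc ‖p 2 * v 0 ^ 3 + p 3 * v 2‖ ≤ ‖p 2‖ * ‖v 0‖ ^ 3 + ‖p 3‖ * ‖v 2‖ :=
          (norm_add_le _ _).trans_eq (by simp only [norm_mul, norm_pow])
      _ ≤ 1 / 16 * 1 ^ 3 + 1 / 16 * 1 := by gcongr <;> apply_assumption
      _ ≤ 1 / 4 := by norm_num
  · calc ‖p 4 * v 0 ^ 2 * (1 + v 1) + p 5‖ ≤ ‖p 4‖ * ‖v 0‖ ^ 2 * ‖1 + v 1‖ + ‖p 5‖ :=
          (norm_add_le _ _).trans_eq (by simp only [norm_mul, norm_pow])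
      _ ≤ 1 / 16 * 1 ^ 2 * 2 + 1 / 16 := by gcongr <;> apply_assumption
      _ ≤ 1 / 4 := by norm_num

theorem norm_sysMap_sub_le {p : Fin 6 → ℂ} {v w : Fin 3 → ℂ} (hp : ‖p‖ ≤ 1 / 16) (hv : ‖v‖ ≤ 1)
    (hw : ‖w‖ ≤ 1) : ‖sysMap p v - sysMap p w‖ ≤ 1 / 2 * ‖v - w‖ := by
  have hp' (i) := (norm_le_pi_norm p i).trans hp
  have hv' (i) := (norm_le_pi_norm v i).trans hv
  have hw' (i) := (norm_le_pi_norm w i).trans hw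
  have hd (i) : ‖v i - w i‖ ≤ ‖v - w‖ := norm_le_pi_norm (v - w) i
  have h1 := norm_one_add_le (hv' 1)
  have hs : ‖v 0 + w 0‖ ≤ 2 := (norm_add_le _ _).trans (by linarith [hv' 0, hw' 0])
  have hq : ‖v 0 ^ 2 + v 0 * w 0 + w 0 ^ 2‖ ≤ 3 := by
    calc _ ≤ ‖v 0 ^ 2‖ + ‖v 0 * w 0‖ + ‖w 0 ^ 2‖ := norm_add₃_le
      _ = ‖v 0‖ ^ 2 + ‖v 0‖ * ‖w 0‖ + ‖w 0‖ ^ 2 := by simp only [norm_mul, norm_pow]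
      _ ≤ 1 ^ 2 + 1 * 1 + 1 ^ 2 := by gcongr <;> apply_assumption
      _ = 3 := by norm_num
  have h0 : 0 ≤ ‖v - w‖ := norm_nonneg _
  refine norm_pi_three_le (by positivity) ?_ ?_ ?_
  · calc ‖(p 0 + p 1 * v 2 * (1 + v 1)) - (p 0 + p 1 * w 2 * (1 + w 1))‖
        = ‖p 1 * (v 2 - w 2) * (1 + v 1) + p 1 * w 2 * (v 1 - w 1)‖ := by congr 1; ring
      _ ≤ ‖p 1‖ * ‖v 2 - w 2‖ * ‖1 + v 1‖ + ‖p 1‖ * ‖w 2‖ * ‖v 1 - w 1‖ :=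
          (norm_add_le _ _).trans_eq (by simp only [norm_mul])
      _ ≤ 1 / 16 * ‖v - w‖ * 2 + 1 / 16 * 1 * ‖v - w‖ := by gcongr <;> apply_assumption
      _ ≤ 1 / 2 * ‖v - w‖ := by linarith
  · calc ‖(p 2 * v 0 ^ 3 + p 3 * v 2) - (p 2 * w 0 ^ 3 + p 3 * w 2)‖
        = ‖p 2 * (v 0 - w 0) * (v 0 ^ 2 + v 0 * w 0 + w 0 ^ 2) + p 3 * (v 2 - w 2)‖ := by
          congr 1; ring
      _ ≤ ‖p 2‖ * ‖v 0 - w 0‖ * ‖v 0 ^ 2 + v 0 * w 0 + w 0 ^ 2‖ + ‖p 3‖ * ‖v 2 - w 2‖ :=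
          (norm_add_le _ _).trans_eq (by simp only [norm_mul])
      _ ≤ 1 / 16 * ‖v - w‖ * 3 + 1 / 16 * ‖v - w‖ := by gcongr <;> apply_assumption
      _ ≤ 1 / 2 * ‖v - w‖ := by linarith
  · calc ‖(p 4 * v 0 ^ 2 * (1 + v 1) + p 5) - (p 4 * w 0 ^ 2 * (1 + w 1) + p 5)‖
        = ‖p 4 * (v 0 - w 0) * (v 0 + w 0) * (1 + v 1) + p 4 * w 0 ^ 2 * (v 1 - w 1)‖ := by
          congr 1; ring
      _ ≤ ‖p 4‖ * ‖v 0 - w 0‖ * ‖v 0 + w 0‖ * ‖1 + v 1‖ + ‖p 4‖ * ‖w 0‖ ^ 2 * ‖v 1 - w 1‖ :=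
          (norm_add_le _ _).trans_eq (by simp only [norm_mul, norm_pow])
      _ ≤ 1 / 16 * ‖v - w‖ * 2 * 2 + 1 / 16 * 1 ^ 2 * ‖v - w‖ := by gcongr <;> apply_assumption
      _ ≤ 1 / 2 * ‖v - w‖ := by linarith

theorem exists_eq_sysMap {p : Fin 6 → ℂ} (hp : ‖p‖ ≤ 1 / 16) :
    ∃ v : Fin 3 → ℂ, ‖v‖ ≤ 1 ∧ v = sysMap p v := by
  have hm : Set.MapsTo (sysMap p) (closedBall 0 1) (closedBall 0 1) := fun v hv => by
    rw [mem_closedBall_zero_iff] at hv ⊢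
    exact (norm_sysMap_le hp hv).trans (by norm_num)
  have hc : ContractingWith (1 / 2) (hm.restrict (sysMap p) (closedBall 0 1) (closedBall 0 1)) := by
    refine ⟨by rw [← NNReal.coe_lt_coe]; norm_num, LipschitzWith.of_dist_le_mul ?_⟩
    rintro ⟨v, hv⟩ ⟨w, hw⟩
    rw [mem_closedBall_zero_iff] at hv hw
    simpa [Subtype.dist_eq, dist_eq_norm] using norm_sysMap_sub_le hp hv hw
  obtain ⟨v, hv, hf, -⟩ := hc.exists_fixedPoint' isClosed_closedBall.isComplete hm
    (mem_closedBall_self zero_le_one) (edist_ne_top _ _)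
  exact ⟨v, mem_closedBall_zero_iff.1 hv, hf.symm⟩

theorem eq_of_eq_sysMap {p : Fin 6 → ℂ} {v w : Fin 3 → ℂ} (hp : ‖p‖ ≤ 1 / 16) (hv : ‖v‖ ≤ 1)
    (hw : ‖w‖ ≤ 1) (hfv : v = sysMap p v) (hfw : w = sysMap p w) : v = w := by
  have h := norm_sysMap_sub_le hp hv hw
  rw [← hfv, ← hfw] at h
  rw [← sub_eq_zero, ← norm_eq_zero]
  linarith [norm_nonneg (v - w)]

open Classical in
/-- The solution of the fixed point system in the closed unit ball. -/
def sol (p : Fin 6 → ℂ) : Fin 3 → ℂ :=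
  if h : ‖p‖ ≤ 1 / 16 then (exists_eq_sysMap h).choose else 0

theorem norm_sol_le_one {p : Fin 6 → ℂ} (hp : ‖p‖ ≤ 1 / 16) : ‖sol p‖ ≤ 1 := by
  rw [sol, dif_pos hp]
  exact (exists_eq_sysMap hp).choose_spec.1

theorem sol_eq {p : Fin 6 → ℂ} (hp : ‖p‖ ≤ 1 / 16) : sol p = sysMap p (sol p) := by
  rw [sol, dif_pos hp]
  exact (exists_eq_sysMap hp).choose_spec.2

theorem norm_sol_le {p : Fin 6 → ℂ} (hp : ‖p‖ ≤ 1 / 16) : ‖sol p‖ ≤ 1 / 4 := by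
  rw [sol_eq hp]
  exact norm_sysMap_le hp (norm_sol_le_one hp)

theorem eq_sol {p : Fin 6 → ℂ} {v : Fin 3 → ℂ} (hp : ‖p‖ ≤ 1 / 16) (hv : ‖v‖ ≤ 1)
    (h : v = sysMap p v) : v = sol p :=
  eq_of_eq_sysMap hp hv (norm_sol_le_one hp) h (sol_eq hp)

theorem contDiff_sysMap {n : WithTop ℕ∞} :
    ContDiff ℂ n fun u : (Fin 6 → ℂ) × (Fin 3 → ℂ) => sysMap u.1 u.2 := by
  rw [contDiff_pi, Fin.forall_fin_succ, Fin.forall_fin_two]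
  have h (i) : ContDiff ℂ n fun u : (Fin 6 → ℂ) × (Fin 3 → ℂ) => u.1 i :=
    (contDiff_apply ℂ ℂ i).comp contDiff_fst
  have h' (i) : ContDiff ℂ n fun u : (Fin 6 → ℂ) × (Fin 3 → ℂ) => u.2 i :=
    (contDiff_apply ℂ ℂ i).comp contDiff_snd
  refine ⟨?_, ?_, ?_⟩
  · exact (h 0).add (((h 1).mul (h' 2)).mul (contDiff_const.add (h' 1)))
  · exact ((h 2).mul ((h' 0).pow 3)).add ((h 3).mul (h' 2))
  · exact (((h 4).mul ((h' 0).pow 2)).mul (contDiff_const.add (h' 1))).add (h 5)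

theorem isInvertible_id_sub {E : Type*} [NormedAddCommGroup E] [NormedSpace ℂ E] [CompleteSpace E]
    {A : E →L[ℂ] E} (hA : ‖A‖ < 1) : (ContinuousLinearMap.id ℂ E - A).IsInvertible := by
  obtain ⟨u, hu⟩ := isUnit_one_sub_of_norm_lt_one hA
  refine ⟨ContinuousLinearEquiv.unitsEquiv ℂ E u, ?_⟩
  ext x
  exact congrArg (fun B : E →L[ℂ] E => B x) hu

/-- The implicit function theorem gives a C¹ branch, since the derivative of `sysMap p` has norm at
most 1/2 and 1 minus it is invertible. Uniqueness in the unit ball identifies this branch with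
`sol`. -/
theorem contDiffAt_sol {p : Fin 6 → ℂ} (hp : ‖p‖ < 1 / 16) : ContDiffAt ℂ 1 sol p := by
  let f : (Fin 6 → ℂ) × (Fin 3 → ℂ) → Fin 3 → ℂ := fun u => u.2 - sysMap u.1 u.2
  have hf : ContDiffAt ℂ 1 f (p, sol p) := (contDiff_snd.sub contDiff_sysMap).contDiffAt
  have hnear : ∀ᶠ v in 𝓝 (sol p), ‖v‖ ≤ 1 := by
    have : ‖sol p‖ < 1 := (norm_sol_le hp.le).trans_lt (by norm_num)
    exact (continuous_norm.continuousAt.eventually_lt continuousAt_const this).mono fun _ => le_of_lt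
  have hinv : (fderiv ℂ f (p, sol p) ∘L .inr ℂ (Fin 6 → ℂ) (Fin 3 → ℂ)).IsInvertible := by
    have hd := hf.differentiableAt one_ne_zero
    have hS : DifferentiableAt ℂ (sysMap p) (sol p) :=
      ((contDiff_sysMap (n := 1)).differentiable one_ne_zero (p, sol p)).comp (sol p)
        ((differentiableAt_const p).prodMk differentiableAt_id)
    have h1 : fderiv ℂ f (p, sol p) ∘L .inr ℂ (Fin 6 → ℂ) (Fin 3 → ℂ) =
        ContinuousLinearMap.id ℂ _ - fderiv ℂ (sysMap p) (sol p) := by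
      have e1 : HasFDerivAt (fun v : Fin 3 → ℂ => f (p, v))
          (fderiv ℂ f (p, sol p) ∘L .inr ℂ (Fin 6 → ℂ) (Fin 3 → ℂ)) (sol p) :=
        hd.hasFDerivAt.comp (sol p) (hasFDerivAt_prodMk_right p (sol p))
      exact e1.unique ((hasFDerivAt_id (sol p)).sub hS.hasFDerivAt)
    rw [h1]
    refine isInvertible_id_sub ((norm_fderiv_le_of_lip' ℂ (C := 1 / 2) (by norm_num) ?_).trans_lt
      (by norm_num))
    filter_upwards [hnear] with v hv using norm_sysMap_sub_le hp.le hv (norm_sol_le_one hp.le)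
  have hψ := hf.contDiffAt_implicitFunction one_ne_zero hinv
  refine hψ.congr_of_eventuallyEq ?_
  have hc : Tendsto (hf.implicitFunction one_ne_zero hinv) (𝓝 p) (𝓝 (sol p)) := by
    have := hψ.continuousAt.tendsto
    rwa [hf.implicitFunction_apply_self one_ne_zero hinv] at this
  filter_upwards [hf.eventually_apply_implicitFunction one_ne_zero hinv, hc.eventually hnear,
    continuous_norm.continuousAt.eventually_lt continuousAt_const hp] with q hq hq1 hq2
  refine (eq_sol hq2.le hq1 ?_).symm
  have h0 : f (p, sol p) = 0 := sub_eq_zero.2 (sol_eq hp.le)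
  rw [h0] at hq
  exact sub_eq_zero.1 hq

theorem continuousOn_sol : ContinuousOn sol (ball 0 (1 / 16)) := fun _ hp =>
  (contDiffAt_sol (mem_ball_zero_iff.1 hp)).continuousAt.continuousWithinAt

/-- The jacobian determinant of `v ↦ v - sysMap p v`, with the columns in the order `1, 0, 2`
of the variables. -/
def sysJac (p : Fin 6 → ℂ) (v : Fin 3 → ℂ) : ℂ :=
  Matrix.det !![-(p 1 * v 2), 1, -(p 1 * (1 + v 1));
    -(p 4 * v 0 ^ 2), -(2 * p 4 * v 0 * (1 + v 1)), 1;
    1, -(3 * p 2 * v 0 ^ 2), -p 3]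

/-- The rows, in the order of P₁, P₃, P₄, are transposed as well as the columns, so the signs cancel
and the value at p = 0 is 1. -/
theorem sysJac_eq (p : Fin 6 → ℂ) (v : Fin 3 → ℂ) :
    sysJac p v = 1 - (2 * p 1 * p 4 * v 0 * (1 + v 1) ^ 2 + p 3 * p 4 * v 0 ^ 2
      + 3 * p 1 * p 2 * v 2 * v 0 ^ 2 + 3 * p 1 * p 2 * p 4 * v 0 ^ 4 * (1 + v 1)
      + 2 * p 1 * p 3 * p 4 * v 2 * v 0 * (1 + v 1)) := by
  rw [sysJac, Matrix.det_fin_three]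
  simp only [Matrix.of_apply, Matrix.cons_val', Matrix.cons_val_zero, Matrix.cons_val_one,
    Matrix.cons_val]
  ring

theorem sysJac_ne_zero {p : Fin 6 → ℂ} {v : Fin 3 → ℂ} (hp : ‖p‖ ≤ 1 / 16) (hv : ‖v‖ ≤ 1) :
    sysJac p v ≠ 0 := by
  have hp' (i) := (norm_le_pi_norm p i).trans hp
  have hv' (i) := (norm_le_pi_norm v i).trans hv
  have h1 := norm_one_add_le (hv' 1)
  intro h
  rw [sysJac_eq, sub_eq_zero] at h
  have h2 := congrArg norm h
  refine absurd h2 (ne_of_gt ?_)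
  have e1 : ‖2 * p 1 * p 4 * v 0 * (1 + v 1) ^ 2‖ ≤ 2 * (1 / 16) * (1 / 16) * 1 * 2 ^ 2 := by
    simp only [norm_mul, norm_pow, Complex.norm_ofNat]
    gcongr <;> apply_assumption
  have e2 : ‖p 3 * p 4 * v 0 ^ 2‖ ≤ 1 / 16 * (1 / 16) * 1 ^ 2 := by
    simp only [norm_mul, norm_pow]
    gcongr <;> apply_assumption
  have e3 : ‖3 * p 1 * p 2 * v 2 * v 0 ^ 2‖ ≤ 3 * (1 / 16) * (1 / 16) * 1 * 1 ^ 2 := by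
    simp only [norm_mul, norm_pow, Complex.norm_ofNat]
    gcongr <;> apply_assumption
  have e4 : ‖3 * p 1 * p 2 * p 4 * v 0 ^ 4 * (1 + v 1)‖ ≤
      3 * (1 / 16) * (1 / 16) * (1 / 16) * 1 ^ 4 * 2 := by
    simp only [norm_mul, norm_pow, Complex.norm_ofNat]
    gcongr <;> apply_assumption
  have e5 : ‖2 * p 1 * p 3 * p 4 * v 2 * v 0 * (1 + v 1)‖ ≤
      2 * (1 / 16) * (1 / 16) * (1 / 16) * 1 * 1 * 2 := by
    simp only [norm_mul, Complex.norm_ofNat]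
    gcongr <;> apply_assumption
  rw [norm_one]
  refine (norm_add_le_of_le (norm_add_le_of_le (norm_add_le_of_le (norm_add_le_of_le e1 e2) e3)
    e4) e5).trans_lt ?_
  norm_num

end PfaffianMirror

end

/-! ### The reciprocal jacobian as an iterated residue -/

noncomputable section

namespace PfaffianMirror

open Filter Topology Metric Complex

theorem circleIntegral_eq_of_simple_pole {F f : ℂ → ℂ} {w : ℂ}
    (hf : DifferentiableOn ℂ f (closedBall 0 1)) (hw : ‖w‖ < 1)
    (hF : ∀ z : ℂ, ‖z‖ = 1 → F z = (z - w)⁻¹ * f z) :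
    (∮ z in C(0, 1), F z) = 2 * Real.pi * I * f w := by
  rw [circleIntegral.integral_congr (g := fun z => (z - w)⁻¹ • f z) zero_le_one
    fun z hz => hF z (by simpa using hz),
    hf.circleIntegral_sub_inv_smul (mem_ball_zero_iff.2 hw), smul_eq_mul]

/-- H is (z - w) times its divided slope, which has no zeros on the disc, so Cauchy's formula
applies. -/
theorem circleIntegral_div_of_unique_zero {H q : ℂ → ℂ} (hH : Differentiable ℂ H)
    (hq : Differentiable ℂ q) {w : ℂ} (hw : ‖w‖ < 1) (h0 : H w = 0) (hd : deriv H w ≠ 0)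
    (hu : ∀ z, ‖z‖ ≤ 1 → H z = 0 → z = w) :
    (∮ z in C(0, 1), q z / H z) = 2 * Real.pi * I * (q w / deriv H w) := by
  have hs : Differentiable ℂ (dslope H w) :=
    differentiableOn_univ.1 ((differentiableOn_dslope univ_mem).2 hH.differentiableOn)
  have hne : ∀ z ∈ closedBall (0 : ℂ) 1, dslope H w z ≠ 0 := by
    intro z hz
    by_cases hzw : z = w
    · rwa [hzw, dslope_same]
    · rw [dslope_of_ne H hzw, slope_def_field, h0, sub_zero]
      exact div_ne_zero (fun h => hzw (hu z (mem_closedBall_zero_iff.1 hz) h)) (sub_ne_zero.2 hzw)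
  have := circleIntegral_eq_of_simple_pole (F := fun z => q z / H z)
    (f := fun z => q z / dslope H w z) (hq.differentiableOn.div hs.differentiableOn hne) hw ?_
  · rw [this, dslope_same]
  · intro z hz
    have hzw : z ≠ w := by
      rintro rfl
      exact hw.ne hz
    have : H z = (z - w) * dslope H w z := by
      have := sub_smul_dslope H w z
      rw [h0, sub_zero, smul_eq_mul] at this
      exact this.symm
    rw [this]
    simp only [div_eq_mul_inv, mul_inv]
    ring

/-- The sum `1 + a` and the variable `c`, as functions of `b`, on the curve cut out by the last two
equations of the system `v = sysMap p v`, are quotients of polynomials in `b` by `elimDen p b`. -/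
def elimDen (p : Fin 6 → ℂ) (b : ℂ) : ℂ := 1 - p 3 * p 4 * b ^ 2

/-- The numerator of `1 + a`. -/
def elimNumA (p : Fin 6 → ℂ) (b : ℂ) : ℂ := 1 + p 2 * b ^ 3 + p 3 * p 5

/-- The numerator of `c`. -/
def elimNumC (p : Fin 6 → ℂ) (b : ℂ) : ℂ := p 4 * b ^ 2 * elimNumA p b + p 5 * elimDen p b

/-- The polynomial in `b` that is left when `a` and `c` are eliminated. -/
def elimPoly (p : Fin 6 → ℂ) (b : ℂ) : ℂ :=
  elimDen p b ^ 2 * (b - p 0) - p 1 * elimNumC p b * elimNumA p b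

section

variable {p : Fin 6 → ℂ} (hp : ‖p‖ ≤ 1 / 16)
include hp

theorem elimDen_ne_zero {b : ℂ} (hb : ‖b‖ ≤ 1) : elimDen p b ≠ 0 := by
  have hp' (i) := (norm_le_pi_norm p i).trans hp
  intro h
  have h1 : ‖p 3 * p 4 * b ^ 2‖ ≤ 1 / 16 * (1 / 16) * 1 ^ 2 := by
    simp only [norm_mul, norm_pow]
    gcongr <;> apply_assumption
  rw [← sub_eq_zero.1 h, norm_one] at h1
  norm_num at h1

theorem norm_elimNumA_div_sub_one_lt {b : ℂ} (hb : ‖b‖ ≤ 1) :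
    ‖elimNumA p b / elimDen p b - 1‖ < 1 := by
  have hp' (i) := (norm_le_pi_norm p i).trans hp
  have h1 : ‖p 3 * p 4 * b ^ 2‖ ≤ 1 / 16 * (1 / 16) * 1 ^ 2 := by
    simp only [norm_mul, norm_pow]
    gcongr <;> apply_assumption
  have h2 : ‖p 2 * b ^ 3‖ ≤ 1 / 16 * 1 ^ 3 := by
    simp only [norm_mul, norm_pow]
    gcongr
    all_goals apply_assumption
  have h3 : ‖p 3 * p 5‖ ≤ 1 / 16 * (1 / 16) := by
    simp only [norm_mul]
    gcongr <;> apply_assumption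
  have h4 : 1 - 1 / 256 ≤ ‖elimDen p b‖ := by
    have := norm_sub_norm_le (1 : ℂ) (p 3 * p 4 * b ^ 2)
    rw [norm_one] at this
    exact le_trans (by linarith) this
  have hD := elimDen_ne_zero hp hb
  have h5 : elimNumA p b / elimDen p b - 1 =
      (p 2 * b ^ 3 + p 3 * p 5 + p 3 * p 4 * b ^ 2) / elimDen p b := by
    rw [eq_div_iff hD, sub_mul, div_mul_cancel₀ _ hD, elimNumA, elimDen]
    ring
  rw [h5, norm_div, div_lt_one (norm_pos_iff.2 hD)]
  refine (norm_add₃_le.trans (add_le_add (add_le_add h2 h3) h1)).trans_lt (lt_of_lt_of_le ?_ h4)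
  norm_num

/-- A root b in the disc extends to a solution (b, a, c) of the whole system with |a|, |c| ≤ 1, and
that solution is unique. -/
theorem eq_sol_of_elimPoly_eq_zero {b : ℂ} (hb : ‖b‖ ≤ 1) (h : elimPoly p b = 0) :
    b = sol p 0 := by
  have hp' (i) := (norm_le_pi_norm p i).trans hp
  have hD := elimDen_ne_zero hp hb
  have ha := (norm_elimNumA_div_sub_one_lt hp hb).le
  set a := elimNumA p b / elimDen p b - 1 with ha_def
  have hA : elimNumA p b = elimDen p b * (1 + a) := by
    rw [ha_def, add_sub_cancel, mul_div_cancel₀ _ hD]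
  let c := p 4 * b ^ 2 * (1 + a) + p 5
  have hC : elimNumC p b = elimDen p b * c := by
    rw [elimNumC, hA]
    ring
  have hc : ‖c‖ ≤ 1 := by
    have h1 := norm_one_add_le ha
    calc ‖c‖ ≤ ‖p 4‖ * ‖b‖ ^ 2 * ‖1 + a‖ + ‖p 5‖ :=
          (norm_add_le _ _).trans_eq (by simp only [norm_mul, norm_pow])
      _ ≤ 1 / 16 * 1 ^ 2 * 2 + 1 / 16 := by gcongr <;> apply_assumption
      _ ≤ 1 := by norm_num
  have hv : ![b, a, c] = sysMap p ![b, a, c] := by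
    funext i
    fin_cases i
    · change b = p 0 + p 1 * c * (1 + a)
      rw [elimPoly, hA, hC] at h
      have : elimDen p b ^ 2 * (b - (p 0 + p 1 * c * (1 + a))) = 0 := by linear_combination h
      exact sub_eq_zero.1 ((mul_eq_zero.1 this).resolve_left (pow_ne_zero 2 hD))
    · change a = p 2 * b ^ 3 + p 3 * c
      rw [elimNumA, elimDen] at hA
      linear_combination -hA
    · rfl
  exact congrFun (eq_sol hp (norm_pi_three_le zero_le_one hb ha hc) hv) 0

theorem elim_sol : elimNumA p (sol p 0) = elimDen p (sol p 0) * (1 + sol p 1) ∧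
    elimNumC p (sol p 0) = elimDen p (sol p 0) * sol p 2 := by
  have h := sol_eq hp
  have h1 : sol p 1 = p 2 * sol p 0 ^ 3 + p 3 * sol p 2 := congrFun h 1
  have h2 : sol p 2 = p 4 * sol p 0 ^ 2 * (1 + sol p 1) + p 5 := congrFun h 2
  have hA : elimNumA p (sol p 0) = elimDen p (sol p 0) * (1 + sol p 1) := by
    rw [elimNumA, elimDen]
    linear_combination -h1 - p 3 * h2
  refine ⟨hA, ?_⟩
  rw [elimNumC, hA]
  linear_combination -elimDen p (sol p 0) * h2

theorem elimPoly_sol : elimPoly p (sol p 0) = 0 := by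
  have h0 : sol p 0 = p 0 + p 1 * sol p 2 * (1 + sol p 1) := congrFun (sol_eq hp) 0
  obtain ⟨hA, hC⟩ := elim_sol hp
  rw [elimPoly, hA, hC]
  linear_combination elimDen p (sol p 0) ^ 2 * h0

end

theorem hasDerivAt_elimDen (p : Fin 6 → ℂ) (b : ℂ) :
    HasDerivAt (elimDen p) (-(2 * p 3 * p 4 * b)) b := by
  refine (((hasDerivAt_id b).pow 2).const_mul (p 3 * p 4)).const_sub 1 |>.congr_deriv ?_
  simp
  ring

theorem hasDerivAt_elimNumA (p : Fin 6 → ℂ) (b : ℂ) :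
    HasDerivAt (elimNumA p) (3 * p 2 * b ^ 2) b := by
  refine ((((hasDerivAt_id b).pow 3).const_mul (p 2)).const_add 1).add_const (p 3 * p 5)
    |>.congr_deriv ?_
  simp
  ring

theorem hasDerivAt_elimNumC (p : Fin 6 → ℂ) (b : ℂ) :
    HasDerivAt (elimNumC p) (2 * p 4 * b * elimNumA p b + p 4 * b ^ 2 * (3 * p 2 * b ^ 2)
      - p 5 * (2 * p 3 * p 4 * b)) b := by
  refine ((((hasDerivAt_id b).pow 2).const_mul (p 4)).mul (hasDerivAt_elimNumA p b)).add
    ((hasDerivAt_elimDen p b).const_mul (p 5)) |>.congr_deriv ?_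
  simp
  ring

theorem hasDerivAt_elimPoly (p : Fin 6 → ℂ) (b : ℂ) :
    HasDerivAt (elimPoly p) (2 * elimDen p b * (-(2 * p 3 * p 4 * b)) * (b - p 0)
      + elimDen p b ^ 2 - p 1 * ((2 * p 4 * b * elimNumA p b + p 4 * b ^ 2 * (3 * p 2 * b ^ 2)
      - p 5 * (2 * p 3 * p 4 * b)) * elimNumA p b + elimNumC p b * (3 * p 2 * b ^ 2))) b := by
  refine ((((hasDerivAt_elimDen p b).pow 2).mul ((hasDerivAt_id b).sub_const (p 0))).sub
    (((hasDerivAt_elimNumC p b).const_mul (p 1)).mul (hasDerivAt_elimNumA p b))).congr_deriv ?_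
  simp
  ring

/-- The extra factor `elimDen` cancels the numerator left by `torusIntegral_sysInv_aux`, so that the
last residue is the reciprocal jacobian. -/
theorem deriv_elimPoly_sol {p : Fin 6 → ℂ} (hp : ‖p‖ ≤ 1 / 16) :
    deriv (elimPoly p) (sol p 0) = elimDen p (sol p 0) * sysJac p (sol p) := by
  have h := sol_eq hp
  have h0 : sol p 0 - p 0 = p 1 * sol p 2 * (1 + sol p 1) :=
    sub_eq_iff_eq_add'.2 (congrFun h 0)
  have h2 : sol p 2 = p 4 * sol p 0 ^ 2 * (1 + sol p 1) + p 5 := congrFun h 2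
  obtain ⟨hA, hC⟩ := elim_sol hp
  rw [(hasDerivAt_elimPoly p (sol p 0)).deriv, hA, hC, h0, sysJac_eq]
  generalize hD : elimDen p (sol p 0) = D
  rw [elimDen] at hD
  linear_combination
    (D * (-1 + 2 * p 1 * p 4 * sol p 0 * (1 + sol p 1) ^ 2)) * hD
      - 2 * p 1 * p 3 * p 4 * sol p 0 * (1 + sol p 1) * D * h2

/-- The integrand of the inner torus integral. -/
def sysInv (p : Fin 6 → ℂ) (v : Fin 3 → ℂ) : ℂ :=
  ((v 0 - sysMap p v 0) * (v 1 - sysMap p v 1) * (v 2 - sysMap p v 2))⁻¹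

theorem sub_sysMap_ne_zero {p : Fin 6 → ℂ} (hp : ‖p‖ ≤ 1 / 16) {v : Fin 3 → ℂ} (hv : ‖v‖ ≤ 1)
    {i : Fin 3} (hi : ‖v i‖ = 1) : v i - sysMap p v i ≠ 0 := by
  intro h
  have := (norm_le_pi_norm (sysMap p v) i).trans (norm_sysMap_le hp hv)
  rw [← sub_eq_zero.1 h, hi] at this
  norm_num at this

theorem continuousAt_sysInv {p : Fin 6 → ℂ} (hp : ‖p‖ ≤ 1 / 16) {v : Fin 3 → ℂ}
    (hv : ∀ i, ‖v i‖ = 1) : ContinuousAt (sysInv p) v := by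
  have hn : ‖v‖ ≤ 1 := (pi_norm_le_iff_of_nonneg zero_le_one).2 fun i => (hv i).le
  have hc : Continuous (sysMap p) :=
    (contDiff_sysMap (n := 0)).continuous.comp (Continuous.prodMk_right p)
  refine ContinuousAt.inv₀ (Continuous.continuousAt ?_) ?_
  · have this (i : Fin 3) : Continuous fun v : Fin 3 → ℂ => v i - sysMap p v i :=
      (continuous_apply i).sub ((continuous_apply i).comp hc)
    exact ((this 0).mul (this 1)).mul (this 2)
  · exact mul_ne_zero (mul_ne_zero (sub_sysMap_ne_zero hp hn (hv 0))
      (sub_sysMap_ne_zero hp hn (hv 1))) (sub_sysMap_ne_zero hp hn (hv 2))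

theorem norm_torusMap_zero_one {n : ℕ} (θ : Fin n → ℝ) (i : Fin n) :
    ‖torusMap 0 (fun _ => 1) θ i‖ = 1 := by
  simp [torusMap]

theorem torusIntegrable_of_continuousAt {n : ℕ} {f : (Fin n → ℂ) → ℂ}
    (hf : ∀ v : Fin n → ℂ, (∀ i, ‖v i‖ = 1) → ContinuousAt f v) :
    TorusIntegrable f 0 (fun _ => 1) := by
  refine Continuous.integrableOn_Icc (continuous_iff_continuousAt.2 fun θ => ?_)
  refine ContinuousAt.comp (f := torusMap (0 : Fin n → ℂ) fun _ => 1)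
    (hf _ (norm_torusMap_zero_one θ)) (Continuous.continuousAt ?_)
  unfold torusMap
  fun_prop

/-- Only the third factor vanishes in |c| ≤ 1, at c₀(a). Putting c = c₀(a) makes the second factor
affine in a with slope `elimDen p b`, so a second simple pole can be removed. -/
theorem torusIntegral_sysInv_aux {p : Fin 6 → ℂ} (hp : ‖p‖ ≤ 1 / 16) {b : ℂ} (hb : ‖b‖ = 1) :
    (∮ a in C(0, 1), ∮ c in C(0, 1), sysInv p ![b, a, c]) =
      (2 * Real.pi * I) ^ 2 * (elimDen p b / elimPoly p b) := by
  have hp' (i) := (norm_le_pi_norm p i).trans hp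
  have hD := elimDen_ne_zero hp hb.le
  let c₀ : ℂ → ℂ := fun a => p 4 * b ^ 2 * (1 + a) + p 5
  have hc₀ (a : ℂ) (ha : ‖a‖ ≤ 1) : ‖c₀ a‖ ≤ 3 / 16 := by
    have h1 := norm_one_add_le ha
    have hb' := hb.le
    calc ‖c₀ a‖ ≤ ‖p 4‖ * ‖b‖ ^ 2 * ‖1 + a‖ + ‖p 5‖ :=
          (norm_add_le _ _).trans_eq (by simp only [norm_mul, norm_pow])
      _ ≤ 1 / 16 * 1 ^ 2 * 2 + 1 / 16 := by gcongr <;> apply_assumption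
      _ ≤ 3 / 16 := by norm_num
  have hcube {a c : ℂ} (ha : ‖a‖ ≤ 1) (hc : ‖c‖ ≤ 1) : ‖![b, a, c]‖ ≤ 1 :=
    norm_pi_three_le zero_le_one hb.le ha hc
  have hn0 {a c : ℂ} (ha : ‖a‖ ≤ 1) (hc : ‖c‖ ≤ 1) : b - (p 0 + p 1 * c * (1 + a)) ≠ 0 :=
    sub_sysMap_ne_zero hp (hcube ha hc) (i := 0) hb
  have hn1 {a c : ℂ} (ha : ‖a‖ = 1) (hc : ‖c‖ ≤ 1) : a - (p 2 * b ^ 3 + p 3 * c) ≠ 0 :=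
    sub_sysMap_ne_zero hp (hcube ha.le hc) (i := 1) ha
  have step1 : ∀ a : ℂ, ‖a‖ = 1 → (∮ c in C(0, 1), sysInv p ![b, a, c]) = 2 * Real.pi * I *
      ((b - (p 0 + p 1 * c₀ a * (1 + a))) * (a - (p 2 * b ^ 3 + p 3 * c₀ a)))⁻¹ := by
    intro a ha
    refine circleIntegral_eq_of_simple_pole (w := c₀ a)
      (f := fun c => ((b - (p 0 + p 1 * c * (1 + a))) * (a - (p 2 * b ^ 3 + p 3 * c)))⁻¹) ?_
      ((hc₀ a ha.le).trans_lt (by norm_num)) ?_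
    · refine DifferentiableOn.inv (Differentiable.differentiableOn (by fun_prop)) fun c hc => ?_
      rw [mem_closedBall_zero_iff] at hc
      exact mul_ne_zero (hn0 ha.le hc) (hn1 ha hc)
    · intro c _
      change ((b - (p 0 + p 1 * c * (1 + a))) * (a - (p 2 * b ^ 3 + p 3 * c)) * (c - c₀ a))⁻¹ = _
      rw [mul_comm _ (c - c₀ a), mul_inv (c - c₀ a)]
  rw [circleIntegral.integral_congr zero_le_one fun a ha => step1 a (by simpa using ha)]
  set a₀ := elimNumA p b / elimDen p b - 1 with ha₀
  have ha₀' : ‖a₀‖ < 1 := norm_elimNumA_div_sub_one_lt hp hb.le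
  have hA : elimNumA p b = elimDen p b * (1 + a₀) := by
    rw [ha₀, add_sub_cancel, mul_div_cancel₀ _ hD]
  have hC : elimNumC p b = elimDen p b * c₀ a₀ := by
    rw [elimNumC, hA]
    ring
  rw [circleIntegral_eq_of_simple_pole (w := a₀)
    (f := fun a => 2 * Real.pi * I * (elimDen p b * (b - (p 0 + p 1 * c₀ a * (1 + a))))⁻¹) ?_ ha₀']
  · have hX := hn0 ha₀'.le ((hc₀ a₀ ha₀'.le).trans (by norm_num))
    have : elimPoly p b =
        elimDen p b * (elimDen p b * (b - (p 0 + p 1 * c₀ a₀ * (1 + a₀)))) := by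
      rw [elimPoly, hA, hC]
      ring
    rw [this, div_mul_cancel_left₀ hD]
    ring
  · intro a _
    have : a - (p 2 * b ^ 3 + p 3 * c₀ a) = (a - a₀) * elimDen p b := by
      have : (1 + a₀) * elimDen p b = elimNumA p b := by rw [hA, mul_comm]
      rw [elimNumA] at this
      rw [elimDen] at this ⊢
      linear_combination this
    rw [this]
    simp only [mul_inv]
    ring
  · refine DifferentiableOn.const_mul (DifferentiableOn.inv
      (Differentiable.differentiableOn (by fun_prop)) fun a ha => ?_) _
    rw [mem_closedBall_zero_iff] at ha
    exact mul_ne_zero hD (hn0 ha ((hc₀ a ha).trans (by norm_num)))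

/-- A three-dimensional residue at the single common zero `sol p`: two variables are integrated out
and the third residue is taken at the only root of `elimPoly` in the disc. -/
theorem torusIntegral_sysInv {p : Fin 6 → ℂ} (hp : ‖p‖ ≤ 1 / 16) :
    (∯ v in T(0, fun _ => 1), sysInv p v) = (2 * Real.pi * I) ^ 3 / sysJac p (sol p) := by
  have hb₀ : ‖sol p 0‖ < 1 :=
    ((norm_le_pi_norm _ 0).trans (norm_sol_le hp)).trans_lt (by norm_num)
  have hD := elimDen_ne_zero hp hb₀.le
  have hJ := sysJac_ne_zero hp (norm_sol_le_one hp)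
  rw [torusIntegral_succ (torusIntegrable_of_continuousAt fun v hv => continuousAt_sysInv hp hv)]
  have step : ∀ b : ℂ, ‖b‖ = 1 → (∯ y in T((0 : Fin 3 → ℂ) ∘ Fin.succ, (fun _ => 1) ∘ Fin.succ),
      sysInv p (Fin.cons b y)) = (2 * Real.pi * I) ^ 2 * (elimDen p b / elimPoly p b) := by
    intro b hb
    rw [← torusIntegral_sysInv_aux hp hb]
    refine (torusIntegral_succ (f := fun y : Fin 2 → ℂ => sysInv p (Fin.cons b y))
      (torusIntegrable_of_continuousAt fun y hy => ?_)).trans ?_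
    · refine ContinuousAt.comp (f := fun y : Fin 2 → ℂ => (Fin.cons b y : Fin 3 → ℂ))
        (continuousAt_sysInv hp ?_) (Continuous.continuousAt ?_)
      · exact Fin.forall_fin_succ.2 ⟨hb, hy⟩
      · exact continuous_const.finCons continuous_id
    · refine circleIntegral.integral_congr zero_le_one fun a _ => ?_
      refine (torusIntegral_dim1 _ _ _).trans ?_
      refine circleIntegral.integral_congr zero_le_one fun c _ => ?_
      refine congrArg (sysInv p) (funext fun i => ?_)
      fin_cases i <;> rfl
  refine (circleIntegral.integral_congr zero_le_one fun b hb => step b (by simpa using hb)).trans ?_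
  rw [circleIntegral.integral_const_mul]
  change _ * (∮ b in C(0, 1), elimDen p b / elimPoly p b) = _
  rw [circleIntegral_div_of_unique_zero (w := sol p 0)
    (fun b => (hasDerivAt_elimPoly p b).differentiableAt)
    (fun b => (hasDerivAt_elimDen p b).differentiableAt) hb₀ (elimPoly_sol hp)
    (by rw [deriv_elimPoly_sol hp]; exact mul_ne_zero hD hJ)
    (fun b hb h => eq_sol_of_elimPoly_eq_zero hp hb h), deriv_elimPoly_sol hp]
  field_simp

end PfaffianMirror

end

/-! ### Mean values on tori and geometric expansions -/

noncomputable section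

namespace PfaffianMirror

open Filter Topology Metric Complex MeasureTheory

/-- The point `e^{iθ}` of the unit circle. -/
def unitPt (θ : ℝ) : ℂ := exp (θ * I)

@[simp]
theorem norm_unitPt (θ : ℝ) : ‖unitPt θ‖ = 1 := norm_exp_ofReal_mul_I θ

@[simp]
theorem unitPt_ne_zero (θ : ℝ) : unitPt θ ≠ 0 := exp_ne_zero _

theorem continuous_unitPt : Continuous unitPt := by
  unfold unitPt
  fun_prop

theorem continuous_unitPt_zpow (k : ℤ) : Continuous fun θ => unitPt θ ^ k :=
  continuous_unitPt.zpow₀ k fun θ => Or.inl (unitPt_ne_zero θ)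

/-- The mean value of a function of an angle. -/
def circleMean (f : ℝ → ℂ) : ℂ := (2 * Real.pi : ℂ)⁻¹ * ∫ θ in Set.Icc 0 (2 * Real.pi), f θ

theorem two_pi_ne_zero' : (2 * Real.pi : ℂ) ≠ 0 := by
  exact_mod_cast Real.two_pi_pos.ne'

theorem circleMean_zpow (k : ℤ) : circleMean (fun θ => unitPt θ ^ k) = if k = 0 then 1 else 0 := by
  rw [circleMean, integral_Icc_eq_integral_Ioc,
    ← intervalIntegral.integral_of_le Real.two_pi_pos.le]
  split_ifs with hk
  · rw [hk]
    simp only [zpow_zero, intervalIntegral.integral_const, sub_zero, real_smul, mul_one]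
    push_cast
    exact inv_mul_cancel₀ two_pi_ne_zero'
  · have hc : (k * I : ℂ) ≠ 0 := mul_ne_zero (by exact_mod_cast hk) I_ne_zero
    have : (fun θ : ℝ => unitPt θ ^ k) = fun θ : ℝ => exp (k * I * θ) := by
      funext θ
      rw [unitPt, ← exp_int_mul]
      ring_nf
    rw [this, integral_exp_mul_complex hc]
    have h1 : exp (k * I * (2 * Real.pi : ℝ)) = 1 := by
      rw [exp_eq_one_iff]
      exact ⟨k, by push_cast; ring⟩
    rw [h1]
    simp

theorem circleMean_const_mul (c : ℂ) (f : ℝ → ℂ) :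
    circleMean (fun θ => c * f θ) = c * circleMean f := by
  rw [circleMean, integral_const_mul, circleMean]
  ring

theorem circleMean_sum {ι : Type*} (s : Finset ι) {f : ι → ℝ → ℂ} (hf : ∀ i ∈ s, Continuous (f i)) :
    circleMean (fun θ => ∑ i ∈ s, f i θ) = ∑ i ∈ s, circleMean (f i) := by
  simp only [circleMean]
  rw [integral_finsetSum _ fun i hi => (hf i hi).integrableOn_Icc, Finset.mul_sum]

/-- Extraction of the coefficient of degree M in (1 + u)^N, including the zero value for M > N. -/
theorem circleMean_zpow_mul_one_add_pow (M N : ℕ) :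
    circleMean (fun θ => unitPt θ ^ (-(M : ℤ)) * (1 + unitPt θ) ^ N) = N.choose M := by
  have : (fun θ => unitPt θ ^ (-(M : ℤ)) * (1 + unitPt θ) ^ N) =
      fun θ => ∑ u ∈ Finset.range (N + 1), (N.choose u : ℂ) * unitPt θ ^ ((u : ℤ) - M) := by
    funext θ
    rw [add_comm, add_pow, Finset.mul_sum]
    refine Finset.sum_congr rfl fun u _ => ?_
    rw [one_pow, mul_one, sub_eq_neg_add, zpow_add₀ (unitPt_ne_zero θ), zpow_natCast]
    ring
  rw [this, circleMean_sum _ (f := fun u θ => (N.choose u : ℂ) * unitPt θ ^ ((u : ℤ) - M))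
    fun u _ => continuous_const.mul (continuous_unitPt_zpow _)]
  simp only [circleMean_const_mul, circleMean_zpow, sub_eq_zero, Nat.cast_inj, mul_ite, mul_one,
    mul_zero, Finset.sum_ite_eq', Finset.mem_range]
  split_ifs with h
  · rfl
  · rw [Nat.choose_eq_zero_of_lt (by omega), Nat.cast_zero]

/-- The mean value of a function on a torus of angles. -/
def torusMean {n : ℕ} (f : (Fin n → ℝ) → ℂ) : ℂ :=
  ((2 * Real.pi : ℂ) ^ n)⁻¹ * ∫ θ in Set.Icc (0 : Fin n → ℝ) fun _ => 2 * Real.pi, f θ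

theorem torusMean_prod {n : ℕ} (f : Fin n → ℝ → ℂ) :
    torusMean (fun θ => ∏ i, f i (θ i)) = ∏ i, circleMean (f i) := by
  simp only [torusMean, circleMean]
  rw [Finset.prod_mul_distrib, ← Set.pi_univ_Icc, volume_pi, Measure.restrict_pi_pi,
    integral_fintype_prod_eq_prod, Finset.prod_const, Finset.card_univ, Fintype.card_fin, inv_pow]
  rfl

theorem torusMean_const_mul {n : ℕ} (c : ℂ) (f : (Fin n → ℝ) → ℂ) :
    torusMean (fun θ => c * f θ) = c * torusMean f := by
  rw [torusMean, integral_const_mul, torusMean]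
  ring

theorem torusMean_sum {n : ℕ} {ι : Type*} (s : Finset ι) {f : ι → (Fin n → ℝ) → ℂ}
    (hf : ∀ i ∈ s, Continuous (f i)) :
    torusMean (fun θ => ∑ i ∈ s, f i θ) = ∑ i ∈ s, torusMean (f i) := by
  simp only [torusMean]
  rw [integral_finsetSum _ fun i hi => (hf i hi).integrableOn_Icc, Finset.mul_sum]

theorem hasSum_torusMean {n : ℕ} {ι : Type*} [Countable ι] {F : ι → (Fin n → ℝ) → ℂ}
    {f : (Fin n → ℝ) → ℂ} {B : ι → ℝ} (hc : ∀ s, Continuous (F s)) (hb : ∀ s θ, ‖F s θ‖ ≤ B s)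
    (hB : Summable B) (h : ∀ θ, HasSum (fun s => F s θ) (f θ)) :
    HasSum (fun s => torusMean (F s)) (torusMean f) := by
  refine (hasSum_integral_of_dominated_convergence (fun s _ => B s)
    (fun s => (hc s).aestronglyMeasurable) (fun s => .of_forall (hb s)) (.of_forall fun _ => hB)
    ?_ (.of_forall h)).mul_left _
  exact continuous_const.integrableOn_Icc

/-- The term of the expansion of `(1 - (α + β))⁻¹` in powers of `α` and `β`. -/
def binTerm (α β : ℂ) (s : ℕ × ℕ) : ℂ := ((s.1 + s.2).choose s.1 : ℂ) * (α ^ s.1 * β ^ s.2)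

/-- A product of two geometric sequences. -/
def geomBound (s : ℕ × ℕ) : ℝ := (1 / 4) ^ s.1 * (1 / 4) ^ s.2

theorem geomBound_nonneg (s : ℕ × ℕ) : 0 ≤ geomBound s := by
  unfold geomBound
  positivity

theorem summable_geomBound : Summable geomBound := by
  have := summable_geometric_of_lt_one (r := (1 / 4 : ℝ)) (by norm_num) (by norm_num)
  exact this.mul_of_nonneg this (fun _ => by positivity) fun _ => by positivity

/-- The binomial coefficient costs at most a factor 2 per degree, and 2 · 1/8 = 1/4. -/
theorem norm_binTerm_le {α β : ℂ} (hα : ‖α‖ ≤ 1 / 8) (hβ : ‖β‖ ≤ 1 / 8) (s : ℕ × ℕ) :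
    ‖binTerm α β s‖ ≤ geomBound s := by
  have h : (((s.1 + s.2).choose s.1 : ℕ) : ℝ) ≤ 2 ^ (s.1 + s.2) := by
    exact_mod_cast Nat.choose_le_two_pow (s.1 + s.2) s.1
  calc ‖binTerm α β s‖ = ((s.1 + s.2).choose s.1 : ℝ) * (‖α‖ ^ s.1 * ‖β‖ ^ s.2) := by
        rw [binTerm, norm_mul, norm_mul, norm_pow, norm_pow, norm_natCast]
    _ ≤ 2 ^ (s.1 + s.2) * ((1 / 8) ^ s.1 * (1 / 8) ^ s.2) := by gcongr
    _ = (2 * (1 / 8)) ^ s.1 * (2 * (1 / 8)) ^ s.2 := by rw [mul_pow, mul_pow, pow_add]; ring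
    _ = geomBound s := by norm_num [geomBound]

theorem summable_norm_binTerm {α β : ℂ} (hα : ‖α‖ ≤ 1 / 8) (hβ : ‖β‖ ≤ 1 / 8) :
    Summable fun s => ‖binTerm α β s‖ :=
  summable_geomBound.of_nonneg_of_le (fun _ => norm_nonneg _) (norm_binTerm_le hα hβ)

theorem hasSum_sum_antidiagonal {f : ℕ × ℕ → ℂ} {a : ℂ} (h : HasSum f a) :
    HasSum (fun n => ∑ s ∈ Finset.HasAntidiagonal.antidiagonal n, f s) a := by
  have h1 := (Finset.HasAntidiagonal.sigmaAntidiagonalEquivProd (A := ℕ)).hasSum_iff.2 h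
  refine (h1.sigma fun n => hasSum_fintype _).congr_fun fun n => ?_
  exact (Finset.sum_coe_sort (Finset.HasAntidiagonal.antidiagonal n) f).symm

theorem hasSum_binTerm {α β : ℂ} (hα : ‖α‖ ≤ 1 / 8) (hβ : ‖β‖ ≤ 1 / 8) :
    HasSum (binTerm α β) (1 - (α + β))⁻¹ := by
  have hs := (summable_norm_binTerm hα hβ).of_norm.hasSum
  have h1 := hasSum_sum_antidiagonal hs
  have h2 : ‖α + β‖ < 1 := (norm_add_le_of_le hα hβ).trans_lt (by norm_num)
  have h3 : (fun n => ∑ s ∈ Finset.HasAntidiagonal.antidiagonal n, binTerm α β s) = fun n => (α + β) ^ n := by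
    funext n
    rw [(Commute.all α β).add_pow']
    refine Finset.sum_congr rfl fun s hs => ?_
    rw [binTerm, Finset.HasAntidiagonal.mem_antidiagonal.1 hs, nsmul_eq_mul]
  rw [h3] at h1
  rwa [h1.unique (hasSum_geometric_of_norm_lt_one h2)] at hs

end PfaffianMirror

end

/-! ### Series for the reciprocal jacobian in the six parameters -/

noncomputable section

namespace PfaffianMirror

open Filter Topology Metric Complex MeasureTheory

/-- The index set of the expansion in the six parameters `p₁, q₁`, `p₂, q₂`, `p₃, q₃`. -/
abbrev SysIdx := (ℕ × ℕ) × (ℕ × ℕ) × (ℕ × ℕ)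

/-- The monomial in the parameters with the exponents `s`. -/
def sysMono (p : Fin 6 → ℂ) (s : SysIdx) : ℂ :=
  p 0 ^ s.1.1 * p 1 ^ s.1.2 * (p 2 ^ s.2.1.1 * p 3 ^ s.2.1.2) * (p 4 ^ s.2.2.1 * p 5 ^ s.2.2.2)

/-- The product of the binomial coefficients that come from the three geometric expansions. -/
def sysBinom (s : SysIdx) : ℂ :=
  ((s.1.1 + s.1.2).choose s.1.1 : ℂ) * ((s.2.1.1 + s.2.1.2).choose s.2.1.1 : ℂ) *
    ((s.2.2.1 + s.2.2.2).choose s.2.2.1 : ℂ)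

/-- The coefficients of the reciprocal jacobian of the system at its solution. -/
def sysCoeff (s : SysIdx) : ℂ :=
  if 2 * s.2.2.1 + 3 * s.2.1.1 = s.1.1 + s.1.2 ∧ s.1.2 + s.2.1.2 = s.2.2.1 + s.2.2.2 then
    sysBinom s * ((s.1.2 + s.2.2.1).choose (s.2.1.1 + s.2.1.2) : ℂ) else 0

/-- The terms of the geometric expansion of the inner integrand. -/
def sysTerm (p : Fin 6 → ℂ) (v : Fin 3 → ℂ) (s : SysIdx) : ℂ :=
  binTerm (p 0 / v 0) (p 1 * v 2 * (1 + v 1) / v 0) s.1 *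
    (binTerm (p 2 * v 0 ^ 3 / v 1) (p 3 * v 2 / v 1) s.2.1 *
      binTerm (p 4 * v 0 ^ 2 * (1 + v 1) / v 2) (p 5 / v 2) s.2.2)

/-- The product of geometric sequences that dominates `sysTerm`. -/
def sysBound (s : SysIdx) : ℝ := geomBound s.1 * (geomBound s.2.1 * geomBound s.2.2)

theorem summable_sysBound : Summable sysBound :=
  summable_geomBound.mul_of_nonneg
    (summable_geomBound.mul_of_nonneg summable_geomBound geomBound_nonneg geomBound_nonneg)
    geomBound_nonneg fun _ => mul_nonneg (geomBound_nonneg _) (geomBound_nonneg _)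

/-- In angles, dv = i v dθ supplies the product of the vᵢ, and (2πi)³ is absorbed by the
normalization of the mean. -/
theorem torusMean_sysInv {p : Fin 6 → ℂ} (hp : ‖p‖ ≤ 1 / 16) :
    torusMean (fun θ : Fin 3 → ℝ => (∏ i, unitPt (θ i)) * sysInv p fun i => unitPt (θ i)) =
      (sysJac p (sol p))⁻¹ := by
  have h := torusIntegral_sysInv hp
  have h1 : (∯ v in T(0, fun _ => 1), sysInv p v) =
      I ^ 3 * ∫ θ in Set.Icc (0 : Fin 3 → ℝ) fun _ => 2 * Real.pi,
        (∏ i, unitPt (θ i)) * sysInv p fun i => unitPt (θ i) := by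
    rw [torusIntegral, ← integral_const_mul]
    refine integral_congr_ae (.of_forall fun θ => ?_)
    have : torusMap 0 (fun _ => 1) θ = fun i => unitPt (θ i) := by
      funext i
      simp [torusMap, unitPt]
    simp only [this, smul_eq_mul, unitPt, Fin.prod_univ_three, ofReal_one]
    ring
  rw [h1, mul_pow] at h
  have h2 := two_pi_ne_zero'
  rw [torusMean]
  have hI : (I : ℂ) ^ 3 ≠ 0 := pow_ne_zero 3 I_ne_zero
  refine mul_left_cancel₀ hI ?_
  rw [mul_left_comm, h]
  field_simp

theorem hasSum_mul_of_summable_norm {ι κ : Type*} {f : ι → ℂ} {g : κ → ℂ} {a b : ℂ}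
    (hf : HasSum f a) (hg : HasSum g b) (hf' : Summable fun x => ‖f x‖)
    (hg' : Summable fun x => ‖g x‖) : HasSum (fun x : ι × κ => f x.1 * g x.2) (a * b) :=
  hf.mul hg (summable_mul_of_summable_norm hf' hg')

theorem summable_mul_norm {ι κ : Type*} {f : ι → ℂ} {g : κ → ℂ} (hf : Summable fun x => ‖f x‖)
    (hg : Summable fun x => ‖g x‖) : Summable fun x : ι × κ => ‖f x.1 * g x.2‖ :=
  hf.mul_norm hg

theorem hasSum_sysTerm {p : Fin 6 → ℂ} (hp : ‖p‖ ≤ 1 / 16) {v : Fin 3 → ℂ} (hv : ∀ i, ‖v i‖ = 1) :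
    HasSum (sysTerm p v) ((∏ i, v i) * sysInv p v) ∧ ∀ s, ‖sysTerm p v s‖ ≤ sysBound s := by
  have hp' (i) := (norm_le_pi_norm p i).trans hp
  have hv' (i) := (hv i).le
  have hv0 (i) : v i ≠ 0 := norm_ne_zero_iff.1 (by rw [hv i]; exact one_ne_zero)
  have h1 := norm_one_add_le (hv' 1)
  have e1 : ‖p 0 / v 0‖ ≤ 1 / 8 := by
    rw [norm_div, hv, div_one]
    exact (hp' 0).trans (by norm_num)
  have e2 : ‖p 1 * v 2 * (1 + v 1) / v 0‖ ≤ 1 / 8 := by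
    rw [norm_div, hv, div_one, norm_mul, norm_mul, hv, mul_one]
    calc _ ≤ (1 / 16 : ℝ) * 2 := by gcongr; exact hp' 1
      _ = _ := by norm_num
  have e3 : ‖p 2 * v 0 ^ 3 / v 1‖ ≤ 1 / 8 := by
    rw [norm_div, hv, div_one, norm_mul, norm_pow, hv, one_pow, mul_one]
    exact (hp' 2).trans (by norm_num)
  have e4 : ‖p 3 * v 2 / v 1‖ ≤ 1 / 8 := by
    rw [norm_div, hv, div_one, norm_mul, hv, mul_one]
    exact (hp' 3).trans (by norm_num)
  have e5 : ‖p 4 * v 0 ^ 2 * (1 + v 1) / v 2‖ ≤ 1 / 8 := by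
    rw [norm_div, hv, div_one, norm_mul, norm_mul, norm_pow, hv, one_pow, mul_one]
    calc _ ≤ (1 / 16 : ℝ) * 2 := by gcongr; exact hp' 4
      _ = _ := by norm_num
  have e6 : ‖p 5 / v 2‖ ≤ 1 / 8 := by
    rw [norm_div, hv, div_one]
    exact (hp' 5).trans (by norm_num)
  constructor
  · have s2 := summable_norm_binTerm e3 e4
    have s3 := summable_norm_binTerm e5 e6
    have hinv (x y : ℂ) (hx : x ≠ 0) : (1 - y / x)⁻¹ = x * (x - y)⁻¹ := by
      rw [one_sub_div hx, inv_div, div_eq_mul_inv]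
    have key : (∏ i, v i) * sysInv p v =
        (1 - (p 0 / v 0 + p 1 * v 2 * (1 + v 1) / v 0))⁻¹ *
          ((1 - (p 2 * v 0 ^ 3 / v 1 + p 3 * v 2 / v 1))⁻¹ *
            (1 - (p 4 * v 0 ^ 2 * (1 + v 1) / v 2 + p 5 / v 2))⁻¹) := by
      rw [← add_div, ← add_div, ← add_div, hinv _ _ (hv0 0), hinv _ _ (hv0 1), hinv _ _ (hv0 2),
        Fin.prod_univ_three, sysInv, mul_inv, mul_inv]
      change _ * ((v 0 - (p 0 + p 1 * v 2 * (1 + v 1)))⁻¹ *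
        (v 1 - (p 2 * v 0 ^ 3 + p 3 * v 2))⁻¹ *
        (v 2 - (p 4 * v 0 ^ 2 * (1 + v 1) + p 5))⁻¹) = _
      ring
    rw [key]
    have t := hasSum_mul_of_summable_norm (hasSum_binTerm e3 e4) (hasSum_binTerm e5 e6) s2 s3
    have t' := summable_mul_norm s2 s3
    have t2 := hasSum_mul_of_summable_norm (hasSum_binTerm e1 e2) t (summable_norm_binTerm e1 e2) t'
    have h : sysTerm p v = fun s => binTerm (p 0 / v 0) (p 1 * v 2 * (1 + v 1) / v 0) s.1 *
        (binTerm (p 2 * v 0 ^ 3 / v 1) (p 3 * v 2 / v 1) s.2.1 *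
          binTerm (p 4 * v 0 ^ 2 * (1 + v 1) / v 2) (p 5 / v 2) s.2.2) := rfl
    rw [h]
    exact t2
  · intro s
    rw [sysTerm, norm_mul, norm_mul, sysBound]
    have := geomBound_nonneg
    gcongr
    · apply this
    · exact norm_binTerm_le e1 e2 _
    · apply this
    · exact norm_binTerm_le e3 e4 _
    · exact norm_binTerm_le e5 e6 _

/-- The constant term in b and c gives the two conditions in `sysCoeff`. In a it is the coefficient
of a^(m+r) in (1 + a)^(j+k), for s = ((i,j),(m,r),(k,l)). -/
theorem torusMean_sysTerm (p : Fin 6 → ℂ) (s : SysIdx) :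
    torusMean (fun θ : Fin 3 → ℝ => sysTerm p (fun i => unitPt (θ i)) s) =
      sysCoeff s * sysMono p s := by
  obtain ⟨⟨i, j⟩, ⟨m, r⟩, k, l⟩ := s
  let f : Fin 3 → ℝ → ℂ :=
    ![fun θ => unitPt θ ^ (((2 * k + 3 * m : ℕ) : ℤ) - ((i + j : ℕ) : ℤ)),
      fun θ => unitPt θ ^ (-((m + r : ℕ) : ℤ)) * (1 + unitPt θ) ^ (j + k),
      fun θ => unitPt θ ^ (((j + r : ℕ) : ℤ) - ((k + l : ℕ) : ℤ))]
  have h : (fun θ : Fin 3 → ℝ => sysTerm p (fun i => unitPt (θ i)) ((i, j), (m, r), (k, l))) =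
      fun θ => sysBinom ((i, j), (m, r), (k, l)) * sysMono p ((i, j), (m, r), (k, l)) *
        ∏ i, f i (θ i) := by
    funext θ
    rw [Fin.prod_univ_three]
    simp only [f, sysTerm, binTerm, sysBinom, sysMono, Matrix.cons_val, Matrix.cons_val_zero,
      Matrix.cons_val_one, zpow_sub₀ (unitPt_ne_zero _), zpow_neg, zpow_natCast, div_pow, mul_pow]
    ring
  rw [h, torusMean_const_mul, torusMean_prod, Fin.prod_univ_three]
  simp only [f, Matrix.cons_val, Matrix.cons_val_zero, Matrix.cons_val_one, circleMean_zpow,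
    circleMean_zpow_mul_one_add_pow, sub_eq_zero, Nat.cast_inj, sysCoeff]
  by_cases h1 : 2 * k + 3 * m = i + j <;> by_cases h2 : j + r = k + l <;> simp [h1, h2]
  ring

theorem continuous_sysTerm (p : Fin 6 → ℂ) (s : SysIdx) :
    Continuous fun θ : Fin 3 → ℝ => sysTerm p (fun i => unitPt (θ i)) s := by
  have h (i : Fin 3) : Continuous fun θ : Fin 3 → ℝ => unitPt (θ i) :=
    continuous_unitPt.comp (continuous_apply i)
  have hd {f : (Fin 3 → ℝ) → ℂ} (hf : Continuous f) (i : Fin 3) :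
      Continuous fun θ => f θ / unitPt (θ i) := hf.div (h i) fun θ => unitPt_ne_zero _
  have h1 : Continuous fun θ : Fin 3 → ℝ => 1 + unitPt (θ 1) := continuous_const.add (h 1)
  have hb {f g : (Fin 3 → ℝ) → ℂ} (hf : Continuous f) (hg : Continuous g) (s : ℕ × ℕ) :
      Continuous fun θ => binTerm (f θ) (g θ) s :=
    continuous_const.mul ((hf.pow _).mul (hg.pow _))
  exact (hb (hd continuous_const 0) (hd ((continuous_const.mul (h 2)).mul h1) 0) _).mul
    ((hb (hd (continuous_const.mul ((h 0).pow 3)) 1) (hd (continuous_const.mul (h 2)) 1) _).mul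
    (hb (hd ((continuous_const.mul ((h 0).pow 2)).mul h1) 2) (hd continuous_const 2) _))

/-- The Taylor expansion of the reciprocal jacobian, at the solution of the system. -/
theorem hasSum_inv_sysJac {p : Fin 6 → ℂ} (hp : ‖p‖ ≤ 1 / 16) :
    HasSum (fun s => sysCoeff s * sysMono p s) (sysJac p (sol p))⁻¹ := by
  rw [← torusMean_sysInv hp]
  simp only [← torusMean_sysTerm]
  exact hasSum_torusMean (continuous_sysTerm p)
    (fun s θ => (hasSum_sysTerm hp fun i => norm_unitPt (θ i)).2 s) summable_sysBound
    fun θ => (hasSum_sysTerm hp fun i => norm_unitPt (θ i)).1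

theorem norm_torusMean_le {n : ℕ} {f : (Fin n → ℝ) → ℂ} {C : ℝ} (h : ∀ θ, ‖f θ‖ ≤ C) :
    ‖torusMean f‖ ≤ C := by
  have h1 := norm_setIntegral_le_of_norm_le_const (μ := volume)
    (s := Set.Icc (0 : Fin n → ℝ) fun _ => 2 * Real.pi) isCompact_Icc.measure_lt_top
    fun θ _ => h θ
  have h2 : volume.real (Set.Icc (0 : Fin n → ℝ) fun _ => 2 * Real.pi) = (2 * Real.pi) ^ n := by
    refine (Real.volume_Icc_pi_toReal fun _ => Real.two_pi_pos.le).trans ?_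
    simp
  have h3 := Real.two_pi_pos
  rw [h2] at h1
  rw [torusMean, norm_mul, norm_inv, norm_pow, norm_mul, norm_ofNat, norm_real, Real.norm_eq_abs,
    abs_of_pos Real.pi_pos, inv_mul_le_iff₀ (by positivity), mul_comm _ C]
  exact h1

/-- A coefficient is a mean of terms with this bound. The bound does not depend on p, which allows
termwise integration over the torus of (x₂, x₃, x₅). -/
theorem norm_sysCoeff_mul_sysMono_le {p : Fin 6 → ℂ} (hp : ‖p‖ ≤ 1 / 16) (s : SysIdx) :
    ‖sysCoeff s * sysMono p s‖ ≤ sysBound s := by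
  rw [← torusMean_sysTerm]
  exact norm_torusMean_le fun θ => (hasSum_sysTerm hp fun i => norm_unitPt (θ i)).2 s

end PfaffianMirror

end

/-! ### Constant terms on the torus of (x₂, x₃, x₅) -/

noncomputable section

namespace PfaffianMirror

open Filter Topology Metric Complex MeasureTheory

/-- The parameters of the fixed point system of the fibre over `t` at `(x₂, x₃, x₅) = (y, z, w)`. -/
def fibreParam (t y z w : ℂ) : Fin 6 → ℂ :=
  ![t * w ^ 3 / (y * z), t ^ 2 / (y * z), t / w, t ^ 2 * (y + z) / w, t ^ 2 / w,
    t * (y * z) * (y + z) / w]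

/-- The parameters over the point of the torus of radius `ε` with the arguments `θ`. -/
def torusParam (ε : ℝ) (t : ℂ) (θ : Fin 3 → ℝ) : Fin 6 → ℂ :=
  fibreParam t (ε * unitPt (θ 0)) (ε * unitPt (θ 1)) (ε * unitPt (θ 2))

/-- The radius of a disc in `t` over which all parameters are small. -/
def fibreRadius (ε : ℝ) : ℝ := 1 / (16 * (2 + ε + 1 / ε ^ 2 + 1 / ε + 2 * ε ^ 2))

theorem fibreRadius_pos {ε : ℝ} (hε : 0 < ε) : 0 < fibreRadius ε := by
  unfold fibreRadius
  positivity

/-- The parameters are bounded by |t| times ε, 1/ε², 1/ε, 2, 1/ε and 2ε², each at most the sum in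
`fibreRadius`. That sum exceeds 2, so |t| ≤ 1 and |t|² ≤ |t|. -/
theorem norm_fibreParam_lt {ε : ℝ} (hε : 0 < ε) {t y z w : ℂ} (ht : ‖t‖ < fibreRadius ε)
    (hy : ‖y‖ = ε) (hz : ‖z‖ = ε) (hw : ‖w‖ = ε) : ‖fibreParam t y z w‖ < 1 / 16 := by
  have h1 : 0 ≤ 1 / ε := by positivity
  have h2 : 0 ≤ 1 / ε ^ 2 := by positivity
  have h3 : 0 ≤ ε ^ 2 := by positivity
  set M := 2 + ε + 1 / ε ^ 2 + 1 / ε + 2 * ε ^ 2 with hM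
  have hMpos : 0 < M := by positivity
  have htM : ‖t‖ * M < 1 / 16 := by
    rw [fibreRadius, ← hM, lt_div_iff₀ (by positivity)] at ht
    linarith
  have ht0 := norm_nonneg t
  have ht1 : ‖t‖ ≤ 1 := by nlinarith
  have ht2 : ‖t‖ ^ 2 ≤ ‖t‖ := by nlinarith
  have hyz : ‖y + z‖ ≤ 2 * ε := (norm_add_le y z).trans (by linarith)
  have key {A x : ℝ} (hx : x ≤ ‖t‖ * A) (hA : A ≤ M) : x < 1 / 16 :=
    (hx.trans (mul_le_mul_of_nonneg_left hA ht0)).trans_lt htM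
  rw [pi_norm_lt_iff (by norm_num)]
  intro i
  fin_cases i
  · refine key (A := ε) ?_ (by linarith)
    change ‖t * w ^ 3 / (y * z)‖ ≤ _
    rw [norm_div, norm_mul, norm_mul, norm_pow, hy, hz, hw]
    apply le_of_eq
    field_simp
  · refine key (A := 1 / ε ^ 2) ?_ (by linarith)
    change ‖t ^ 2 / (y * z)‖ ≤ _
    rw [norm_div, norm_mul, norm_pow, hy, hz, ← sq, div_eq_mul_one_div]
    gcongr
  · refine key (A := 1 / ε) ?_ (by linarith)
    change ‖t / w‖ ≤ _
    rw [norm_div, hw, div_eq_mul_one_div]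
  · refine key (A := 2) ?_ (by linarith)
    change ‖t ^ 2 * (y + z) / w‖ ≤ _
    rw [norm_div, norm_mul, norm_pow, hw, div_le_iff₀ hε, mul_assoc]
    gcongr
  · refine key (A := 1 / ε) ?_ (by linarith)
    change ‖t ^ 2 / w‖ ≤ _
    rw [norm_div, norm_pow, hw, div_eq_mul_one_div]
    gcongr
  · refine key (A := 2 * ε ^ 2) ?_ (by linarith)
    change ‖t * (y * z) * (y + z) / w‖ ≤ _
    rw [norm_div, norm_mul, norm_mul, norm_mul, hy, hz, hw, div_le_iff₀ hε]
    calc _ ≤ ‖t‖ * (ε * ε) * (2 * ε) := by gcongr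
      _ = _ := by ring

theorem norm_ofReal_mul_unitPt {ε : ℝ} (hε : 0 < ε) (θ : ℝ) : ‖(ε : ℂ) * unitPt θ‖ = ε := by
  rw [norm_mul, norm_unitPt, mul_one, norm_real, Real.norm_of_nonneg hε.le]

theorem norm_torusParam_lt {ε : ℝ} (hε : 0 < ε) {t : ℂ} (ht : ‖t‖ < fibreRadius ε)
    (θ : Fin 3 → ℝ) : ‖torusParam ε t θ‖ < 1 / 16 :=
  norm_fibreParam_lt hε ht (norm_ofReal_mul_unitPt hε _) (norm_ofReal_mul_unitPt hε _)
    (norm_ofReal_mul_unitPt hε _)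

theorem continuous_torusParam {ε : ℝ} (hε : 0 < ε) :
    Continuous fun q : ℂ × (Fin 3 → ℝ) => torusParam ε q.1 q.2 := by
  have hε' : (ε : ℂ) ≠ 0 := by exact_mod_cast hε.ne'
  have h (i : Fin 3) : Continuous fun q : ℂ × (Fin 3 → ℝ) => (ε : ℂ) * unitPt (q.2 i) :=
    continuous_const.mul (continuous_unitPt.comp ((continuous_apply i).comp continuous_snd))
  have h0 (i : Fin 3) (q : ℂ × (Fin 3 → ℝ)) : (ε : ℂ) * unitPt (q.2 i) ≠ 0 :=
    mul_ne_zero hε' (unitPt_ne_zero _)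
  have ht : Continuous fun q : ℂ × (Fin 3 → ℝ) => q.1 := continuous_fst
  refine continuous_pi fun i => ?_
  have h01 := (h 0).mul (h 1)
  have h010 := fun q => mul_ne_zero (h0 0 q) (h0 1 q)
  have hs := (h 0).add (h 1)
  fin_cases i
  · exact (ht.mul ((h 2).pow 3)).div h01 h010
  · exact (ht.pow 2).div h01 h010
  · exact ht.div (h 2) (h0 2)
  · exact ((ht.pow 2).mul hs).div (h 2) (h0 2)
  · exact (ht.pow 2).div (h 2) (h0 2)
  · exact ((ht.mul h01).mul hs).div (h 2) (h0 2)

theorem continuous_sysMono (s : SysIdx) : Continuous fun p => sysMono p s := by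
  unfold sysMono
  fun_prop

/-- The monomial contains x₅^(3i-m-r-k-l) and (x₂+x₃)^(r+l) (x₂x₃)^(l-i-j); its constant term needs
the first exponent zero and the middle term x₂^(i+j-l) x₃^(i+j-l). By homogeneity the powers of ε
cancel. -/
theorem torusMean_sysMono {ε : ℝ} (hε : 0 < ε) (t : ℂ) (i j m r k l : ℕ) :
    torusMean (fun θ : Fin 3 → ℝ => sysMono (torusParam ε t θ) ((i, j), (m, r), (k, l))) =
      if 3 * i = m + r + k + l ∧ r + 3 * l = 2 * i + 2 * j then
        ((r + l).choose (i + j - l) : ℂ) * t ^ (i + 2 * j + m + 2 * r + 2 * k + l) else 0 := by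
  have hε' : (ε : ℂ) ≠ 0 := by exact_mod_cast hε.ne'
  let c (u : ℕ × ℕ) : ℂ := ((r + l).choose u.1 : ℂ) * t ^ (i + 2 * j + m + 2 * r + 2 * k + l) *
    ((ε : ℂ) ^ (3 * i + 2 * l + u.1 + u.2) / ε ^ (m + r + k + l + 2 * i + 2 * j))
  let f (u : ℕ × ℕ) : Fin 3 → ℝ → ℂ :=
    ![fun θ => unitPt θ ^ (((u.1 + l : ℕ) : ℤ) - ((i + j : ℕ) : ℤ)),
      fun θ => unitPt θ ^ (((u.2 + l : ℕ) : ℤ) - ((i + j : ℕ) : ℤ)),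
      fun θ => unitPt θ ^ (((3 * i : ℕ) : ℤ) - ((m + r + k + l : ℕ) : ℤ))]
  have h : (fun θ : Fin 3 → ℝ => sysMono (torusParam ε t θ) ((i, j), (m, r), (k, l))) =
      fun θ => ∑ u ∈ Finset.HasAntidiagonal.antidiagonal (r + l), c u * ∏ i, f u i (θ i) := by
    funext θ
    have h1 := (Commute.all ((ε : ℂ) * unitPt (θ 0)) (ε * unitPt (θ 1))).add_pow' (r + l)
    have h2 : sysMono (torusParam ε t θ) ((i, j), (m, r), (k, l)) =
        (ε * unitPt (θ 0) + ε * unitPt (θ 1)) ^ (r + l) *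
        (t ^ (i + 2 * j + m + 2 * r + 2 * k + l) *
          (ε ^ (3 * i + 2 * l) / ε ^ (m + r + k + l + 2 * i + 2 * j)) *
          (unitPt (θ 0) ^ l / unitPt (θ 0) ^ (i + j)) *
          (unitPt (θ 1) ^ l / unitPt (θ 1) ^ (i + j)) *
          (unitPt (θ 2) ^ (3 * i) / unitPt (θ 2) ^ (m + r + k + l))) := by
      simp only [sysMono, torusParam, fibreParam, Matrix.cons_val, Matrix.cons_val_zero,
        Matrix.cons_val_one]
      generalize (ε : ℂ) * unitPt (θ 0) + ε * unitPt (θ 1) = S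
      simp only [div_pow, mul_pow]
      ring
    rw [h2, h1, Finset.sum_mul]
    refine Finset.sum_congr rfl fun u _ => ?_
    simp only [f, c, Fin.prod_univ_three, Matrix.cons_val, Matrix.cons_val_zero,
      Matrix.cons_val_one, zpow_sub₀ (unitPt_ne_zero _), zpow_natCast, nsmul_eq_mul]
    ring
  have hf (u : ℕ × ℕ) : Continuous fun θ : Fin 3 → ℝ => c u * ∏ i, f u i (θ i) := by
    refine continuous_const.mul (continuous_finsetProd _ fun i _ => ?_)
    fin_cases i <;> exact (continuous_unitPt_zpow _).comp (continuous_apply _)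
  have hmean (u : ℕ × ℕ) : torusMean (fun θ : Fin 3 → ℝ => c u * ∏ i, f u i (θ i)) =
      c u * ((if u.1 + l = i + j then 1 else 0) * (if u.2 + l = i + j then 1 else 0) *
        (if 3 * i = m + r + k + l then 1 else 0)) := by
    rw [torusMean_const_mul, torusMean_prod, Fin.prod_univ_three]
    simp only [f, Matrix.cons_val, Matrix.cons_val_zero, Matrix.cons_val_one, circleMean_zpow,
      sub_eq_zero, Nat.cast_inj]
  rw [h, torusMean_sum _ fun u _ => hf u]
  simp only [hmean]
  by_cases hc : 3 * i = m + r + k + l ∧ r + 3 * l = 2 * i + 2 * j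
  · rw [if_pos hc]
    obtain ⟨hc1, hc2⟩ := hc
    -- The natural subtraction is exact, since r + 3l = 2(i+j) gives l ≤ i + j.
    rw [Finset.sum_eq_single (i + j - l, i + j - l)]
    · simp only [c]
      rw [if_pos (by omega), if_pos hc1, mul_one, mul_one, mul_one,
        show 3 * i + 2 * l + (i + j - l) + (i + j - l) = m + r + k + l + 2 * i + 2 * j by omega,
        div_self (pow_ne_zero _ hε'), mul_one]
    · intro u hu hne
      rw [Finset.HasAntidiagonal.mem_antidiagonal] at hu
      have : ¬ (u.1 + l = i + j ∧ u.2 + l = i + j) := fun h =>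
        hne (Prod.ext (by simp only; omega) (by simp only; omega))
      by_cases h1 : u.1 + l = i + j
      · rw [if_neg (fun h2 => this ⟨h1, h2⟩ : ¬ u.2 + l = i + j)]
        ring
      · rw [if_neg h1]
        ring
    · intro h
      exact absurd (Finset.HasAntidiagonal.mem_antidiagonal.2 (by omega)) h
  · rw [if_neg hc]
    refine Finset.sum_eq_zero fun u hu => ?_
    rw [Finset.HasAntidiagonal.mem_antidiagonal] at hu
    by_cases h1 : u.1 + l = i + j
    · by_cases h2 : u.2 + l = i + j
      · rw [if_neg (fun h3 => hc ⟨h3, by omega⟩ : ¬ 3 * i = m + r + k + l)]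
        ring
      · rw [if_neg h2]
        ring
    · rw [if_neg h1]
      ring

/-- The exponents that contribute to the constant term on the torus. -/
def balancedIdx (u : ℕ × ℕ) : SysIdx :=
  ((u.1 + u.2, 2 * u.1 + u.2), (u.1, u.2), (u.2, 2 * u.1 + u.2))

theorem balancedIdx_injective : Function.Injective balancedIdx := fun u v h => by
  simp only [balancedIdx, Prod.mk.injEq] at h
  exact Prod.ext h.2.1.1 h.2.1.2

/-- The four balancing conditions on six exponents are solved by `balancedIdx` in terms of (m, r),
with total power t^(8(m+r)). The four coefficients in `sysCoeff` and the one from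
`torusMean_sysMono` are then the five binomials of `periodCoeff_eq_sum`. -/
theorem hasSum_torusMean_inv_sysJac {ε : ℝ} (hε : 0 < ε) {t : ℂ} (ht : ‖t‖ < fibreRadius ε) :
    HasSum (fun n => (periodCoeff n : ℂ) * (t ^ 8) ^ n) (torusMean fun θ : Fin 3 → ℝ =>
      (sysJac (torusParam ε t θ) (sol (torusParam ε t θ)))⁻¹) := by
  have hc (s : SysIdx) : Continuous fun θ : Fin 3 → ℝ =>
      sysCoeff s * sysMono (torusParam ε t θ) s :=
    continuous_const.mul ((continuous_sysMono s).comp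
      ((continuous_torusParam hε).comp (Continuous.prodMk_right t)))
  have h := hasSum_torusMean hc
    (fun s θ => norm_sysCoeff_mul_sysMono_le (norm_torusParam_lt hε ht θ).le s) summable_sysBound
    fun θ => hasSum_inv_sysJac (norm_torusParam_lt hε ht θ).le
  simp only [torusMean_const_mul] at h
  rw [← balancedIdx_injective.hasSum_iff] at h
  · refine (hasSum_sum_antidiagonal h).congr_fun fun n => ?_
    rw [periodCoeff_eq_sum, ← Finset.Nat.sum_antidiagonal_eq_sum_range_succ fun m r =>
      ((2 * n).choose n : ℤ) ^ 2 * ((2 * n + m).choose n * (2 * n).choose r * n.choose m),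
      Int.cast_sum, Finset.sum_mul]
    refine Finset.sum_congr rfl fun u hu => ?_
    rw [Finset.HasAntidiagonal.mem_antidiagonal] at hu
    obtain ⟨m, r⟩ := u
    subst hu
    simp only [Function.comp_apply, balancedIdx]
    rw [torusMean_sysMono hε, if_pos (by omega), sysCoeff, if_pos (by simp only; omega), sysBinom]
    simp only
    rw [show m + r + (2 * m + r) - (2 * m + r) = m + r by omega,
      show r + (2 * m + r) = 2 * (m + r) by omega,
      show 2 * m + r + r = 2 * (m + r) by omega,
      show m + r + (2 * m + r) = 2 * (m + r) + m by omega,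
      show m + r + 2 * (2 * m + r) + m + 2 * r + 2 * r + (2 * m + r) = 8 * (m + r) by omega, pow_mul]
    push_cast
    ring
  · rintro ⟨⟨i, j⟩, ⟨m, r⟩, k, l⟩ hs
    rw [torusMean_sysMono hε, sysCoeff]
    split_ifs with h1 h2
    · refine absurd ⟨(m, r), ?_⟩ hs
      simp only at h1
      simp only [balancedIdx, Prod.mk.injEq]
      refine ⟨⟨?_, ?_⟩, trivial, ?_, ?_⟩ <;> omega
    all_goals simp

end PfaffianMirror

end

/-! ### Pfaffians and the determinant of the residue form -/

noncomputable section

namespace PfaffianMirror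

open Filter Topology Metric Complex MeasureTheory MvPolynomial

/-- Expansion by the value p of σ at 0: σ is the transposition of 0 and p (the identity for p = 0)
after a permutation of the remaining indices. -/
theorem sum_perm_fin_succ {R : Type*} [CommRing R] {n : ℕ}
    (F : Equiv.Perm (Fin (n + 1)) → R) :
    ∑ σ : Equiv.Perm (Fin (n + 1)), ((Equiv.Perm.sign σ : ℤ) : R) * F σ =
      ∑ p : Fin (n + 1), (if p = 0 then 1 else -1) * ∑ e : Equiv.Perm (Fin n),
        ((Equiv.Perm.sign e : ℤ) : R) * F (Equiv.Perm.decomposeFin.symm (p, e)) := by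
  rw [← Equiv.Perm.decomposeFin.symm.sum_comp, Fintype.sum_prod_type]
  refine Finset.sum_congr rfl fun p _ => ?_
  rw [Finset.mul_sum]
  refine Finset.sum_congr rfl fun e _ => ?_
  rw [Equiv.Perm.decomposeFin.symm_sign]
  split_ifs <;> simp

theorem sum_perm_fin_two {R : Type*} [CommRing R] (f : Fin 2 → Fin 2 → R) :
    ∑ σ : Equiv.Perm (Fin 2), ((Equiv.Perm.sign σ : ℤ) : R) * f (σ 0) (σ 1) =
      f 0 1 - f 1 0 := by
  rw [sum_perm_fin_succ fun σ => f (σ 0) (σ 1)]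
  rw [Fin.sum_univ_two, Fintype.sum_unique, Fintype.sum_unique, if_pos rfl, if_neg (by decide)]
  have hs (σ : Equiv.Perm (Fin 1)) : Equiv.Perm.sign σ = 1 := by
    rw [Subsingleton.elim σ 1, Equiv.Perm.sign_one]
  rw [hs, Units.val_one, Int.cast_one]
  change 1 * (1 * f 0 1) + -1 * (1 * f 1 0) = _
  ring

theorem sum_perm_fin_three {R : Type*} [CommRing R] (f : Fin 3 → Fin 3 → Fin 3 → R) :
    ∑ σ : Equiv.Perm (Fin 3), ((Equiv.Perm.sign σ : ℤ) : R) * f (σ 0) (σ 1) (σ 2) =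
      f 0 1 2 - f 0 2 1 - f 1 0 2 + f 1 2 0 + f 2 0 1 - f 2 1 0 := by
  have h (p : Fin 3) := sum_perm_fin_two fun a b =>
    f p (Equiv.swap 0 p a.succ) (Equiv.swap 0 p b.succ)
  have h0 (p : Fin 3) (e : Equiv.Perm (Fin 2)) :
      f (Equiv.Perm.decomposeFin.symm (p, e) 0) (Equiv.Perm.decomposeFin.symm (p, e) 1)
        (Equiv.Perm.decomposeFin.symm (p, e) 2) =
      f p (Equiv.swap 0 p (e 0).succ) (Equiv.swap 0 p (e 1).succ) := by
    have h1 := Equiv.Perm.decomposeFin_symm_apply_succ e p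
    rw [Equiv.Perm.decomposeFin_symm_apply_zero, ← h1, ← h1]
    rfl
  rw [sum_perm_fin_succ fun σ => f (σ 0) (σ 1) (σ 2)]
  simp only [h0, h]
  rw [Fin.sum_univ_three, if_pos rfl, if_neg (by decide), if_neg (by decide)]
  change 1 * (f 0 1 2 - f 0 2 1) + -1 * (f 1 0 2 - f 1 2 0) + -1 * (f 2 1 0 - f 2 0 1) = _
  ring

theorem sum_perm_fin_four {R : Type*} [CommRing R] (f : Fin 4 → Fin 4 → Fin 4 → Fin 4 → R) :
    ∑ σ : Equiv.Perm (Fin 4), ((Equiv.Perm.sign σ : ℤ) : R) * f (σ 0) (σ 1) (σ 2) (σ 3) =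
      f 0 1 2 3 - f 0 1 3 2 - f 0 2 1 3 + f 0 2 3 1 + f 0 3 1 2 - f 0 3 2 1
      - f 1 0 2 3 + f 1 0 3 2 + f 1 2 0 3 - f 1 2 3 0 - f 1 3 0 2 + f 1 3 2 0
      + f 2 0 1 3 - f 2 0 3 1 - f 2 1 0 3 + f 2 1 3 0 + f 2 3 0 1 - f 2 3 1 0
      - f 3 0 1 2 + f 3 0 2 1 + f 3 1 0 2 - f 3 1 2 0 - f 3 2 0 1 + f 3 2 1 0 := by
  have h (p : Fin 4) := sum_perm_fin_three fun a b c =>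
    f p (Equiv.swap 0 p a.succ) (Equiv.swap 0 p b.succ) (Equiv.swap 0 p c.succ)
  have h0 (p : Fin 4) (e : Equiv.Perm (Fin 3)) :
      f (Equiv.Perm.decomposeFin.symm (p, e) 0) (Equiv.Perm.decomposeFin.symm (p, e) 1)
        (Equiv.Perm.decomposeFin.symm (p, e) 2) (Equiv.Perm.decomposeFin.symm (p, e) 3) =
      f p (Equiv.swap 0 p (e 0).succ) (Equiv.swap 0 p (e 1).succ)
        (Equiv.swap 0 p (e 2).succ) := by
    have h1 := Equiv.Perm.decomposeFin_symm_apply_succ e p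
    rw [Equiv.Perm.decomposeFin_symm_apply_zero, ← h1, ← h1, ← h1]
    rfl
  rw [sum_perm_fin_succ fun σ => f (σ 0) (σ 1) (σ 2) (σ 3)]
  simp only [h0, h]
  rw [Fin.sum_univ_four, if_pos rfl, if_neg (by decide), if_neg (by decide),
    if_neg (by decide)]
  change 1 * (f 0 1 2 3 - f 0 1 3 2 - f 0 2 1 3 + f 0 2 3 1 + f 0 3 1 2 - f 0 3 2 1)
    + -1 * (f 1 0 2 3 - f 1 0 3 2 - f 1 2 0 3 + f 1 2 3 0 + f 1 3 0 2 - f 1 3 2 0)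
    + -1 * (f 2 1 0 3 - f 2 1 3 0 - f 2 0 1 3 + f 2 0 3 1 + f 2 3 1 0 - f 2 3 0 1)
    + -1 * (f 3 1 2 0 - f 3 1 0 2 - f 3 2 1 0 + f 3 2 0 1 + f 3 0 1 2 - f 3 0 2 1) = _
  ring

theorem pfaffian_one {R : Type*} [CommRing R] [Algebra ℚ R] {M : Matrix (Fin 2) (Fin 2) R}
    (hM : ∀ i j, M j i = -M i j) : pfaffian 1 M = M 0 1 := by
  have h := sum_perm_fin_two fun a b => M a b
  rw [hM 0 1, sub_neg_eq_add] at h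
  have h2 : pfaffian 1 M = ((1 : ℚ) / 2) • (M 0 1 + M 0 1) := by
    rw [← h, pfaffian]
    simp
  rw [h2, ← two_smul ℚ, smul_smul]
  norm_num

/-- With the pairing of i and r + i this is the negative of the usual pfaffian. It makes P₁, P₃, P₄
reduce to x₂x₃x₄, x₅x₆, x₀x₁x₅ at t = 0. -/
theorem pfaffian_two {R : Type*} [CommRing R] [Algebra ℚ R] {M : Matrix (Fin 4) (Fin 4) R}
    (hM : ∀ i j, M j i = -M i j) :
    pfaffian 2 M = M 0 2 * M 1 3 - M 0 1 * M 2 3 - M 0 3 * M 1 2 := by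
  have h := sum_perm_fin_four fun a b c d => M a c * M b d
  have h2 : pfaffian 2 M =
      ((1 : ℚ) / 8) • ((8 : ℚ) • (M 0 2 * M 1 3 - M 0 1 * M 2 3 - M 0 3 * M 1 2)) := by
    rw [pfaffian]
    congr 1
    · norm_num [Nat.factorial]
    · have e (σ : Equiv.Perm (Fin (2 * 2))) :
          ∏ i : Fin 2, M (σ ⟨i, by omega⟩) (σ ⟨2 + i, by omega⟩) = M (σ 0) (σ 2) * M (σ 1) (σ 3) :=
        Fin.prod_univ_two _
      simp only [e]
      refine h.trans ?_
      rw [hM 0 1, hM 0 2, hM 0 3, hM 1 2, hM 1 3, hM 2 3]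
      rw [show (8 : ℚ) = (8 : ℕ) by norm_num, Nat.cast_smul_eq_nsmul, nsmul_eq_mul]
      push_cast
      ring
  rw [h2, smul_smul]
  norm_num

theorem matrixN_skew (t : ℂ) (i j : Fin 5) : matrixN t j i = -matrixN t i j := by
  fin_cases i <;> fin_cases j <;> simp [matrixN]

theorem P_eq (t : ℂ) (i : Fin 5) : P t i =
    matrixN t (i.succAbove 0) (i.succAbove 2) * matrixN t (i.succAbove 1) (i.succAbove 3)
    - matrixN t (i.succAbove 0) (i.succAbove 1) * matrixN t (i.succAbove 2) (i.succAbove 3)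
    - matrixN t (i.succAbove 0) (i.succAbove 3) * matrixN t (i.succAbove 1) (i.succAbove 2) :=
  pfaffian_two fun _ _ => matrixN_skew t _ _

theorem P_zero (t : ℂ) :
    P t 0 = x 2 * x 3 * x 4 - C t * x 6 * (C t * (x 0 + x 1)) - x 5 * (C t * x 5 ^ 2) :=
  P_eq t 0

theorem P_one (t : ℂ) :
    P t 1 = x 6 * x 4 - x 0 * x 1 * (C t * (x 0 + x 1)) - C t * (x 2 + x 3) * (C t * x 5 ^ 2) :=
  P_eq t 1

theorem P_two (t : ℂ) : P t 2 = x 6 * x 5 - C t * x 4 ^ 2 * (C t * (x 0 + x 1))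
    - C t * (x 2 + x 3) * (x 2 * x 3) :=
  P_eq t 2

theorem P_three (t : ℂ) :
    P t 3 = x 0 * x 1 * x 5 - C t * x 4 ^ 2 * x 4 - C t * (x 2 + x 3) * (C t * x 6) :=
  P_eq t 3

theorem P_four (t : ℂ) :
    P t 4 = x 0 * x 1 * (x 2 * x 3) - C t * x 4 ^ 2 * (C t * x 5 ^ 2) - x 6 * (C t * x 6) :=
  P_eq t 4

theorem P134_eq (t : ℂ) : P134 t = x 5 :=
  pfaffian_one (M := (matrixN t).submatrix ![1, 4] ![1, 4]) fun _ _ => matrixN_skew t _ _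

/-- The frame vectors fill the columns of x₁, x₄, x₆, and the tangent vectors have no x₀-component.
Hence the derivatives of the implicit functions drop out; the minus sign cancels against C = -1. -/
theorem det_frame {R : Type*} [CommRing R] (e₀ e₁ e₂ e₃ e₄ e₅ e₆ a₁ a₂ a₄ a₆ b₁ b₃ b₄ b₆
    c₁ c₄ c₅ c₆ : R) :
    Matrix.det !![e₀, e₁, e₂, e₃, e₄, e₅, e₆;
      0, 1, 0, 0, 0, 0, 0;
      0, 0, 0, 0, 1, 0, 0;
      0, 0, 0, 0, 0, 0, 1;
      0, a₁, a₂, 0, a₄, 0, a₆;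
      0, b₁, 0, b₃, b₄, 0, b₆;
      0, c₁, 0, 0, c₄, c₅, c₆] = -(e₀ * (a₂ * b₃ * c₅)) := by
  rw [Matrix.det_succ_column_zero, Fin.sum_univ_succ, Finset.sum_eq_zero, add_zero]
  swap
  · intro i _
    fin_cases i <;> simp
  rw [Matrix.det_succ_row_zero, Fin.sum_univ_succ, Finset.sum_eq_zero, add_zero]
  swap
  · intro i _
    fin_cases i <;> simp
  rw [Matrix.det_succ_row_zero, Finset.sum_eq_single 2]
  rotate_left
  · intro i _ hi
    fin_cases i <;> simp at hi ⊢
  · simp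
  rw [Matrix.det_succ_row_zero, Finset.sum_eq_single 3]
  rotate_left
  · intro i _ hi
    fin_cases i
    rotate_right
    · exact absurd rfl hi
    all_goals exact mul_eq_zero_of_left (mul_zero _) _
  · simp
  rw [Matrix.det_fin_three]
  change (-1) ^ 0 * e₀ * ((-1) ^ 0 * 1 * ((-1) ^ 2 * 1 * ((-1) ^ 3 * 1 * (a₂ * b₃ * c₅ - a₂ * 0 * 0
    - 0 * 0 * c₅ + 0 * 0 * 0 + 0 * 0 * 0 - 0 * b₃ * 0)))) = _
  ring

end PfaffianMirror

end

/-! ### The fibre and the form α in the chart x₀ = 1 -/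

noncomputable section

namespace PfaffianMirror

open Filter Topology Metric Complex MeasureTheory MvPolynomial

/-- The point of the chart `x₀ = 1` with `(x₂, x₃, x₅) = (y, z, w)` and `(x₄, x₁, x₆) = v`. -/
def chartPt (y z w : ℂ) (v : Fin 3 → ℂ) : Fin 7 → ℂ := ![1, v 1, y, z, v 0, w, v 2]

section

variable {t y z w : ℂ} (hy : y ≠ 0) (hz : z ≠ 0) (hw : w ≠ 0) (v : Fin 3 → ℂ)

theorem eval_P_zero : eval (chartPt y z w v) (P t 0) =
    y * z * v 0 - t ^ 2 * v 2 * (1 + v 1) - t * w ^ 3 := by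
  simp [P_zero, chartPt]
  ring

theorem eval_P_one : eval (chartPt y z w v) (P t 1) =
    v 2 * v 0 - t * v 1 * (1 + v 1) - t ^ 2 * (y + z) * w ^ 2 := by
  simp [P_one, chartPt]
  ring

theorem eval_P_two : eval (chartPt y z w v) (P t 2) =
    w * v 2 - t ^ 2 * v 0 ^ 2 * (1 + v 1) - t * (y * z) * (y + z) := by
  simp [P_two, chartPt]
  ring

theorem eval_P_three : eval (chartPt y z w v) (P t 3) =
    w * v 1 - t * v 0 ^ 3 - t ^ 2 * (y + z) * v 2 := by
  simp [P_three, chartPt]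
  ring

theorem eval_P_four : eval (chartPt y z w v) (P t 4) =
    y * z * v 1 - t ^ 2 * v 0 ^ 2 * w ^ 2 - t * v 2 ^ 2 := by
  simp [P_four, chartPt]
  ring

include hy hz hw

/-- P₁/(yz), P₄/w and P₃/w are the three fixed point equations; the other two pfaffians follow
because w ≠ 0. -/
theorem chartPt_mem_cone_iff :
    chartPt y z w v ∈ cone t ↔ v = sysMap (fibreParam t y z w) v := by
  have e0 : (v 0 = sysMap (fibreParam t y z w) v 0) ↔ eval (chartPt y z w v) (P t 0) = 0 := by
    change (v 0 = t * w ^ 3 / (y * z) + t ^ 2 / (y * z) * v 2 * (1 + v 1)) ↔ _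
    rw [eval_P_zero]
    field_simp
    constructor <;> intro h <;> linear_combination h
  have e1 : (v 1 = sysMap (fibreParam t y z w) v 1) ↔ eval (chartPt y z w v) (P t 3) = 0 := by
    change (v 1 = t / w * v 0 ^ 3 + t ^ 2 * (y + z) / w * v 2) ↔ _
    rw [eval_P_three]
    field_simp
    constructor <;> intro h <;> linear_combination h
  have e2 : (v 2 = sysMap (fibreParam t y z w) v 2) ↔ eval (chartPt y z w v) (P t 2) = 0 := by
    change (v 2 = t ^ 2 / w * v 0 ^ 2 * (1 + v 1) + t * (y * z) * (y + z) / w) ↔ _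
    rw [eval_P_two]
    field_simp
    constructor <;> intro h <;> linear_combination h
  rw [funext_iff, Fin.forall_fin_succ, Fin.forall_fin_two]
  change _ ↔ v 0 = sysMap (fibreParam t y z w) v 0 ∧ v 1 = sysMap (fibreParam t y z w) v 1 ∧
    v 2 = sysMap (fibreParam t y z w) v 2
  rw [e0, e1, e2]
  constructor
  · rintro ⟨-, h⟩
    exact ⟨h 0, h 3, h 2⟩
  · rintro ⟨h0, h3, h2⟩
    refine ⟨fun h => one_ne_zero (congrFun h 0), fun i => ?_⟩
    -- Syzygies of the skew matrix express w P₂ and w P₅ through P₁, P₃, P₄.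
    have h1 : eval (chartPt y z w v) (P t 1) = 0 := by
      refine (mul_eq_zero.1 (?_ : w * _ = 0)).resolve_left hw
      rw [eval_P_zero] at h0
      rw [eval_P_two] at h2
      rw [eval_P_three] at h3
      rw [eval_P_one]
      linear_combination v 0 * h2 - t * (1 + v 1) * h3 + t * (y + z) * h0
    have h4 : eval (chartPt y z w v) (P t 4) = 0 := by
      refine (mul_eq_zero.1 (?_ : w * _ = 0)).resolve_left hw
      rw [eval_P_zero] at h0
      rw [eval_P_two] at h2
      rw [eval_P_three] at h3
      rw [eval_P_four]
      linear_combination y * z * h3 - t * v 2 * h2 + t * v 0 ^ 2 * h0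
    fin_cases i
    exacts [h0, h1, h2, h3, h4]

/-- Passing from the pfaffians to the fixed point system divides the rows by yz, w and w. -/
theorem dEqs_chartPt : dEqs t (chartPt y z w v) normalFrame =
    y * z * w ^ 2 * sysJac (fibreParam t y z w) v := by
  have h (i : Fin 3) (k : Fin 7) : ∑ l, eval (chartPt y z w v) (pderiv l (eqs t i)) *
      (Pi.single k 1 : Fin 7 → ℂ) l = eval (chartPt y z w v) (pderiv k (eqs t i)) := by
    simp [Pi.single_apply]
  have hn (i j : Fin 3) : ∑ l, eval (chartPt y z w v) (pderiv l (eqs t i)) * normalFrame j l =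
      eval (chartPt y z w v) (pderiv ((![1, 4, 6] : Fin 3 → Fin 7) j) (eqs t i)) := by
    fin_cases j <;> exact h i _
  have hm : (Matrix.of fun i j : Fin 3 => eval (chartPt y z w v)
      (pderiv ((![1, 4, 6] : Fin 3 → Fin 7) j) (eqs t i))) =
      !![-(t ^ 2 * v 2), y * z, -(t ^ 2 * (1 + v 1));
        -(t ^ 2 * v 0 ^ 2), -(2 * t ^ 2 * v 0 * (1 + v 1)), w;
        w, -(3 * t * v 0 ^ 2), -(t ^ 2 * (y + z))] := by
    ext i j
    fin_cases i <;> fin_cases j <;>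
      simp [eqs, P_zero, P_two, P_three, chartPt, pderiv_X, Derivation.leibniz_pow]
      <;> ring
  rw [dEqs]
  simp only [hn]
  rw [hm, sysJac, Matrix.det_fin_three, Matrix.det_fin_three]
  simp only [Matrix.of_apply, Matrix.cons_val', Matrix.cons_val_zero, Matrix.cons_val_one,
    Matrix.cons_val, fibreParam]
  field_simp

/-- The numerator P₁₃₄ = w cancels one factor of the yzw² from `dEqs_chartPt`. -/
theorem alpha_chartPt {u : Fin 3 → Fin 7 → ℂ} {a b c : ℂ} (h0 : ∀ j, u j 0 = 0)
    (h2 : ∀ j, u j 2 = ![a, 0, 0] j) (h3 : ∀ j, u j 3 = ![0, b, 0] j)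
    (h5 : ∀ j, u j 5 = ![0, 0, c] j) : alpha t (chartPt y z w v) u =
      a * b * c / ((2 * Real.pi * I) ^ 3 * (y * z * w * sysJac (fibreParam t y z w) v)) := by
  have hm : (Matrix.of (Fin.cons (fun k => weight k * chartPt y z w v k)
      ![normalFrame 0, normalFrame 1, normalFrame 2, u 0, u 1, u 2] : Fin 7 → Fin 7 → ℂ)) =
      !![1, v 1, y, z, v 0, w, 2 * v 2;
        0, 1, 0, 0, 0, 0, 0;
        0, 0, 0, 0, 1, 0, 0;
        0, 0, 0, 0, 0, 0, 1;
        0, u 0 1, a, 0, u 0 4, 0, u 0 6;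
        0, u 1 1, 0, b, u 1 4, 0, u 1 6;
        0, u 2 1, 0, 0, u 2 4, c, u 2 6] := by
    ext i j
    fin_cases i <;> fin_cases j <;> simp [weight, chartPt, normalFrame, h0, h2, h3, h5]
  have hpi : (Real.pi : ℂ) ≠ 0 := by exact_mod_cast Real.pi_pos.ne'
  have hI := I_ne_zero
  rw [alpha, residue, Omega0, hm, det_frame, dEqs_chartPt hy hz hw, P134_eq, eval_X]
  change -((2 * Real.pi * I) ^ 3 * w * _ / _) = _
  -- For a vanishing jacobian both sides are quotients by zero, hence 0.
  by_cases hJ : sysJac (fibreParam t y z w) v = 0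
  · simp [hJ]
  · field_simp

end

end PfaffianMirror

end

/-! ### The family of tori: existence, uniqueness, period -/

noncomputable section

namespace PfaffianMirror

open Filter Topology Metric Complex MeasureTheory

/-- The point over `t` with the arguments `θ` of the family of tori given by the solution of the
fixed point system. -/
def solCycle (ε : ℝ) (t : ℂ) (θ : Fin 3 → ℝ) : Fin 7 → ℂ :=
  chartPt (ε * unitPt (θ 0)) (ε * unitPt (θ 1)) (ε * unitPt (θ 2)) (sol (torusParam ε t θ))

theorem unitPt_add_two_pi (θ : ℝ) : unitPt (θ + 2 * Real.pi) = unitPt θ := by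
  rw [unitPt, unitPt]
  push_cast
  rw [add_mul]
  exact exp_periodic _

theorem contDiff_unitPt_apply {n : WithTop ℕ∞} (i : Fin 3) :
    ContDiff ℝ n fun θ : Fin 3 → ℝ => unitPt (θ i) :=
  ((ofRealCLM.contDiff.comp (contDiff_apply ℝ ℝ i)).mul contDiff_const).cexp

theorem sol_of_zero : sol 0 = 0 := by
  refine (eq_sol (by simp) (by simp) ?_).symm
  funext i
  fin_cases i <;> simp [sysMap]

theorem torusParam_zero (ε : ℝ) (θ : Fin 3 → ℝ) : torusParam ε 0 θ = 0 := by
  funext i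
  fin_cases i <;> simp [torusParam, fibreParam]

section

variable {ε : ℝ} (hε : 0 < ε)
include hε

theorem ofReal_mul_unitPt_ne_zero (θ : ℝ) : (ε : ℂ) * unitPt θ ≠ 0 :=
  mul_ne_zero (by exact_mod_cast hε.ne') (unitPt_ne_zero θ)

theorem contDiff_torusParam (t : ℂ) : ContDiff ℝ 1 (torusParam ε t) := by
  have h (i : Fin 3) : ContDiff ℝ 1 fun θ : Fin 3 → ℝ => (ε : ℂ) * unitPt (θ i) :=
    contDiff_const.mul (contDiff_unitPt_apply i)
  have h0 (i : Fin 3) (θ : Fin 3 → ℝ) := ofReal_mul_unitPt_ne_zero hε (θ i)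
  have h01 := (h 0).mul (h 1)
  have h010 := fun q => mul_ne_zero (h0 0 q) (h0 1 q)
  have hs := (h 0).add (h 1)
  have hdiv {f g : (Fin 3 → ℝ) → ℂ} (hf : ContDiff ℝ 1 f) (hg : ContDiff ℝ 1 g)
      (hg0 : ∀ θ, g θ ≠ 0) : ContDiff ℝ 1 fun θ => f θ / g θ := by
    simp only [div_eq_mul_inv]
    exact hf.mul (hg.inv hg0)
  refine contDiff_pi.2 fun i => ?_
  fin_cases i
  · exact hdiv (contDiff_const.mul ((h 2).pow 3)) h01 h010
  · exact hdiv contDiff_const h01 h010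
  · exact hdiv contDiff_const (h 2) (h0 2)
  · exact hdiv (contDiff_const.mul hs) (h 2) (h0 2)
  · exact hdiv contDiff_const (h 2) (h0 2)
  · exact hdiv ((contDiff_const.mul h01).mul hs) (h 2) (h0 2)

theorem isTorusCycle_solCycle : IsTorusCycle ε (fibreRadius ε) (solCycle ε) where
  continuousOn := by
    have hsol : ContinuousOn (fun q : ℂ × (Fin 3 → ℝ) => sol (torusParam ε q.1 q.2))
        (ball 0 (fibreRadius ε) ×ˢ Set.univ) :=
      continuousOn_sol.comp (continuous_torusParam hε).continuousOn fun q hq =>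
        mem_ball_zero_iff.2 (norm_torusParam_lt hε (mem_ball_zero_iff.1 hq.1) q.2)
    have hv (i : Fin 3) := (continuous_apply i).comp_continuousOn hsol
    have hu (i : Fin 3) : ContinuousOn (fun q : ℂ × (Fin 3 → ℝ) => (ε : ℂ) * unitPt (q.2 i))
        (ball 0 (fibreRadius ε) ×ˢ Set.univ) :=
      (continuous_const.mul (continuous_unitPt.comp
        ((continuous_apply i).comp continuous_snd))).continuousOn
    refine continuousOn_pi.2 fun i => ?_
    fin_cases i
    exacts [continuousOn_const, hv 1, hu 0, hu 1, hv 0, hu 2, hv 2]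
  contDiff t ht := by
    have hsol : ContDiff ℝ 1 fun θ => sol (torusParam ε t θ) :=
      contDiff_iff_contDiffAt.2 fun θ => ((contDiffAt_sol
        (norm_torusParam_lt hε (mem_ball_zero_iff.1 ht) θ)).restrict_scalars ℝ).comp θ
        (contDiff_torusParam hε t).contDiffAt
    have hv (i : Fin 3) := contDiff_pi.1 hsol i
    have hu (i : Fin 3) : ContDiff ℝ 1 fun θ : Fin 3 → ℝ => (ε : ℂ) * unitPt (θ i) :=
      contDiff_const.mul (contDiff_unitPt_apply i)
    refine contDiff_pi.2 fun i => ?_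
    fin_cases i
    exacts [contDiff_const, hv 1, hu 0, hu 1, hv 0, hu 2, hv 2]
  periodic t _ θ j := by
    have h (i : Fin 3) : unitPt (Function.update θ j (θ j + 2 * Real.pi) i) = unitPt (θ i) := by
      by_cases hij : i = j
      · rw [hij, Function.update_self, unitPt_add_two_pi]
      · rw [Function.update_of_ne hij]
    simp only [solCycle, torusParam, h]
  mem_cone t ht θ := by
    have h0 (i : Fin 3) := ofReal_mul_unitPt_ne_zero hε (θ i)
    exact (chartPt_mem_cone_iff (h0 0) (h0 1) (h0 2) _).2
      (sol_eq (norm_torusParam_lt hε (mem_ball_zero_iff.1 ht) θ).le)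
  x0 _ _ _ := rfl
  x2 _ _ _ := rfl
  x3 _ _ _ := rfl
  x5 _ _ _ := rfl
  central θ := by
    simp [solCycle, torusParam_zero, sol_of_zero, chartPt]

/-- Along the segment from 0 to t the solution starts at 0. A solution of norm at most 1 has norm at
most 1/4, so by continuity it never leaves the ball where `sol` is the only one. -/
theorem IsTorusCycle.eq_solCycle {γ : ℂ → (Fin 3 → ℝ) → Fin 7 → ℂ}
    (hγ : IsTorusCycle ε (fibreRadius ε) γ) {t : ℂ} (ht : t ∈ ball (0 : ℂ) (fibreRadius ε))
    (θ : Fin 3 → ℝ) : γ t θ = solCycle ε t θ := by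
  let v : ℂ → Fin 3 → ℂ := fun s => ![γ s θ 4, γ s θ 1, γ s θ 6]
  have h0 (i : Fin 3) := ofReal_mul_unitPt_ne_zero hε (θ i)
  have hpt {s : ℂ} (hs : s ∈ ball (0 : ℂ) (fibreRadius ε)) : γ s θ =
      chartPt (ε * unitPt (θ 0)) (ε * unitPt (θ 1)) (ε * unitPt (θ 2)) (v s) := by
    funext i
    fin_cases i
    exacts [hγ.x0 s hs θ, rfl, hγ.x2 s hs θ, hγ.x3 s hs θ, rfl, hγ.x5 s hs θ, rfl]
  have hfix {s : ℂ} (hs : s ∈ ball (0 : ℂ) (fibreRadius ε)) : v s = sysMap (torusParam ε s θ) (v s) := by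
    have := hγ.mem_cone s hs θ
    rw [hpt hs] at this
    exact (chartPt_mem_cone_iff (h0 0) (h0 1) (h0 2) _).1 this
  have hle {s : ℂ} (hs : s ∈ ball (0 : ℂ) (fibreRadius ε)) (h1 : ‖v s‖ ≤ 1) : ‖v s‖ ≤ 1 / 4 := by
    rw [hfix hs]
    exact norm_sysMap_le (norm_torusParam_lt hε (mem_ball_zero_iff.1 hs) θ).le h1
  have hmem {s : ℝ} (hs : s ∈ Set.Icc (0 : ℝ) 1) : (s : ℂ) * t ∈ ball (0 : ℂ) (fibreRadius ε) := by
    rw [mem_ball_zero_iff] at ht ⊢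
    rw [norm_mul, norm_real, Real.norm_of_nonneg hs.1]
    nlinarith [norm_nonneg t, hs.2]
  have hc : ContinuousOn (fun s : ℝ => ‖v (s * t)‖) (Set.Icc 0 1) := by
    have h1 : ContinuousOn (fun s : ℝ => γ (s * t) θ) (Set.Icc 0 1) :=
      hγ.continuousOn.comp (f := fun s : ℝ => ((s : ℂ) * t, θ))
        (((continuous_ofReal.mul continuous_const).prodMk continuous_const).continuousOn)
        fun s hs => ⟨hmem hs, trivial⟩
    have h2 (i : Fin 7) := (continuous_apply i).comp_continuousOn h1
    refine ContinuousOn.norm (continuousOn_pi.2 fun i => ?_)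
    fin_cases i
    exacts [h2 4, h2 1, h2 6]
  have hv0 : ‖v ((0 : ℝ) * t)‖ = 0 := by
    obtain ⟨h1, h4, h6⟩ := hγ.central θ
    rw [ofReal_zero, zero_mul, norm_eq_zero]
    funext i
    fin_cases i
    exacts [h4, h1, h6]
  have hv1 : ‖v t‖ ≤ 1 := by
    -- A norm above 1 would force the value 1/2 somewhere on the segment, which `hle` excludes.
    by_contra! hlt
    have := intermediate_value_Icc zero_le_one hc
    obtain ⟨s, hs, hs'⟩ := this (show (1 / 2 : ℝ) ∈ _ by
      rw [hv0, ofReal_one, one_mul]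
      constructor <;> linarith)
    have := hle (hmem hs) (hs'.le.trans (by norm_num))
    simp only at hs'
    linarith
  rw [hpt ht, solCycle, eq_sol (norm_torusParam_lt hε (mem_ball_zero_iff.1 ht) θ).le hv1 (hfix ht)]

/-- On the torus dy = i y dθ, and likewise for z and w, so yzw cancels and α becomes (2π)⁻³ J⁻¹ dθ.
-/
theorem period_solCycle {t : ℂ} (ht : t ∈ ball (0 : ℂ) (fibreRadius ε)) :
    period t (solCycle ε t) = torusMean fun θ : Fin 3 → ℝ =>
      (sysJac (torusParam ε t θ) (sol (torusParam ε t θ)))⁻¹ := by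
  rw [period, torusMean, ← integral_const_mul]
  refine integral_congr_ae (.of_forall fun θ => ?_)
  have h0 (i : Fin 3) := ofReal_mul_unitPt_ne_zero hε (θ i)
  have hd (i j : Fin 3) : deriv (fun s : ℝ => (ε : ℂ) * unitPt (Function.update θ j s i)) (θ j) =
      if i = j then ε * unitPt (θ i) * I else 0 := by
    split_ifs with hij
    · subst hij
      simp only [Function.update_self, unitPt]
      have : HasDerivAt (fun s : ℝ => (ε : ℂ) * exp (s * I)) (ε * (exp (θ i * I) * (1 * I))) (θ i) :=
        ((((hasDerivAt_id (θ i)).ofReal_comp.mul_const I)).cexp).const_mul (ε : ℂ)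
      rw [this.deriv]
      ring
    · simp only [Function.update_of_ne hij, deriv_const]
  have hJ := sysJac_ne_zero (norm_torusParam_lt hε (mem_ball_zero_iff.1 ht) θ).le
    (norm_sol_le_one (norm_torusParam_lt hε (mem_ball_zero_iff.1 ht) θ).le)
  refine (alpha_chartPt (h0 0) (h0 1) (h0 2) _ (a := ε * unitPt (θ 0) * I)
    (b := ε * unitPt (θ 1) * I) (c := ε * unitPt (θ 2) * I) (fun j => ?_) (fun j => ?_) (fun j => ?_)
    (fun j => ?_)).trans ?_
  · exact deriv_const (θ j) (1 : ℂ)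
  · refine (hd 0 j).trans ?_
    fin_cases j <;> rfl
  · refine (hd 1 j).trans ?_
    fin_cases j <;> rfl
  · refine (hd 2 j).trans ?_
    fin_cases j <;> rfl
  · change _ / (_ * (_ * sysJac (torusParam ε t θ) _)) = _
    have h1 := h0 0
    have h2 := h0 1
    have h3 := h0 2
    generalize (ε : ℂ) * unitPt (θ 0) = y at h1 ⊢
    generalize (ε : ℂ) * unitPt (θ 1) = z at h2 ⊢
    generalize (ε : ℂ) * unitPt (θ 2) = w at h3 ⊢
    have hpi := two_pi_ne_zero'
    have hI := I_ne_zero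
    rw [mul_pow]
    generalize (2 * Real.pi : ℂ) = π₂ at hpi ⊢
    field_simp

end

theorem isPicardFuchs_periodSeries {r : ℝ} (hr : 0 < r) {Φ : ℂ → ℂ}
    (h : ∀ φ ∈ ball (0 : ℂ) r, HasSum (fun n : ℕ => (periodCoeff n : ℂ) * φ ^ n) (Φ φ)) :
    IsPicardFuchs D10 Φ := by
  refine isPicardFuchs_D10 (hasSeries_iff.2 ?_)
  filter_upwards [ball_mem_nhds (0 : ℂ) hr] with φ hφ
  simpa [periodSeries, mul_comm] using h φ hφ

end PfaffianMirror

/-! ### The theorem -/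

theorem mainTheorem5 (ε : ℝ) (hε : 0 < ε) :
    ∃ δ : ℝ, 0 < δ ∧
      (∃ γ, PfaffianMirror.IsTorusCycle ε δ γ) ∧
      ∀ γ, PfaffianMirror.IsTorusCycle ε δ γ →
        (∀ t ∈ Metric.ball (0 : ℂ) δ, ∀ θ,
          PfaffianMirror.dEqs t (γ t θ) PfaffianMirror.normalFrame ≠ 0) ∧
        ∃ Φ : ℂ → ℂ,
          (∀ t ∈ Metric.ball (0 : ℂ) δ, PfaffianMirror.period t (γ t) = Φ (t ^ 8)) ∧
          (∀ φ ∈ Metric.ball (0 : ℂ) (δ ^ 8),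
            HasSum (fun n : ℕ => (PfaffianMirror.periodCoeff n : ℂ) * φ ^ n) (Φ φ)) ∧
          PfaffianMirror.IsPicardFuchs PfaffianMirror.D10 Φ := by
  open PfaffianMirror Metric in
  have hδ := fibreRadius_pos hε
  refine ⟨fibreRadius ε, hδ, ⟨_, isTorusCycle_solCycle hε⟩, fun γ hγ => ⟨fun t ht θ => ?_, ?_⟩⟩
  · have h0 (i : Fin 3) := ofReal_mul_unitPt_ne_zero hε (θ i)
    have hp := (norm_torusParam_lt hε (mem_ball_zero_iff.1 ht) θ).le
    rw [hγ.eq_solCycle hε ht, solCycle, dEqs_chartPt (h0 0) (h0 1) (h0 2)]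
    exact mul_ne_zero (mul_ne_zero (mul_ne_zero (h0 0) (h0 1)) (pow_ne_zero 2 (h0 2)))
      (sysJac_ne_zero hp (norm_sol_le_one hp))
  · have hsum : ∀ φ ∈ ball (0 : ℂ) (fibreRadius ε ^ 8),
        HasSum (fun n : ℕ => (periodCoeff n : ℂ) * φ ^ n) (∑' n, (periodCoeff n : ℂ) * φ ^ n) := by
      intro φ hφ
      -- Convergence at φ is read off from the period at an eighth root t of φ, which lies in the
      -- disc of radius δ.
      obtain ⟨t, rfl⟩ := IsAlgClosed.exists_pow_nat_eq φ (n := 8) (by norm_num)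
      rw [mem_ball_zero_iff, norm_pow] at hφ
      exact (hasSum_torusMean_inv_sysJac hε
        (lt_of_pow_lt_pow_left₀ 8 hδ.le hφ)).summable.hasSum
    refine ⟨fun φ => ∑' n, (periodCoeff n : ℂ) * φ ^ n, fun t ht => ?_, hsum,
      isPicardFuchs_periodSeries (by positivity) hsum⟩
    rw [funext fun θ => hγ.eq_solCycle hε ht θ, period_solCycle hε ht]
    exact (hasSum_torusMean_inv_sysJac hε (mem_ball_zero_iff.1 ht)).tsum_eq.symm
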